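/- **Machine model.** We use a random access machine (RAM) with registers $R_0,R_1,\dots$ and memory cells $M[0],M[1],\dots$, all holding natural numbers. A program is a finite list of instructions: loading a constant, copying, $+$, truncated subtraction, $\cdot$, indirect load and store, unconditional jump and jumps on $=$ and $<$, printing a register, printing a separator $\#$, halting, and one further binary operation $\mathrm{op}$ on register contents. Every instruction takes one time unit. **Objects.** Let $\mathcal C$ be a category. A vertex-labelled $\mathcal C$-decorated binary DAG $\mathcal D=(V,E,\lambda,\gamma)$ is a finite directed acyclic graph in which every vertex is either a leaf, with a label from a finite set $\Sigma_0$, or has exactly one left and one right outgoing edge and a label from a finite set $\Sigma_2$; $\gamma$ maps every vertex $v$ to an object $\gamma(v)$ of $\mathcal C$ and every edge from $u$ to $v$ to a morphism $\gamma(u)\to\gamma(v)$. For a path $\pi$, $\gamma(\pi)$ is the composition of the morphisms of its edges (the identity if $\pi$ is empty), and $|\mathcal D|=|V|+|E|$. For $v_0\in V$, $\mathsf{unfold}_{\mathcal D}(v_0)$ is the binary tree whose vertices are the paths of $\mathcal D$ starting in $v_0$. A leaf $p$ of this tree is a path from $v_0$ to a leaf of $\mathcal D$, and $\gamma^*(p)=\gamma(p)$;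 for a set $S$ of leaves, $\gamma^*(S)$ is the multiset $\{\!\{\gamma^*(p):p\in S\}\!\}$. A (leaf-selecting) deterministic bottom-up tree automaton (dBUTA) $\mathcal B$ has a finite state set $Q$, maps $\delta_0:\Sigma_0\times\{0,1\}\to Q$ and $\delta_2:Q\times Q\times\Sigma_2\to Q$, and final states $Q_f\subseteq Q$; $\mathsf{select}(\mathcal B,T)$ is the set of all sets $S$ of leaves of the binary tree $T$ such that $\mathcal B$ evaluates $T$, with the leaves in $S$ marked by $1$ and the other leaves marked by $0$, to a final state. **Register assumption with length $w$.** The number of vertices of $\mathcal D$ is at most $2^w$; morphisms are coded by natural numbers such that the code of $\gamma(\pi)$ is less than $2^w$ for every path $\pi$ of $\mathcal D$; and for all paths $\pi_1,\pi_2$ such that $\pi_1$ ends where $\pi_2$ starts, $\mathrm{op}$ maps the codes of $\gamma(\pi_1)$ and $\gamma(\pi_2)$ to the code of $\gamma(\pi_1)\circ\gamma(\pi_2)$ (so morphisms of composable paths are composed in constant time). Moreover, $|Q|$, $|\Sigma_0|$ and $|\Sigma_2|$ are at most $2^w$. **Theorem.** Fix a category $\mathcal C$. There are two RAM programs, a preprocessing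 program and an enumeration program, and a constant $c$ such that the following holds for every dBUTA $\mathcal B$ with $m$ states, every vertex-labelled $\mathcal C$-decorated binary DAG $\mathcal D=(V,E,\lambda,\gamma)$ and every $w$, coding and operation $\mathrm{op}$ satisfying the register assumption. The input is written into the memory as follows: the vertices, the states and the labels are numbered in an arbitrary way; the memory contains $|V|, m, |\Sigma_0|, |\Sigma_2|$, then for every vertex its type (leaf or internal), label, children and the codes of the decorations of the vertex (an object being represented by its identity morphism) and of its outgoing edges, and then the tables of $\delta_0$, $\delta_2$ and $Q_f$. 1. The preprocessing program, started on this input, halts after at most $c\cdot(|\mathcal D|\cdot m^2+1)$ steps. The resulting memory content is the data structure. 2. For every $v_0\in V$, the enumeration program, started on this data structure with $v_0$ in $R_0$, enumerates the multiset $$\{\!\{\gamma^*(S) : S\in\mathsf{select}(\mathcal B,\mathsf{unfold}_{\mathcal D}(v_0))\}\!\}$$ with output-linear delay: it prints a sequence $s_1,\dots,s_k$, each $s_i$ being a list of (codes of) morphisms followed by $\#$, such that the multiset of the $s_i$, read as multisets, is the above multiset. If $t_1=0$ and, for $1\le i\le k$, $t_{i+1}$ is the time when the output of $s_i$ is complete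 (so that the output of the next object starts), then $t_{i+1}-t_i\le c\cdot(|s_i|+1)$ for all $1\le i\le k$, where $|s_i|$ is the number of elements of $s_i$; and the program halts (end of enumeration) by time $t_{k+1}+c$. 3. During both phases all register and memory contents are less than $2^{c(w+|\mathcal D|+1)}$. -/

import Mathlib

universe v u

open CategoryTheory

namespace DAGEnum

/-! ### A random access machine with a step count -/

/-- Instructions of the RAM. The arguments `d a b` are indices of registers, `k` is a constant
and `l` is a position in the program. -/
inductive Instr : Type
  /-- `R_d := k` -/
  | const (d k : ℕ)
  /-- `R_d := R_a` -/
  | copy (d a : ℕ)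
  /-- `R_d := R_a + R_b` -/
  | add (d a b : ℕ)
  /-- `R_d := max (R_a - R_b) 0` -/
  | sub (d a b : ℕ)
  /-- `R_d := R_a * R_b` -/
  | mul (d a b : ℕ)
  /-- `R_d := R_a ∘ R_b`, where `R_a` and `R_b` hold codes of morphisms -/
  | comp (d a b : ℕ)
  /-- `R_d := M[R_a]` -/
  | load (d a : ℕ)
  /-- `M[R_a] := R_b` -/
  | store (a b : ℕ)
  /-- unconditional jump -/
  | jump (l : ℕ)
  /-- jump to `l` if `R_a = R_b` -/
  | jeq (a b l : ℕ)
  /-- jump to `l` if `R_a < R_b` -/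
  | jlt (a b l : ℕ)
  /-- print the content of `R_a` -/
  | print (a : ℕ)
  /-- print the separator `#` that ends the current output object -/
  | sep
  /-- stop; in an enumeration this is the end-of-enumeration marker -/
  | halt

/-- A program is a finite sequence of instructions. -/
abbrev Program : Type := List Instr

/-- Configurations of the RAM: program counter, registers, memory, and everything printed so far,
where `some x` stands for a printed register content `x` and `none` for the separator `#`. -/
structure Config : Type where
  pc : ℕ
  reg : ℕ → ℕ
  mem : ℕ → ℕ
  out : List (Option ℕ)

namespace Config

/-- Write `x` into register `d` and go to the next instruction. -/
def setReg (σ : Config) (d x : ℕ) : Config :=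
  { σ with pc := σ.pc + 1, reg := Function.update σ.reg d x }

/-- Write `x` into memory cell `a` and go to the next instruction. -/
def setMem (σ : Config) (a x : ℕ) : Config :=
  { σ with pc := σ.pc + 1, mem := Function.update σ.mem a x }

/-- Print `x` and go to the next instruction. -/
def emit (σ : Config) (x : Option ℕ) : Config :=
  { σ with pc := σ.pc + 1, out := σ.out ++ [x] }

/-- Go to `l` if `b` holds and to the next instruction otherwise. -/
def branch (σ : Config) (b : Bool) (l : ℕ) : Config :=
  { σ with pc := if b then l else σ.pc + 1 }

/-- All register and memory contents are numbers with at most `W` bits. (Addresses that are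
accessed are register contents, so they are covered as well.) -/
def Fits (W : ℕ) (σ : Config) : Prop :=
  (∀ r, σ.reg r < 2 ^ W) ∧ ∀ a, σ.mem a < 2 ^ W

end Config

/-- The effect of one instruction; `op` is the operation carried out by `Instr.comp`. -/
def Instr.exec (op : ℕ → ℕ → ℕ) (σ : Config) : Instr → Config
  | .const d k => σ.setReg d k
  | .copy d a => σ.setReg d (σ.reg a)
  | .add d a b => σ.setReg d (σ.reg a + σ.reg b)
  | .sub d a b => σ.setReg d (σ.reg a - σ.reg b)
  | .mul d a b => σ.setReg d (σ.reg a * σ.reg b)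
  | .comp d a b => σ.setReg d (op (σ.reg a) (σ.reg b))
  | .load d a => σ.setReg d (σ.mem (σ.reg a))
  | .store a b => σ.setMem (σ.reg a) (σ.reg b)
  | .jump l => σ.branch true l
  | .jeq a b l => σ.branch (decide (σ.reg a = σ.reg b)) l
  | .jlt a b l => σ.branch (decide (σ.reg a < σ.reg b)) l
  | .print a => σ.emit (some (σ.reg a))
  | .sep => σ.emit none
  | .halt => σ

/-- One time unit; a machine whose program counter points outside of the program has stopped. -/
def step (op : ℕ → ℕ → ℕ) (P : Program) (σ : Config) : Config :=
  match P[σ.pc]? with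
  | some i => i.exec op σ
  | none => σ

/-- The configuration after `t` time units. -/
def run (op : ℕ → ℕ → ℕ) (P : Program) (t : ℕ) (σ : Config) : Config :=
  (step op P)^[t] σ

/-- The machine has stopped. -/
def Halted (P : Program) (σ : Config) : Prop :=
  P[σ.pc]? = none ∨ P[σ.pc]? = some Instr.halt

/-- The initial configuration for an input that is written into the memory cells `0, 1, 2, …`. -/
def initConfig (input : List ℕ) : Config :=
  { pc := 0, reg := fun _ => 0, mem := fun a => input.getD a 0, out := [] }

/-- The configuration in which an enumeration phase starts: the memory contains the data structure,
register `0` contains the query. -/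
def queryConfig (mem : ℕ → ℕ) (query : ℕ) : Config :=
  { pc := 0, reg := fun r => if r = 0 then query else 0, mem := mem, out := [] }

/-- The word that is printed when the objects in the list are output one after the other. -/
def printed (L : List (List ℕ)) : List (Option ℕ) :=
  L.flatMap fun s => s.map some ++ [none]

/-- Started in `σ`, the program `P` enumerates the multiset `S` (each of whose elements is itself a
finite multiset of register contents) with output-linear delay and delay constant `c`.
The output sequence is `L = (s₀, …, s_{k-1})`, `t i` is the time when the output of `sᵢ` starts
(the first moment when all earlier objects have been output), and the machine stops
(end-of-enumeration) at most `c` steps after it has finished `s_{k-1}`. -/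
def EnumeratesLinearDelay (op : ℕ → ℕ → ℕ) (P : Program) (c : ℕ) (σ : Config)
    (S : Multiset (Multiset ℕ)) : Prop :=
  ∃ (L : List (List ℕ)) (t : ℕ → ℕ),
    ((L.map fun s => (s : Multiset ℕ) : List (Multiset ℕ)) : Multiset (Multiset ℕ)) = S ∧
    t 0 = 0 ∧
    (∀ (i : ℕ) (hi : i < L.length),
      t i ≤ t (i + 1) ∧ t (i + 1) - t i ≤ c * (L[i].length + 1)) ∧
    (∀ i ≤ L.length, (run op P (t i) σ).out = printed (L.take i) ∧
      ∀ t' < t i, (run op P t' σ).out ≠ printed (L.take i)) ∧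
    ∃ T, t L.length ≤ T ∧ T ≤ t L.length + c ∧
      Halted P (run op P T σ) ∧ (run op P T σ).out = printed L

/-! ### Decorated binary trees and tree automata -/

/-- Vertex-labelled binary trees (leaves are labelled in `A`, internal vertices in `F`) decorated by
the category `C`; the index is the object that decorates the root. -/
inductive DecTree (C : Type u) [Category.{v} C] (A F : Type) : C → Type (max u v)
  | leaf (x : C) (a : A) : DecTree C A F x
  | node {x y z : C} (f : F) (α : x ⟶ y) (β : x ⟶ z)
      (l : DecTree C A F y) (r : DecTree C A F z) : DecTree C A F x

namespace DecTree

variable {C : Type u} [Category.{v} C] {A F : Type}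

/-- The leaves of a tree. -/
def Leaves : {x : C} → DecTree C A F x → Type
  | _, leaf _ _ => Unit
  | _, node _ _ _ l r => Leaves l ⊕ Leaves r

/-- A tree has finitely many leaves. -/
instance instFintypeLeaves : {x : C} → (T : DecTree C A F x) → Fintype T.Leaves
  | _, leaf _ _ => inferInstanceAs (Fintype Unit)
  | _, node _ _ _ l r =>
    letI := instFintypeLeaves l
    letI := instFintypeLeaves r
    inferInstanceAs (Fintype (Leaves l ⊕ Leaves r))

/-- Equality of leaves is decidable. -/
instance instDecidableEqLeaves : {x : C} → (T : DecTree C A F x) → DecidableEq T.Leaves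
  | _, leaf _ _ => inferInstanceAs (DecidableEq Unit)
  | _, node _ _ _ l r =>
    letI := instDecidableEqLeaves l
    letI := instDecidableEqLeaves r
    inferInstanceAs (DecidableEq (Leaves l ⊕ Leaves r))

/-- The morphism `γ*(p)` of a leaf `p`, the composition of the decorations along the path from
the root to `p`, together with its target. -/
def leafMor : {x : C} → (T : DecTree C A F x) → T.Leaves → Σ y : C, (x ⟶ y)
  | x, leaf _ _ => fun _ => ⟨x, 𝟙 x⟩
  | _, node _ α β l r =>
    Sum.elim (fun p => ⟨(leafMor l p).1, α ≫ (leafMor l p).2⟩)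
      (fun p => ⟨(leafMor r p).1, β ≫ (leafMor r p).2⟩)

/-- The multiset `γ*(S)` of a set of leaves `S`. -/
def setMor {x : C} (T : DecTree C A F x) (S : Finset T.Leaves) : Multiset (Σ y : C, (x ⟶ y)) :=
  S.val.map T.leafMor

/-- Extend the label of every leaf by a mark. -/
def mark : {x : C} → (T : DecTree C A F x) → (T.Leaves → Bool) → DecTree C (A × Bool) F x
  | _, leaf x a, s => leaf x (a, s ())
  | _, node f α β l r, s =>
    node f α β (mark l fun p => s (Sum.inl p)) (mark r fun p => s (Sum.inr p))

end DecTree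

/-- Deterministic bottom-up tree automata with state set `Q`, leaf labels in `A` and labels of
internal vertices in `F`. -/
structure DBUTA (Q A F : Type) : Type where
  δ₀ : A → Q
  δ₂ : Q → Q → F → Q
  final : Finset Q

namespace DBUTA

variable {C : Type u} [Category.{v} C] {Q A F : Type}

/-- The state to which the automaton evaluates a tree (decorations are ignored). -/
def eval (B : DBUTA Q A F) : {x : C} → DecTree C A F x → Q
  | _, .leaf _ a => B.δ₀ a
  | _, .node f _ _ l r => B.δ₂ (eval B l) (eval B r) f

/-- `select(B, T)`: the sets of leaves of `T` such that `T`, with the leaves in this set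
marked by `1` and the others by `0`, is accepted. -/
def select [DecidableEq Q] (B : DBUTA Q (A × Bool) F) {x : C} (T : DecTree C A F x) :
    Finset (Finset T.Leaves) :=
  Finset.univ.filter fun S => B.eval (T.mark fun p => decide (p ∈ S)) ∈ B.final

end DBUTA

/-! ### Decorated binary DAGs -/

/-- Edges of a binary directed graph that is given by the map `node`; `false` is the direction
"left" and `true` the direction "right". -/
def IsEdge {A F V : Type} (node : V → A ⊕ (F × V × V)) (x : V) (d : Bool) (y : V) : Prop :=
  ∃ f l r, node x = Sum.inr (f, l, r) ∧ y = if d then r else l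

/-- Vertex-labelled binary DAGs with vertices `0, …, n-1`. A vertex is either a leaf with a label
from `A`, or an internal vertex with a label from `F`, a left child and a right child. -/
structure BinDAG (A F : Type) : Type where
  n : ℕ
  node : Fin n → A ⊕ (F × Fin n × Fin n)
  acyclic : ∀ x, ¬ Relation.TransGen (fun y z => ∃ d, IsEdge node y d z) x x

namespace BinDAG

variable {A F : Type}

/-- The vertices. -/
def V (D : BinDAG A F) : Type := Fin D.n

/-- The edges `(x, d, y)`. -/
def Edge (D : BinDAG A F) (x : D.V) (d : Bool) (y : D.V) : Prop :=
  IsEdge D.node x d y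

instance instQuiver (D : BinDAG A F) : Quiver D.V where
  Hom x y := {d : Bool // D.Edge x d y}

/-- The size: number of vertices plus number of edges. -/
noncomputable def size (D : BinDAG A F) : ℕ :=
  D.n + Nat.card {e : D.V × Bool × D.V // D.Edge e.1 e.2.1 e.2.2}

/-- The relation "is a child of" is well-founded. -/
theorem wf (D : BinDAG A F) : WellFounded fun y x : D.V => ∃ d, D.Edge x d y := by
  have : Finite D.V := inferInstanceAs (Finite (Fin D.n))
  have h : WellFounded (Relation.TransGen fun y x : D.V => ∃ d, D.Edge x d y) := by
    have : Std.Irrefl (Relation.TransGen fun y x : D.V => ∃ d, D.Edge x d y) :=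
      ⟨fun x hx => D.acyclic x (Relation.transGen_swap.1 hx)⟩
    exact Finite.wellFounded_of_trans_of_irrefl _
  exact Subrelation.wf (fun hxy => Relation.TransGen.single hxy) h

end BinDAG

/-- Vertex-labelled binary DAGs decorated by the category `C`: `γ` maps vertices to objects and an
edge from `x` to `y` to a morphism from `γ x` to `γ y`. -/
structure DecDAG (C : Type u) [Category.{v} C] (A F : Type) extends BinDAG A F where
  γ : toBinDAG.V ⥤q C

namespace DecDAG

variable {C : Type u} [Category.{v} C] {A F : Type}

/-- The left outgoing edge of an internal vertex. -/
def leftEdge (D : DecDAG C A F) {x l r : D.V} {f : F} (h : D.node x = Sum.inr (f, l, r)) :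
    x ⟶ l :=
  ⟨false, f, l, r, h, rfl⟩

/-- The right outgoing edge of an internal vertex. -/
def rightEdge (D : DecDAG C A F) {x l r : D.V} {f : F} (h : D.node x = Sum.inr (f, l, r)) :
    x ⟶ r :=
  ⟨true, f, l, r, h, rfl⟩

/-- The morphism `γ(π)` of a path `π`; it is the identity if `π` is empty. -/
def pathMor (D : DecDAG C A F) {x y : D.V} (π : Quiver.Path x y) : D.γ.obj x ⟶ D.γ.obj y :=
  composePath (D.γ.mapPath π)

/-- The unfolding of the DAG from the vertex `x`, a decorated tree. -/
def unfold (D : DecDAG C A F) (x : D.V) : DecTree C A F (D.γ.obj x) :=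
  match h : D.node x with
  | Sum.inl a => .leaf _ a
  | Sum.inr (f, l, r) =>
    .node f (D.γ.map (D.leftEdge h)) (D.γ.map (D.rightEdge h)) (D.unfold l) (D.unfold r)
termination_by D.wf.wrap x
decreasing_by
  · exact ⟨false, f, l, r, h, rfl⟩
  · exact ⟨true, f, l, r, h, rfl⟩

end DecDAG

/-! ### Representation of the input in memory, and the register assumption -/

section Input

variable {C : Type u} [Category.{v} C] {m s₀ s₂ : ℕ}

/-- The assumption that, with respect to the coding `code` of morphisms by numbers, vertices and
morphisms of paths fit into registers of length `w`, and that the operation `op` of the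
machine composes morphisms of composable paths. -/
structure RegisterAssumption {A F : Type} (D : DecDAG C A F)
    (code : ∀ x y : C, (x ⟶ y) → ℕ) (op : ℕ → ℕ → ℕ) (w : ℕ) : Prop where
  vertex_fits : D.n ≤ 2 ^ w
  mor_fits : ∀ {x y : D.V} (π : Quiver.Path x y), code _ _ (D.pathMor π) < 2 ^ w
  op_eq : ∀ {x y z : D.V} (π₁ : Quiver.Path x y) (π₂ : Quiver.Path y z),
    op (code _ _ (D.pathMor π₁)) (code _ _ (D.pathMor π₂)) = code _ _ (D.pathMor π₁ ≫ D.pathMor π₂)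

/-- The record of seven memory cells for the vertex `x`: whether it is internal, its label, its
left and right child, the object `γ x` (represented by its identity morphism), and the morphisms
of the left and of the right outgoing edge. -/
def vertexRecord (D : DecDAG C (Fin s₀) (Fin s₂)) (code : ∀ x y : C, (x ⟶ y) → ℕ)
    (x : D.V) : List ℕ :=
  match h : D.node x with
  | Sum.inl a => [0, a.val, 0, 0, code _ _ (𝟙 (D.γ.obj x)), 0, 0]
  | Sum.inr (f, l, r) =>
    [1, f.val, l.val, r.val, code _ _ (𝟙 (D.γ.obj x)),
      code _ _ (D.γ.map (D.leftEdge h)), code _ _ (D.γ.map (D.rightEdge h))]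

/-- The tables of the automaton: `δ₀ (a, b)` at position `2 * a + b`, then `δ₂ p q f` at position
`(f * m + p) * m + q`, then the characteristic function of the set of final states. -/
def automatonTables (B : DBUTA (Fin m) (Fin s₀ × Bool) (Fin s₂)) : List ℕ :=
  ((List.finRange s₀).flatMap fun a => [(B.δ₀ (a, false)).val, (B.δ₀ (a, true)).val]) ++
  ((List.finRange s₂).flatMap fun f => (List.finRange m).flatMap fun p =>
    (List.finRange m).map fun q => (B.δ₂ p q f).val) ++
  ((List.finRange m).map fun q => if q ∈ B.final then 1 else 0)

/-- The input: the four sizes, the records of the vertices, and the tables of the automaton. -/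
def encodeInput (B : DBUTA (Fin m) (Fin s₀ × Bool) (Fin s₂))
    (D : DecDAG C (Fin s₀) (Fin s₂)) (code : ∀ x y : C, (x ⟶ y) → ℕ) : List ℕ :=
  [D.n, m, s₀, s₂] ++
  ((List.finRange D.n).flatMap fun x => vertexRecord D code x) ++
  automatonTables B

/-- The multiset of all `γ*(S)` with `S` in `select(B, unfold(x))`, with every morphism
replaced by its code. -/
def answers (B : DBUTA (Fin m) (Fin s₀ × Bool) (Fin s₂))
    (D : DecDAG C (Fin s₀) (Fin s₂)) (code : ∀ x y : C, (x ⟶ y) → ℕ) (x : D.V) :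
    Multiset (Multiset ℕ) :=
  (B.select (D.unfold x)).val.map fun S =>
    ((D.unfold x).setMor S).map fun α => code _ _ α.2

end Input

end DAGEnum

/-! For a vertex `x` and a state `q`, consider the multiset of all γ*(S), where S is a nonempty set
of leaves of the unfolding of `x` whose marking evaluates to `q`. The automaton is deterministic, so
every S has exactly one state, and at an inner vertex with children l, r this multiset splits into a
sum over pairs of child states: selections that are nonempty on both sides give sums of a left and a
right element, selections that are nonempty on one side give the multiset of that side, the other
side being in its fixed state for the empty selection (`properSols_node`, `vertexSols_node`). Hence
it is represented by a tree with leaves, products and unions (`Tr`). Links between nodes carry paths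
of the DAG, and the path collected on the way down is the one whose morphism is printed at a leaf. A
tree of a child is therefore never copied: it is linked with the edge composed in front, and all
trees share memory. A depth-first search that finishes children before parents creates a number of
nodes quadratic in the number of states for each vertex.

Leaving out the empty selection makes output-linear delay possible. Every stored tree has a solution
and every solution has an element (`Tr.sols_ne_zero`, `Tr.card_pos_of_mem_sols`), so the enumeration
never runs into a dead end and each pending factor of a product ends up as at least one printed
element. With o leaves chosen and g goals pending, expanding a leaf or a product raises 2o + g by
exactly one, which bounds the time for one solution linearly in its size (`exec_forward`). The empty
selection is tested and printed separately.

Chains of unions would spoil this, so each union also stores the address of its leftmost subtree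
that is not a union and the code of the composed path to it. The machine jumps there at once and
leaves a single choice point at the upper union. On return it takes the right subtree of that union
and, if the left subtree is itself a union, pushes a choice point for the latter
(`Tr.sols_eq_add_rest`, `wp_descend`, `wp_backtrack`). All of this takes constant time.

For the bound on register contents, subtrees are stored below their parents, so a choice point of
five cells is paid for by the decrease of the address of the tree; the addresses in use are bounded
through 2o + g (`addrBound`). Solutions have at most as many elements as the unfolding has leaves,
which is at most 2 to the number of vertices (`card_leaves_le_two_pow`); this is where the size of
the graph enters the exponent.

The programs are written in a small structured language. `Exec.reach` shows that compiled code
follows the structured semantics with exact running times and bounded registers; `Tri` and `Cmd.wp`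
serve to verify structured programs; `Enumer.enumeratesLinearDelay` converts a loop that prints one
object per round into the required notion of delay. Trees speak of abstract paths with a coding, so
that the composition instruction is only reasoned about on codes of composable paths, as the
register assumption demands. -/

namespace DAGEnum

set_option linter.unusedSimpArgs false

/-! ### A structured language on top of the RAM -/

/-- The variables of structured programs. -/
inductive Var : Type
  | query | cnt | states | tabLeaf | tabNode | fin | table | width | stack | heap
  | vert | depth | cur | row | record | lrow | rrow | lempty | rempty | lmor | rmor | ident | label
  | i | j | p | q | cell | tgt | mor | goals | outs | choices | saved | smor | old | omor
  deriving DecidableEq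

namespace Var

/-- The number of a variable. -/
def idx : Var → ℕ
  | query => 0 | cnt => 1 | states => 2 | tabLeaf => 3 | tabNode => 4 | fin => 5 | table => 6
  | width => 7 | stack => 8 | heap => 9 | vert => 10 | depth => 11 | cur => 12 | row => 13
  | record => 14 | lrow => 15 | rrow => 16 | lempty => 17 | rempty => 18 | lmor => 19 | rmor => 20
  | ident => 21 | label => 22 | i => 23 | j => 24 | p => 25 | q => 26 | cell => 27 | tgt => 28
  | mor => 29 | goals => 30 | outs => 31 | choices => 32 | saved => 33 | smor => 34
  | old => 35 | omor => 36

theorem idx_injective : Function.Injective idx := by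
  intro a b h
  -- An explicit left inverse avoids comparing all pairs of variables.
  have key : ∀ a : Var, (fun k => [query, cnt, states, tabLeaf, tabNode, fin, table, width, stack,
      heap, vert, depth, cur, row, record, lrow, rrow, lempty, rempty, lmor, rmor, ident, label,
      Var.i, j, p, q, cell, tgt, mor, goals, outs, choices, saved, smor, old, omor].getD k query) (idx a)
      = a := by
    intro a; cases a <;> rfl
  rw [← key a, ← key b, h]

/-- The register of a variable. -/
def reg (x : Var) : ℕ := 2 * x.idx

end Var

/-- The registers for intermediate results. -/
def tmp (k : ℕ) : ℕ := 2 * k + 1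

/-- States of structured programs. -/
structure St : Type where
  var : Var → ℕ
  mem : ℕ → ℕ
  out : List (Option ℕ)

namespace St

/-- Assign a value to a variable. -/
def set (s : St) (x : Var) (k : ℕ) : St := { s with var := Function.update s.var x k }

/-- Write a value into the memory. -/
def put (s : St) (a k : ℕ) : St := { s with mem := Function.update s.mem a k }

/-- Print a symbol. -/
def emit (s : St) (k : Option ℕ) : St := { s with out := s.out ++ [k] }

@[simp] theorem set_var (s : St) (x y : Var) (k : ℕ) :
    (s.set x k).var y = if y = x then k else s.var y := Function.update_apply ..
@[simp] theorem set_mem (s : St) (x : Var) (k : ℕ) : (s.set x k).mem = s.mem := rfl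
@[simp] theorem set_out (s : St) (x : Var) (k : ℕ) : (s.set x k).out = s.out := rfl
@[simp] theorem put_var (s : St) (a k : ℕ) : (s.put a k).var = s.var := rfl
@[simp] theorem put_mem (s : St) (a k : ℕ) : (s.put a k).mem = Function.update s.mem a k := rfl
@[simp] theorem put_out (s : St) (a k : ℕ) : (s.put a k).out = s.out := rfl
@[simp] theorem emit_var (s : St) (k : Option ℕ) : (s.emit k).var = s.var := rfl
@[simp] theorem emit_mem (s : St) (k : Option ℕ) : (s.emit k).mem = s.mem := rfl
@[simp] theorem emit_out (s : St) (k : Option ℕ) : (s.emit k).out = s.out ++ [k] := rfl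

/-- All values are numbers with at most `N` bits. -/
def Bounded (N : ℕ) (s : St) : Prop := (∀ x, s.var x < 2 ^ N) ∧ ∀ a, s.mem a < 2 ^ N

theorem Bounded.set {N : ℕ} {s : St} (h : s.Bounded N) {x : Var} {k : ℕ} (hk : k < 2 ^ N) :
    (s.set x k).Bounded N := by
  refine ⟨fun y => ?_, h.2⟩
  rw [set_var]; split_ifs
  exacts [hk, h.1 y]

theorem Bounded.put {N : ℕ} {s : St} (h : s.Bounded N) {a k : ℕ} (hk : k < 2 ^ N) :
    (s.put a k).Bounded N := by
  refine ⟨h.1, fun b => ?_⟩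
  rw [put_mem, Function.update_apply]; split_ifs
  exacts [hk, h.2 b]

end St

/-- Expressions. -/
inductive Ex : Type
  | num (k : ℕ)
  | var (x : Var)
  | add (a b : Ex)
  | sub (a b : Ex)
  | mul (a b : Ex)
  | mem (a : Ex)

namespace Ex

instance : Coe Var Ex := ⟨var⟩
instance (k : ℕ) : OfNat Ex k := ⟨num k⟩
instance : Add Ex := ⟨add⟩
instance : Sub Ex := ⟨sub⟩
instance : Mul Ex := ⟨mul⟩

/-- The value of an expression. -/
def eval (s : St) : Ex → ℕ
  | num k => k
  | var x => s.var x
  | add a b => a.eval s + b.eval s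
  | sub a b => a.eval s - b.eval s
  | mul a b => a.eval s * b.eval s
  | mem a => s.mem (a.eval s)

section
variable (s : St) (a b : Ex)
@[simp] theorem eval_num (k : ℕ) : (num k).eval s = k := rfl
@[simp] theorem eval_ofNat (k : ℕ) : (ofNat(k) : Ex).eval s = ofNat(k) := rfl
@[simp] theorem eval_var (x : Var) : (var x).eval s = s.var x := rfl
@[simp] theorem eval_add : (a + b).eval s = a.eval s + b.eval s := rfl
@[simp] theorem eval_sub : (a - b).eval s = a.eval s - b.eval s := rfl
@[simp] theorem eval_mul : (a * b).eval s = a.eval s * b.eval s := rfl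
@[simp] theorem eval_mem : (mem a).eval s = s.mem (a.eval s) := rfl
end

/-- Code that writes the value of an expression into the `k`-th intermediate register. -/
def code : Ex → ℕ → List Instr
  | num c, k => [.const (tmp k) c]
  | var x, k => [.copy (tmp k) x.reg]
  | add a b, k => a.code k ++ (b.code (k + 1) ++ [.add (tmp k) (tmp k) (tmp (k + 1))])
  | sub a b, k => a.code k ++ (b.code (k + 1) ++ [.sub (tmp k) (tmp k) (tmp (k + 1))])
  | mul a b, k => a.code k ++ (b.code (k + 1) ++ [.mul (tmp k) (tmp k) (tmp (k + 1))])
  | mem a, k => a.code k ++ [.load (tmp k) (tmp k)]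

/-- The length of the code of an expression. -/
def len : Ex → ℕ
  | num _ => 1
  | var _ => 1
  | add a b => a.len + (b.len + 1)
  | sub a b => a.len + (b.len + 1)
  | mul a b => a.len + (b.len + 1)
  | mem a => a.len + 1

@[simp] theorem length_code (e : Ex) (k : ℕ) : (e.code k).length = e.len := by
  induction e generalizing k <;> simp_all [code, len]

/-- A factor by which the evaluation of an expression increases the number of bits. -/
def weight : Ex → ℕ
  | num k => k + 1
  | var _ => 1
  | add a b => a.weight + b.weight
  | sub a b => a.weight + b.weight
  | mul a b => a.weight + b.weight
  | mem a => a.weight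

theorem weight_pos (e : Ex) : 0 < e.weight := by
  induction e <;> simp_all [weight]

/-- Two powers of two that are at least 2 have a sum that is at most their product, so weights can
be added for `+` just as for `*`. Only assigned values are kept within `N` bits; this controls the
longer intermediate results, whose length is a constant multiple of `N`. -/
theorem eval_lt {N : ℕ} (hN : 0 < N) {s : St} (hs : s.Bounded N) (e : Ex) :
    e.eval s < 2 ^ (N * e.weight) := by
  have two_le : ∀ e : Ex, 2 ≤ 2 ^ (N * e.weight) := fun e =>
    Nat.le_self_pow (Nat.mul_pos hN e.weight_pos).ne' 2
  induction e with
  | num k =>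
    have h1 : k < 2 ^ k := Nat.lt_two_pow_self
    exact h1.trans_le (Nat.pow_le_pow_right (by norm_num) (by simp only [weight]; nlinarith))
  | var x => simpa [weight] using hs.1 x
  | add a b iha ihb =>
    have ha := two_le a
    have hb := two_le b
    simp only [eval, weight, mul_add, pow_add]
    nlinarith
  | sub a b iha ihb =>
    refine (Nat.sub_le _ _).trans_lt (iha.trans_le (Nat.pow_le_pow_right (by norm_num) ?_))
    simp only [weight]; nlinarith
  | mul a b iha ihb =>
    simp only [eval, weight, mul_add, pow_add]
    exact Nat.mul_lt_mul'' iha ihb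
  | mem a _ =>
    exact (hs.2 _).trans_le (Nat.pow_le_pow_right (by norm_num)
      (by have := a.weight_pos; simp only [weight]; nlinarith))

end Ex

/-- Conditions. -/
inductive Cond : Type
  | lt (a b : Ex)
  | eq (a b : Ex)

namespace Cond

/-- The truth value of a condition. -/
def eval (s : St) : Cond → Prop
  | lt a b => a.eval s < b.eval s
  | eq a b => a.eval s = b.eval s

/-- Code that jumps to `l` if the condition is satisfied. -/
def code : Cond → ℕ → List Instr
  | lt a b, l => a.code 0 ++ (b.code 1 ++ [.jlt (tmp 0) (tmp 1) l])
  | eq a b, l => a.code 0 ++ (b.code 1 ++ [.jeq (tmp 0) (tmp 1) l])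

/-- The length of the code of a condition. -/
def len : Cond → ℕ
  | lt a b => a.len + (b.len + 1)
  | eq a b => a.len + (b.len + 1)

@[simp] theorem length_code (c : Cond) (l : ℕ) : (c.code l).length = c.len := by
  cases c <;> simp [code, len]

/-- A factor by which the evaluation of a condition increases the number of bits. -/
def weight : Cond → ℕ
  | lt a b => a.weight + b.weight
  | eq a b => a.weight + b.weight

end Cond

/-- Structured programs. -/
inductive Cmd : Type
  | skip
  | assign (x : Var) (e : Ex)
  | comp (x : Var) (a b : Ex)
  | store (a b : Ex)
  | print (e : Ex)
  | sep
  | seq (a b : Cmd)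
  | ite (c : Cond) (a b : Cmd)
  | loop (c : Cond) (a : Cmd)

infix:60 " ≔ " => Cmd.assign
infixr:55 " ⨟ " => Cmd.seq

namespace Cmd

/-- The length of the code. -/
def len : Cmd → ℕ
  | skip => 0
  | assign _ e => e.len + 1
  | comp _ a b => a.len + (b.len + 1)
  | store a b => a.len + (b.len + 1)
  | print e => e.len + 1
  | sep => 1
  | seq a b => a.len + b.len
  | ite c a b => c.len + (1 + (a.len + (1 + b.len)))
  | loop c a => c.len + (1 + (a.len + 1))

/-- The code, when it is placed at position `n`. -/
def code : Cmd → ℕ → List Instr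
  | skip, _ => []
  | assign x e, _ => e.code 0 ++ [.copy x.reg (tmp 0)]
  | comp x a b, _ => a.code 0 ++ (b.code 1 ++ [.comp x.reg (tmp 0) (tmp 1)])
  | store a b, _ => a.code 0 ++ (b.code 1 ++ [.store (tmp 0) (tmp 1)])
  | print e, _ => e.code 0 ++ [.print (tmp 0)]
  | sep, _ => [.sep]
  | seq a b, n => a.code n ++ b.code (n + a.len)
  | ite c a b, n =>
    c.code (n + c.len + 1) ++ ([.jump (n + c.len + 1 + a.len + 1)] ++ (a.code (n + c.len + 1) ++
      ([.jump (n + c.len + 1 + a.len + 1 + b.len)] ++ b.code (n + c.len + 1 + a.len + 1))))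
  | loop c a, n =>
    c.code (n + c.len + 1) ++ ([.jump (n + c.len + 1 + a.len + 1)] ++
      (a.code (n + c.len + 1) ++ [.jump n]))

@[simp] theorem length_code (c : Cmd) (n : ℕ) : (c.code n).length = c.len := by
  induction c generalizing n <;> simp_all [code, len] <;> omega

/-- A factor by which intermediate results increase the number of bits. -/
def weight : Cmd → ℕ
  | skip => 0
  | assign _ e => e.weight
  | comp _ a b => a.weight + b.weight
  | store a b => a.weight + b.weight
  | print e => e.weight
  | sep => 0
  | seq a b => a.weight + b.weight
  | ite c a b => c.weight + a.weight + b.weight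
  | loop c a => c.weight + a.weight

end Cmd

/-- `Exec op N c s t s'`: started in `s`, the program `c` stops in `s'` after `t` steps of its code,
and all values assigned in between have at most `N` bits. -/
inductive Exec (op : ℕ → ℕ → ℕ) (N : ℕ) : Cmd → St → ℕ → St → Prop
  | skip (s : St) : Exec op N .skip s 0 s
  | assign (x : Var) (e : Ex) (s : St) (h : e.eval s < 2 ^ N) :
    Exec op N (.assign x e) s (e.len + 1) (s.set x (e.eval s))
  | comp (x : Var) (a b : Ex) (s : St) (h : op (a.eval s) (b.eval s) < 2 ^ N) :
    Exec op N (.comp x a b) s (a.len + (b.len + 1)) (s.set x (op (a.eval s) (b.eval s)))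
  | store (a b : Ex) (s : St) (h : b.eval s < 2 ^ N) :
    Exec op N (.store a b) s (a.len + (b.len + 1)) (s.put (a.eval s) (b.eval s))
  | print (e : Ex) (s : St) : Exec op N (.print e) s (e.len + 1) (s.emit (some (e.eval s)))
  | sep (s : St) : Exec op N .sep s 1 (s.emit none)
  | seq {a b : Cmd} {s s₁ s₂ : St} {t₁ t₂ : ℕ} (h₁ : Exec op N a s t₁ s₁)
    (h₂ : Exec op N b s₁ t₂ s₂) : Exec op N (.seq a b) s (t₁ + t₂) s₂
  | ite_true {c : Cond} {a b : Cmd} {s s' : St} {t : ℕ} (hc : c.eval s) (h : Exec op N a s t s') :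
    Exec op N (.ite c a b) s (c.len + (t + 1)) s'
  | ite_false {c : Cond} {a b : Cmd} {s s' : St} {t : ℕ} (hc : ¬ c.eval s)
    (h : Exec op N b s t s') : Exec op N (.ite c a b) s (c.len + (1 + t)) s'
  | loop_true {c : Cond} {a : Cmd} {s s₁ s₂ : St} {t₁ t₂ : ℕ} (hc : c.eval s)
    (h₁ : Exec op N a s t₁ s₁) (h₂ : Exec op N (.loop c a) s₁ t₂ s₂) :
    Exec op N (.loop c a) s (c.len + (t₁ + (1 + t₂))) s₂
  | loop_false {c : Cond} {a : Cmd} {s : St} (hc : ¬ c.eval s) :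
    Exec op N (.loop c a) s (c.len + 1) s

theorem Exec.bounded {op : ℕ → ℕ → ℕ} {N : ℕ} {c : Cmd} {s s' : St} {t : ℕ}
    (h : Exec op N c s t s') (hs : s.Bounded N) : s'.Bounded N := by
  induction h with
  | skip => exact hs
  | assign x e s h => exact hs.set h
  | comp x a b s h => exact hs.set h
  | store a b s h => exact hs.put h
  | print => exact hs
  | sep => exact hs
  | seq _ _ ih₁ ih₂ => exact ih₂ (ih₁ hs)
  | ite_true _ _ ih => exact ih hs
  | ite_false _ _ ih => exact ih hs
  | loop_true _ _ _ ih₁ ih₂ => exact ih₂ (ih₁ hs)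
  | loop_false => exact hs

/-! ### Correctness of the compilation -/

/-- The instructions `l` are found in the program `P` from position `n` on. -/
def CodeAt (P : Program) (n : ℕ) (l : List Instr) : Prop :=
  ∀ i < l.length, P[n + i]? = l[i]?

theorem CodeAt.left {P : Program} {n : ℕ} {l₁ l₂ : List Instr} (h : CodeAt P n (l₁ ++ l₂)) :
    CodeAt P n l₁ := by
  intro i hi
  rw [h i (by simp; omega), List.getElem?_append_left hi]

theorem CodeAt.right {P : Program} {n : ℕ} {l₁ l₂ : List Instr} (h : CodeAt P n (l₁ ++ l₂)) :
    CodeAt P (n + l₁.length) l₂ := by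
  intro i hi
  have := h (l₁.length + i) (by simp; omega)
  rw [← add_assoc] at this
  rw [this, List.getElem?_append_right (by omega), Nat.add_sub_cancel_left]

theorem CodeAt.head {P : Program} {n : ℕ} {i : Instr} {l : List Instr} (h : CodeAt P n (i :: l)) :
    P[n]? = some i := by
  simpa using h 0 (by simp)

theorem codeAt_self (P : Program) : CodeAt P 0 P := by
  intro i _; simp

/-- After `t` steps the machine passes from `σ` to `τ`, and all values fit up to that time. -/
def Reach (op : ℕ → ℕ → ℕ) (P : Program) (W t : ℕ) (σ τ : Config) : Prop :=
  run op P t σ = τ ∧ ∀ i ≤ t, (run op P i σ).Fits W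

section Reach

variable {op : ℕ → ℕ → ℕ} {P : Program} {W : ℕ}

theorem run_add (a b : ℕ) (σ : Config) : run op P (a + b) σ = run op P b (run op P a σ) := by
  simp only [run, add_comm a b, Function.iterate_add_apply]

theorem Reach.refl {σ : Config} (h : σ.Fits W) : Reach op P W 0 σ σ :=
  ⟨rfl, fun i hi => by obtain rfl := Nat.le_zero.1 hi; exact h⟩

theorem Reach.trans {a b : ℕ} {σ τ ρ : Config} (h₁ : Reach op P W a σ τ)
    (h₂ : Reach op P W b τ ρ) : Reach op P W (a + b) σ ρ := by
  refine ⟨by rw [run_add, h₁.1, h₂.1], fun i hi => ?_⟩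
  rcases le_total i a with h | h
  · exact h₁.2 i h
  · obtain ⟨k, rfl⟩ := Nat.exists_eq_add_of_le h
    rw [run_add, h₁.1]
    exact h₂.2 k (by omega)

theorem Reach.fits_right {t : ℕ} {σ τ : Config} (h : Reach op P W t σ τ) : τ.Fits W :=
  h.1 ▸ h.2 t le_rfl

theorem Reach.single {σ : Config} {i : Instr} (hi : P[σ.pc]? = some i) (hσ : σ.Fits W)
    (h : (i.exec op σ).Fits W) : Reach op P W 1 σ (i.exec op σ) := by
  have e : run op P 1 σ = i.exec op σ := by
    simp only [run, Function.iterate_one, step, hi]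
  refine ⟨e, fun k hk => ?_⟩
  obtain rfl | rfl : k = 0 ∨ k = 1 := by omega
  · exact hσ
  · rwa [e]

theorem Config.Fits.setReg {σ : Config} (hσ : σ.Fits W) (d : ℕ) {x : ℕ} (hx : x < 2 ^ W) :
    (σ.setReg d x).Fits W := by
  refine ⟨fun r => ?_, hσ.2⟩
  simp only [Config.setReg, Function.update_apply]
  split_ifs
  exacts [hx, hσ.1 r]

theorem Config.Fits.setMem {σ : Config} (hσ : σ.Fits W) (d : ℕ) {x : ℕ} (hx : x < 2 ^ W) :
    (σ.setMem d x).Fits W := by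
  refine ⟨hσ.1, fun r => ?_⟩
  simp only [Config.setMem, Function.update_apply]
  split_ifs
  exacts [hx, hσ.2 r]

end Reach

/-- The configuration `σ` represents the state `s`. -/
def Sim (s : St) (σ : Config) : Prop :=
  (∀ x : Var, σ.reg x.reg = s.var x) ∧ σ.mem = s.mem ∧ σ.out = s.out

theorem Sim.setTmp {s : St} {σ : Config} (h : Sim s σ) (k x : ℕ) : Sim s (σ.setReg (tmp k) x) := by
  refine ⟨fun y => ?_, h.2⟩
  rw [← h.1 y]
  exact Function.update_of_ne (by simp only [Var.reg, tmp]; omega) _ _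

theorem Sim.setVar {s : St} {σ : Config} (h : Sim s σ) (x : Var) (k : ℕ) :
    Sim (s.set x k) (σ.setReg x.reg k) := by
  refine ⟨fun y => ?_, h.2⟩
  simp only [Config.setReg, Function.update_apply, St.set_var, h.1 y]
  have : y.reg = x.reg ↔ y = x :=
    ⟨fun e => Var.idx_injective (by simpa [Var.reg] using e), fun e => e ▸ rfl⟩
  simp [this]

theorem Sim.setMem {s : St} {σ : Config} (h : Sim s σ) (a k : ℕ) :
    Sim (s.put a k) (σ.setMem a k) :=
  ⟨h.1, by simp only [Config.setMem, St.put, h.2.1], h.2.2⟩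

section Simulation

variable {op : ℕ → ℕ → ℕ} {P : Program} {N W : ℕ}

theorem lt_two_pow_of_weight {N W a b x : ℕ} (hx : x < 2 ^ (N * a)) (hab : a ≤ b)
    (hW : N * b ≤ W) : x < 2 ^ W :=
  hx.trans_le (Nat.pow_le_pow_right (by norm_num) ((Nat.mul_le_mul_left N hab).trans hW))

/-- Evaluation into the `k`-th intermediate register leaves the lower ones alone; this is what lets
a left operand survive the evaluation of the right one. -/
theorem Ex.reach (hN : 0 < N) {s : St} (hs : s.Bounded N) (e : Ex) :
    ∀ {n k : ℕ} {σ : Config}, N * e.weight ≤ W → CodeAt P n (e.code k) → σ.pc = n → Sim s σ →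
      σ.Fits W → ∃ τ, Reach op P W e.len σ τ ∧ τ.pc = n + e.len ∧ Sim s τ ∧
        τ.reg (tmp k) = e.eval s ∧ ∀ i < k, τ.reg (tmp i) = σ.reg (tmp i) := by
  have setTmp_ne : ∀ {σ : Config} {i k x : ℕ}, i < k →
      (σ.setReg (tmp k) x).reg (tmp i) = σ.reg (tmp i) := by
    intro σ i k x hi
    exact Function.update_of_ne (by simp only [tmp]; omega) _ _
  -- The three binary operations differ only in the last instruction, so they are treated together.
  have bin : ∀ (a b e : Ex) (ins : Instr) (f : ℕ → ℕ → ℕ) (n k : ℕ) (σ : Config),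
      (∀ {n k : ℕ} {σ : Config}, N * a.weight ≤ W → CodeAt P n (a.code k) → σ.pc = n → Sim s σ →
      σ.Fits W → ∃ τ, Reach op P W a.len σ τ ∧ τ.pc = n + a.len ∧ Sim s τ ∧
        τ.reg (tmp k) = a.eval s ∧ ∀ i < k, τ.reg (tmp i) = σ.reg (tmp i)) →
      (∀ {n k : ℕ} {σ : Config}, N * b.weight ≤ W → CodeAt P n (b.code k) → σ.pc = n → Sim s σ →
      σ.Fits W → ∃ τ, Reach op P W b.len σ τ ∧ τ.pc = n + b.len ∧ Sim s τ ∧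
        τ.reg (tmp k) = b.eval s ∧ ∀ i < k, τ.reg (tmp i) = σ.reg (tmp i)) →
      (∀ τ : Config, ins.exec op τ
        = τ.setReg (tmp k) (f (τ.reg (tmp k)) (τ.reg (tmp (k + 1))))) →
      e.eval s = f (a.eval s) (b.eval s) → e.len = a.len + (b.len + 1) →
      e.weight = a.weight + b.weight →
      N * e.weight ≤ W → CodeAt P n (a.code k ++ (b.code (k + 1) ++ [ins])) → σ.pc = n →
      Sim s σ → σ.Fits W → ∃ τ, Reach op P W e.len σ τ ∧ τ.pc = n + e.len ∧ Sim s τ ∧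
        τ.reg (tmp k) = e.eval s ∧ ∀ i < k, τ.reg (tmp i) = σ.reg (tmp i) := by
    intro a b e ins f n k σ iha ihb hins hev hlen hwt hW hc hpc hsim hfit
    have hbd := eval_lt hN hs e
    rw [hwt, mul_add] at hW
    obtain ⟨τ₁, r₁, p₁, s₁, v₁, k₁⟩ := iha (by omega) hc.left hpc hsim hfit
    have hc₂ := hc.right
    rw [length_code] at hc₂
    obtain ⟨τ₂, r₂, p₂, s₂, v₂, k₂⟩ := ihb (by omega) hc₂.left p₁ s₁ r₁.fits_right
    have hc₃ := hc₂.right.head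
    rw [length_code, ← p₂] at hc₃
    have hv : f (τ₂.reg (tmp k)) (τ₂.reg (tmp (k + 1))) = e.eval s := by
      rw [k₂ k (by omega), v₁, v₂, hev]
    have hex := hins τ₂
    rw [hv] at hex
    refine ⟨ins.exec op τ₂, ?_, ?_, ?_, ?_, ?_⟩
    · rw [hlen]
      refine r₁.trans (r₂.trans (Reach.single hc₃ r₂.fits_right ?_))
      rw [hex]
      exact r₂.fits_right.setReg _ (lt_two_pow_of_weight hbd le_rfl (by rw [hwt, mul_add]; exact hW))
    · rw [hex, hlen]; simp only [Config.setReg]; omega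
    · rw [hex]; exact s₂.setTmp _ _
    · rw [hex]; exact Function.update_self ..
    · intro i hi
      rw [hex, setTmp_ne hi, k₂ i (by omega), k₁ i hi]
  induction e with
  | num c =>
    intro n k σ hW hc hpc hsim hfit
    have hc₁ := hc.head
    rw [← hpc] at hc₁
    refine ⟨_, Reach.single hc₁ hfit (hfit.setReg _ ?_), ?_, hsim.setTmp k _, ?_, ?_⟩
    · exact lt_two_pow_of_weight (eval_lt hN hs (num c)) le_rfl hW
    · simp [Instr.exec, Config.setReg, hpc, len]
    · exact Function.update_self ..
    · intro i hi; exact setTmp_ne hi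
  | var x =>
    intro n k σ hW hc hpc hsim hfit
    have hc₁ := hc.head
    rw [← hpc] at hc₁
    refine ⟨_, Reach.single hc₁ hfit (hfit.setReg _ (hfit.1 _)), ?_, hsim.setTmp k _, ?_, ?_⟩
    · simp [Instr.exec, Config.setReg, hpc, len]
    · exact (Function.update_self ..).trans (hsim.1 x)
    · intro i hi; exact setTmp_ne hi
  | add a b iha ihb =>
    intro n k σ
    exact bin a b _ _ (· + ·) n k σ iha ihb (fun _ => rfl) rfl rfl rfl
  | sub a b iha ihb =>
    intro n k σ
    exact bin a b _ _ (· - ·) n k σ iha ihb (fun _ => rfl) rfl rfl rfl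
  | mul a b iha ihb =>
    intro n k σ
    exact bin a b _ _ (· * ·) n k σ iha ihb (fun _ => rfl) rfl rfl rfl
  | mem a ih =>
    intro n k σ hW hc hpc hsim hfit
    obtain ⟨τ, r, p, s', v, h⟩ := ih hW hc.left hpc hsim hfit
    have hc₃ := hc.right.head
    rw [length_code, ← p] at hc₃
    refine ⟨_, r.trans (Reach.single hc₃ r.fits_right (r.fits_right.setReg _ (r.fits_right.2 _))),
      ?_, s'.setTmp k _, ?_, ?_⟩
    · simp only [Instr.exec, Config.setReg, p, len, add_assoc]
    · refine (Function.update_self ..).trans ?_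
      rw [v, s'.2.1]; rfl
    · intro i hi; rw [← h i hi]; exact setTmp_ne hi

/-- Two expressions are evaluated into the first two intermediate registers. -/
theorem Ex.reach_pair (hN : 0 < N) {s : St} (hs : s.Bounded N) (a b : Ex) {n : ℕ} {σ : Config}
    {l : List Instr} (hW : N * (a.weight + b.weight) ≤ W)
    (hc : CodeAt P n (a.code 0 ++ (b.code 1 ++ l))) (hpc : σ.pc = n) (hsim : Sim s σ)
    (hfit : σ.Fits W) : ∃ τ, Reach op P W (a.len + b.len) σ τ ∧ τ.pc = n + a.len + b.len ∧
      Sim s τ ∧ τ.reg (tmp 0) = a.eval s ∧ τ.reg (tmp 1) = b.eval s ∧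
      CodeAt P τ.pc l := by
  rw [mul_add] at hW
  obtain ⟨τ₁, r₁, p₁, s₁, v₁, -⟩ := a.reach hN hs (by omega) hc.left hpc hsim hfit
  have hc₂ := hc.right
  rw [length_code] at hc₂
  obtain ⟨τ₂, r₂, p₂, s₂, v₂, k₂⟩ := b.reach hN hs (by omega) hc₂.left p₁ s₁ r₁.fits_right
  have hc₃ := hc₂.right
  rw [length_code, ← p₂] at hc₃
  exact ⟨τ₂, r₁.trans r₂, p₂, s₂, by rw [k₂ 0 (by omega), v₁], v₂, hc₃⟩

theorem Cond.reach (hN : 0 < N) {s : St} (hs : s.Bounded N) (c : Cond) {n l : ℕ} {σ : Config}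
    (hW : N * c.weight ≤ W) (hc : CodeAt P n (c.code l)) (hpc : σ.pc = n) (hsim : Sim s σ)
    (hfit : σ.Fits W) [Decidable (c.eval s)] :
    ∃ τ, Reach op P W c.len σ τ ∧ τ.pc = (if c.eval s then l else n + c.len) ∧ Sim s τ := by
  cases c with
  | lt a b =>
    obtain ⟨τ, r, p, s', v₁, v₂, hc'⟩ := Ex.reach_pair hN hs a b hW hc hpc hsim hfit
    refine ⟨_, (r.trans (Reach.single hc'.head r.fits_right r.fits_right)), ?_, s'⟩
    simp only [Instr.exec, Config.branch, decide_eq_true_eq, v₁, v₂, p]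
    by_cases h : a.eval s < b.eval s <;> simp [Cond.eval, h, len, add_assoc]
  | eq a b =>
    obtain ⟨τ, r, p, s', v₁, v₂, hc'⟩ := Ex.reach_pair hN hs a b hW hc hpc hsim hfit
    refine ⟨_, (r.trans (Reach.single hc'.head r.fits_right r.fits_right)), ?_, s'⟩
    simp only [Instr.exec, Config.branch, decide_eq_true_eq, v₁, v₂, p]
    by_cases h : a.eval s = b.eval s <;> simp [Cond.eval, h, len, add_assoc]

theorem Reach.jump {σ : Config} {l : ℕ} (hi : P[σ.pc]? = some (.jump l)) (hσ : σ.Fits W) :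
    Reach op P W 1 σ { σ with pc := l } :=
  Reach.single hi hσ hσ

/-- The code of a structured program does what the program does. -/
theorem Exec.reach (hN : 0 < N) {c : Cmd} {s s' : St} {t : ℕ} (h : Exec op N c s t s') :
    ∀ {n : ℕ} {σ : Config}, s.Bounded N → N * c.weight ≤ W → CodeAt P n (c.code n) → σ.pc = n →
      Sim s σ → σ.Fits W →
      ∃ τ, Reach op P W t σ τ ∧ τ.pc = n + c.len ∧ Sim s' τ := by
  classical
  induction h with
  | skip s =>
    intro n σ hs hW hc hpc hsim hfit
    exact ⟨σ, Reach.refl hfit, hpc, hsim⟩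
  | assign x e s h =>
    intro n σ hs hW hc hpc hsim hfit
    obtain ⟨τ, r, p, s', v, -⟩ := e.reach hN hs hW hc.left hpc hsim hfit
    have hc' := hc.right.head
    rw [Ex.length_code, ← p] at hc'
    refine ⟨_, r.trans (Reach.single hc' r.fits_right (r.fits_right.setReg _ (r.fits_right.1 _))),
      ?_, ?_⟩
    · simp [Instr.exec, Config.setReg, p, Cmd.len, add_assoc]
    · simp only [Instr.exec, v]; exact s'.setVar x _
  | comp x a b s h =>
    intro n σ hs hW hc hpc hsim hfit
    obtain ⟨τ, r, p, s', v₁, v₂, hc'⟩ := Ex.reach_pair hN hs a b hW hc hpc hsim hfit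
    have hNW : 2 ^ N ≤ 2 ^ W := Nat.pow_le_pow_right (by norm_num) <| hW.trans' <|
      Nat.le_mul_of_pos_right _ (Nat.add_pos_left a.weight_pos _)
    have := r.trans (Reach.single (op := op) hc'.head r.fits_right
      (r.fits_right.setReg _ (by rw [v₁, v₂]; omega)))
    rw [add_assoc] at this
    refine ⟨_, this, ?_, ?_⟩
    · simp [Instr.exec, Config.setReg, p, Cmd.len, add_assoc]
    · simp only [Instr.exec, v₁, v₂]; exact s'.setVar x _
  | store a b s h =>
    intro n σ hs hW hc hpc hsim hfit
    obtain ⟨τ, r, p, s', v₁, v₂, hc'⟩ := Ex.reach_pair hN hs a b hW hc hpc hsim hfit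
    have := r.trans (Reach.single (op := op) hc'.head r.fits_right
      (r.fits_right.setMem _ (r.fits_right.1 _)))
    rw [add_assoc] at this
    refine ⟨_, this, ?_, ?_⟩
    · simp [Instr.exec, Config.setMem, p, Cmd.len, add_assoc]
    · simp only [Instr.exec, v₁, v₂]; exact s'.setMem _ _
  | print e s =>
    intro n σ hs hW hc hpc hsim hfit
    obtain ⟨τ, r, p, s', v, -⟩ := e.reach hN hs hW hc.left hpc hsim hfit
    have hc' := hc.right.head
    rw [Ex.length_code, ← p] at hc'
    refine ⟨_, r.trans (Reach.single hc' r.fits_right r.fits_right), ?_, ?_⟩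
    · simp [Instr.exec, Config.emit, p, Cmd.len, add_assoc]
    · exact ⟨s'.1, s'.2.1, by simp [Instr.exec, Config.emit, s'.2.2, v]⟩
  | sep s =>
    intro n σ hs hW hc hpc hsim hfit
    have hc' := hc.head
    rw [← hpc] at hc'
    refine ⟨_, Reach.single hc' hfit hfit, ?_, ?_⟩
    · simp [Instr.exec, Config.emit, hpc, Cmd.len]
    · exact ⟨hsim.1, hsim.2.1, by simp [Instr.exec, Config.emit, hsim.2.2]⟩
  | seq h₁ h₂ ih₁ ih₂ =>
    intro n σ hs hW hc hpc hsim hfit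
    simp only [Cmd.weight, mul_add] at hW
    obtain ⟨τ₁, r₁, p₁, s₁⟩ := ih₁ hs (by omega) hc.left hpc hsim hfit
    have hc' := hc.right
    rw [Cmd.length_code] at hc'
    obtain ⟨τ₂, r₂, p₂, s₂⟩ := ih₂ (h₁.bounded hs) (by omega) hc' p₁ s₁ r₁.fits_right
    exact ⟨τ₂, r₁.trans r₂, by rw [p₂, Cmd.len, add_assoc], s₂⟩
  | @ite_true c a b s s' t hb h ih =>
    intro n σ hs hW hc hpc hsim hfit
    simp only [Cmd.weight, mul_add] at hW
    obtain ⟨τ₁, r₁, p₁, s₁⟩ := c.reach (op := op) hN hs (by omega) hc.left hpc hsim hfit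
    rw [if_pos hb] at p₁
    -- The taken conditional jump skips the unconditional jump to the other branch.
    have hc₂ := hc.right.right
    rw [Cond.length_code, List.length_singleton] at hc₂
    obtain ⟨τ₂, r₂, p₂, s₂⟩ := ih hs (by omega) hc₂.left p₁ s₁ r₁.fits_right
    have hc₃ := hc₂.right.left.head
    rw [Cmd.length_code, ← p₂] at hc₃
    refine ⟨_, r₁.trans (r₂.trans (Reach.jump hc₃ r₂.fits_right)), ?_, s₂⟩
    simp only [Cmd.len]; omega
  | @ite_false c a b s s' t hb h ih =>
    intro n σ hs hW hc hpc hsim hfit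
    simp only [Cmd.weight, mul_add] at hW
    obtain ⟨τ₁, r₁, p₁, s₁⟩ := c.reach (op := op) hN hs (by omega) hc.left hpc hsim hfit
    rw [if_neg hb] at p₁
    have hc₂ := hc.right
    rw [Cond.length_code] at hc₂
    -- The conditional jump falls through to the jump that leads past the first branch.
    have hc₃ : P[τ₁.pc]? = some (.jump (n + c.len + 1 + a.len + 1)) := by
      rw [p₁]; exact hc₂.left.head
    have hc₄ := hc₂.right.right.right
    simp only [Cmd.length_code, List.length_singleton] at hc₄
    have r₂ := Reach.jump (op := op) hc₃ r₁.fits_right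
    have r₂pc : ({ τ₁ with pc := n + c.len + 1 + a.len + 1 } : Config).pc
      = n + c.len + 1 + a.len + 1 := rfl
    obtain ⟨τ₂, r₃, p₃, s₃⟩ := ih hs (by omega) hc₄ r₂pc s₁ r₂.fits_right
    refine ⟨_, r₁.trans (r₂.trans r₃), ?_, s₃⟩
    simp only [Cmd.len]; omega
  | @loop_true c a s s₁ s₂ t₁ t₂ hb h₁ h₂ ih₁ ih₂ =>
    intro n σ hs hW hc hpc hsim hfit
    have hW' := hW
    simp only [Cmd.weight, mul_add] at hW
    obtain ⟨τ₁, r₁, p₁, q₁⟩ := c.reach (op := op) hN hs (by omega) hc.left hpc hsim hfit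
    rw [if_pos hb] at p₁
    have hc₂ := hc.right.right
    rw [Cond.length_code, List.length_singleton] at hc₂
    obtain ⟨τ₂, r₂, p₂, q₂⟩ := ih₁ hs (by omega) hc₂.left p₁ q₁ r₁.fits_right
    have hc₃ := hc₂.right.head
    rw [Cmd.length_code, ← p₂] at hc₃
    have r₃ := Reach.jump (op := op) hc₃ r₂.fits_right
    have r₃pc : ({ τ₂ with pc := n } : Config).pc = n := rfl
    -- Back at position `n`, the remaining iterations are executed by the same piece of code.
    obtain ⟨τ₄, r₄, p₄, q₄⟩ := ih₂ (n := n) (h₁.bounded hs) hW' hc r₃pc q₂ r₃.fits_right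
    exact ⟨_, r₁.trans (r₂.trans (r₃.trans r₄)), p₄, q₄⟩
  | @loop_false c a s hb =>
    intro n σ hs hW hc hpc hsim hfit
    simp only [Cmd.weight, mul_add] at hW
    obtain ⟨τ₁, r₁, p₁, q₁⟩ := c.reach (op := op) hN hs (by omega) hc.left hpc hsim hfit
    rw [if_neg hb] at p₁
    have hc₂ := hc.right
    rw [Cond.length_code] at hc₂
    have hc₃ := hc₂.left.head
    rw [← p₁] at hc₃
    refine ⟨_, r₁.trans (Reach.jump hc₃ r₁.fits_right), ?_, q₁⟩
    simp only [Cmd.len]; omega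

end Simulation

/-! ### Reasoning about structured programs -/

/-- Started in `s`, the program `c` stops within time `T` in a state that satisfies `Q`; all values
have at most `N` bits if this is the case for `s`. -/
def Tri (op : ℕ → ℕ → ℕ) (N : ℕ) (c : Cmd) (s : St) (T : ℕ) (Q : St → Prop) : Prop :=
  s.Bounded N → ∃ t ≤ T, ∃ s', Exec op N c s t s' ∧ s'.Bounded N ∧ Q s'

/-- A condition that ensures that the value of an expression has at most `N` bits in a bounded
state. -/
def Ex.Safe (N : ℕ) (s : St) : Ex → Prop
  | num k => k < 4
  | var _ => True
  | mem _ => True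
  | add a b => a.eval s + b.eval s < 2 ^ N
  | sub a b => a.eval s - b.eval s < 2 ^ N
  | mul a b => a.eval s * b.eval s < 2 ^ N

section
variable (N : ℕ) (s : St) (a b : Ex)
@[simp] theorem Ex.safe_ofNat (k : ℕ) : (ofNat(k) : Ex).Safe N s ↔ ofNat(k) < 4 := Iff.rfl
@[simp] theorem Ex.safe_var (x : Var) : (var x).Safe N s ↔ True := Iff.rfl
@[simp] theorem Ex.safe_mem : (mem a).Safe N s ↔ True := Iff.rfl
@[simp] theorem Ex.safe_add : (a + b).Safe N s ↔ a.eval s + b.eval s < 2 ^ N := Iff.rfl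
@[simp] theorem Ex.safe_sub : (a - b).Safe N s ↔ a.eval s - b.eval s < 2 ^ N := Iff.rfl
@[simp] theorem Ex.safe_mul : (a * b).Safe N s ↔ a.eval s * b.eval s < 2 ^ N := Iff.rfl
end

theorem Ex.Safe.eval_lt {N : ℕ} (hN : 2 ≤ N) {s : St} (hs : s.Bounded N) {e : Ex}
    (h : e.Safe N s) : e.eval s < 2 ^ N := by
  cases e with
  | num k => exact lt_of_lt_of_le h (Nat.pow_le_pow_right (n := 2) (by norm_num) hN)
  | var x => exact hs.1 x
  | mem a => exact hs.2 _
  | add a b => exact h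
  | sub a b => exact h
  | mul a b => exact h

namespace Cmd

/-- The weakest precondition of a program without loops. -/
def wp (op : ℕ → ℕ → ℕ) (N : ℕ) : Cmd → (St → Prop) → St → Prop
  | skip, Q, s => Q s
  | assign x e, Q, s => e.Safe N s ∧ Q (s.set x (e.eval s))
  | comp x a b, Q, s =>
    op (a.eval s) (b.eval s) < 2 ^ N ∧ Q (s.set x (op (a.eval s) (b.eval s)))
  | store a b, Q, s => b.Safe N s ∧ Q (s.put (a.eval s) (b.eval s))
  | print e, Q, s => Q (s.emit (some (e.eval s)))
  | sep, Q, s => Q (s.emit none)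
  | seq a b, Q, s => a.wp op N (b.wp op N Q) s
  | ite c a b, Q, s => (c.eval s → a.wp op N Q s) ∧ (¬ c.eval s → b.wp op N Q s)
  | loop _ _, _, _ => False

/-- A bound for the running time of a program without loops. -/
def cost : Cmd → ℕ
  | skip => 0
  | assign _ e => e.len + 1
  | comp _ a b => a.len + (b.len + 1)
  | store a b => a.len + (b.len + 1)
  | print e => e.len + 1
  | sep => 1
  | seq a b => a.cost + b.cost
  | ite c a b => c.len + 1 + a.cost + b.cost
  | loop _ _ => 0

end Cmd

section Rules

variable {op : ℕ → ℕ → ℕ} {N : ℕ}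

theorem Tri.mono {c : Cmd} {s : St} {T T' : ℕ} {Q Q' : St → Prop} (h : Tri op N c s T Q)
    (hT : T ≤ T') (hQ : ∀ s', Q s' → Q' s') : Tri op N c s T' Q' := by
  intro hs
  obtain ⟨t, ht, s', h₁, h₂, h₃⟩ := h hs
  exact ⟨t, ht.trans hT, s', h₁, h₂, hQ _ h₃⟩

theorem Tri.seq {a b : Cmd} {s : St} {T₁ T₂ : ℕ} {Q : St → Prop}
    (h : Tri op N a s T₁ fun s₁ => Tri op N b s₁ T₂ Q) : Tri op N (a ⨟ b) s (T₁ + T₂) Q := by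
  intro hs
  obtain ⟨t₁, ht₁, s₁, e₁, b₁, h₁⟩ := h hs
  obtain ⟨t₂, ht₂, s₂, e₂, b₂, h₂⟩ := h₁ b₁
  exact ⟨t₁ + t₂, add_le_add ht₁ ht₂, s₂, e₁.seq e₂, b₂, h₂⟩

theorem Tri.ite {c : Cond} {a b : Cmd} {s : St} {T : ℕ} {Q : St → Prop}
    (h₁ : c.eval s → Tri op N a s T Q) (h₂ : ¬ c.eval s → Tri op N b s T Q) :
    Tri op N (.ite c a b) s (c.len + 1 + T) Q := by
  intro hs
  by_cases hc : c.eval s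
  · obtain ⟨t, ht, s', e, b, h⟩ := h₁ hc hs
    exact ⟨_, by omega, s', .ite_true hc e, b, h⟩
  · obtain ⟨t, ht, s', e, b, h⟩ := h₂ hc hs
    exact ⟨_, by omega, s', .ite_false hc e, b, h⟩

/-- The rule for loops; the invariant depends on a bound for the number of iterations. -/
theorem Tri.loop {c : Cond} {a : Cmd} {T : ℕ} {Q : St → Prop} (Inv : ℕ → St → Prop)
    (hinv : ∀ k s, Inv k s → c.eval s → Tri op N a s T fun s' => ∃ k' < k, Inv k' s')
    (hend : ∀ k s, Inv k s → ¬ c.eval s → Q s) {k : ℕ} {s : St} (hs : Inv k s) :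
    Tri op N (.loop c a) s (k * (c.len + T + 1) + (c.len + 1)) Q := by
  induction k using Nat.strong_induction_on generalizing s with
  | _ k ih =>
  intro hb
  by_cases hc : c.eval s
  · obtain ⟨t₁, ht₁, s₁, e₁, b₁, k', hk', h₁⟩ := hinv k s hs hc hb
    obtain ⟨t₂, ht₂, s₂, e₂, b₂, h₂⟩ := ih k' hk' h₁ b₁
    refine ⟨_, ?_, s₂, .loop_true hc e₁ e₂, b₂, h₂⟩
    have : (k' + 1) * (c.len + T + 1) ≤ k * (c.len + T + 1) := Nat.mul_le_mul_right _ hk'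
    rw [add_mul, one_mul] at this
    omega
  · exact ⟨_, by omega, s, .loop_false hc, hb, hend k s hs hc⟩

/-- Induction on the program; this turns the verification of loop-free code into simplification.
Loops have the precondition `False`, which makes their cost 0 harmless. The bound `2 ≤ N` is needed
for the numerals of programs, which are less than 4. -/
theorem Tri.of_wp (hN : 2 ≤ N) {c : Cmd} {s : St} {Q : St → Prop} (h : c.wp op N Q s) :
    Tri op N c s c.cost Q := by
  induction c generalizing s Q with
  | skip => exact fun hs => ⟨_, le_rfl, s, .skip s, hs, h⟩
  | assign x e =>
    exact fun hs => ⟨_, le_rfl, _, .assign x e s (h.1.eval_lt hN hs), hs.set (h.1.eval_lt hN hs), h.2⟩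
  | comp x a b => exact fun hs => ⟨_, le_rfl, _, .comp x a b s h.1, hs.set h.1, h.2⟩
  | store a b =>
    exact fun hs => ⟨_, le_rfl, _, .store a b s (h.1.eval_lt hN hs), hs.put (h.1.eval_lt hN hs), h.2⟩
  | print e => exact fun hs => ⟨_, le_rfl, _, .print e s, hs, h⟩
  | sep => exact fun hs => ⟨_, le_rfl, _, .sep s, hs, h⟩
  | seq a b iha ihb => exact ((iha h).mono le_rfl fun s' h' => ihb h').seq
  | ite c a b iha ihb =>
    refine (Tri.ite (T := a.cost + b.cost) (fun hc => (iha (h.1 hc)).mono (by omega) fun _ => id)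
      fun hc => (ihb (h.2 hc)).mono (by omega) fun _ => id).mono ?_ fun _ => id
    simp only [Cmd.cost]; omega
  | loop => exact h.elim

end Rules

/-! ### Enumeration with output-linear delay -/

/-- From `σ` on, the machine prints the objects in the list one after the other and halts; `K` is
the constant for all running times. -/
inductive Enumer (op : ℕ → ℕ → ℕ) (P : Program) (W K : ℕ) : Config → List (List ℕ) → Prop
  | nil {σ τ : Config} {t : ℕ} (ht : t ≤ K) (h : Reach op P W t σ τ) (hτ : Halted P τ)
    (ho : τ.out = σ.out) : Enumer op P W K σ []
  | cons {σ τ ρ : Config} {a b : ℕ} {s : List ℕ} {L : List (List ℕ)} (h₁ : Reach op P W a σ τ)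
    (h₂ : Reach op P W b τ ρ) (ha : a ≤ K * (s.length + 1)) (hb : b ≤ K)
    (hτ : τ.out = σ.out ++ s.map some) (hρ : ρ.out = σ.out ++ (s.map some ++ [none]))
    (h : Enumer op P W K ρ L) : Enumer op P W K σ (s :: L)

/-- The multiset of the objects in a list, each of them read as a multiset. -/
def multisets (L : List (List ℕ)) : Multiset (Multiset ℕ) :=
  Multiset.ofList (L.map Multiset.ofList)

section Enumer

variable {op : ℕ → ℕ → ℕ} {P : Program} {W K : ℕ}

theorem Halted.run_eq {σ : Config} (h : Halted P σ) (t : ℕ) : run op P t σ = σ := by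
  have hs : step op P σ = σ := by
    rcases h with h | h <;> simp [step, h, Instr.exec]
  exact Function.iterate_fixed hs t

/-- A stopped machine no longer changes, so bounds up to the stopping time hold forever. -/
theorem Reach.fits_of_halted {t : ℕ} {σ τ : Config} (h : Reach op P W t σ τ) (hτ : Halted P τ)
    (k : ℕ) : (run op P k σ).Fits W := by
  rcases le_total k t with hk | hk
  · exact h.2 k hk
  · obtain ⟨i, rfl⟩ := Nat.exists_eq_add_of_le hk
    rw [run_add, h.1, hτ.run_eq]
    exact h.fits_right

theorem Enumer.fits {σ : Config} {L : List (List ℕ)} (h : Enumer op P W K σ L) (t : ℕ) :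
    (run op P t σ).Fits W := by
  induction h generalizing t with
  | nil _ h hτ _ => exact h.fits_of_halted hτ t
  | @cons σ τ ρ a b s L h₁ h₂ _ _ _ _ _ ih =>
    have h := h₁.trans h₂
    rcases le_total t (a + b) with ht | ht
    · exact h.2 t ht
    · obtain ⟨i, rfl⟩ := Nat.exists_eq_add_of_le ht
      rw [run_add, h.1]
      exact ih i

theorem length_out_step (σ : Config) : σ.out.length ≤ (step op P σ).out.length := by
  unfold step
  split
  · rename_i i _
    cases i <;> simp [Instr.exec, Config.setReg, Config.setMem, Config.branch, Config.emit]
  · exact le_rfl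

theorem length_out_run_mono (σ : Config) {a b : ℕ} (h : a ≤ b) :
    (run op P a σ).out.length ≤ (run op P b σ).out.length := by
  refine monotone_nat_of_le_succ (f := fun t => (run op P t σ).out.length) (fun t => ?_) h
  simp only [run, Function.iterate_succ_apply']
  exact length_out_step _

theorem printed_cons (s : List ℕ) (L : List (List ℕ)) :
    printed (s :: L) = s.map some ++ [none] ++ printed L := by
  simp [printed]

theorem length_printed_take_lt {L : List (List ℕ)} {i : ℕ} (hi : i < L.length) :
    (printed (L.take i)).length < (printed (L.take (i + 1))).length := by
  rw [List.take_succ_eq_append_getElem hi, printed, printed, List.flatMap_append,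
    List.length_append]
  simp only [List.flatMap_singleton, List.length_append, List.length_singleton]
  omega

/-- The times at which a machine that enumerates a list passes from one object to the next. -/
theorem Enumer.times {σ : Config} {L : List (List ℕ)} (h : Enumer op P W K σ L) :
    ∃ t : ℕ → ℕ, t 0 = 0 ∧
      (∀ (i : ℕ) (hi : i < L.length), t (i + 1) ≤ t i + 2 * K * (L[i].length + 1)) ∧
      (∀ i ≤ L.length, (run op P (t i) σ).out = σ.out ++ printed (L.take i)) ∧
      -- At time `g` the separator of the `i`-th object has not been printed yet, so the first
      -- moment at which the object is complete lies at most `K` steps before `t (i + 1)`.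
      (∀ i < L.length, ∃ g, t (i + 1) ≤ g + K ∧
        (run op P g σ).out.length < (σ.out ++ printed (L.take (i + 1))).length) ∧
      ∃ T ≤ K, Halted P (run op P (t L.length + T) σ) ∧
        (run op P (t L.length + T) σ).out = σ.out ++ printed L := by
  induction h with
  | @nil σ τ t ht h hτ ho =>
    refine ⟨fun _ => 0, rfl, by simp, ?_, by simp, t, ht, ?_⟩
    · intro i _
      simp [printed, run]
    · simpa [h.1, ho, printed] using hτ
  | @cons σ τ ρ a b s L h₁ h₂ ha hb hτ hρ h ih =>
    obtain ⟨t, t0, td, ho', tg, T, hT, hh, ho⟩ := ih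
    have hr : ∀ k, run op P (a + b + k) σ = run op P k ρ := by
      intro k; rw [run_add, (h₁.trans h₂).1]
    refine ⟨fun i => Nat.casesOn i 0 fun i => a + b + t i, rfl, ?_, ?_, ?_, T, hT, ?_⟩
    · rintro (_ | i) hi
      · simp only [t0, List.getElem_cons_zero]
        nlinarith
      · have := td i (by simpa using hi)
        simp only [List.getElem_cons_succ]
        omega
    · rintro (_ | i) hi
      · simp [printed, run]
      · have := ho' i (by simpa using hi)
        simp only [hr, this, hρ, List.take_succ_cons, printed_cons, List.append_assoc]
    · rintro (_ | i) hi
      · refine ⟨a, by simp only [t0]; omega, ?_⟩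
        rw [h₁.1, hτ]
        simp [printed]
      · obtain ⟨g, hg₁, hg₂⟩ := tg i (by simpa using hi)
        refine ⟨a + b + g, by simp only; omega, ?_⟩
        rw [hr]
        simpa only [hρ, List.take_succ_cons, printed_cons, List.append_assoc] using hg₂
    · simp only [List.length_cons, add_assoc (a + b), hr]
      refine ⟨hh, ?_⟩
      simp only [ho, hρ, printed_cons, List.append_assoc]

/-- The times from `Enumer.times` are taken after the work that follows the separator, whereas the
definition of delay asks for the first moment at which the output has the right form. The two differ
by at most `K`; together with `2 * K` for a round this gives `3 * K`. -/
theorem Enumer.enumeratesLinearDelay {σ : Config} {L : List (List ℕ)}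
    (h : Enumer op P W K σ L) (hσ : σ.out = []) :
    EnumeratesLinearDelay op P (3 * K) σ (multisets L) := by
  obtain ⟨h, h0, hd, ho, hg, T, hT, hh, hout⟩ := h.times
  simp only [hσ, List.nil_append] at ho hg hout
  set t : ℕ → ℕ := fun i => sInf {t | (run op P t σ).out = printed (L.take i)} with ht
  have tmem : ∀ i ≤ L.length, (run op P (t i) σ).out = printed (L.take i) := fun i hi =>
    Nat.sInf_mem (s := {t | (run op P t σ).out = printed (L.take i)}) ⟨h i, ho i hi⟩
  have tle : ∀ i ≤ L.length, t i ≤ h i := fun i hi => Nat.sInf_le (ho i hi)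
  have hle : ∀ i ≤ L.length, h i ≤ t i + K := by
    rintro (_ | i) hi
    -- At `i = 0` the time from `Enumer.times` is 0.
    · omega
    · obtain ⟨g, hg₁, hg₂⟩ := hg i hi
      by_contra! hlt
      have := length_out_run_mono (op := op) (P := P) σ (show t (i + 1) ≤ g by omega)
      rw [tmem _ hi] at this
      omega
  have tmono : ∀ i < L.length, t i ≤ t (i + 1) := by
    intro i hi
    by_contra! hlt
    have := length_out_run_mono (op := op) (P := P) σ hlt.le
    rw [tmem i hi.le, tmem (i + 1) hi] at this
    exact absurd (length_printed_take_lt hi) this.not_gt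
  refine ⟨L, t, ?_, ?_, ?_, ?_, ?_⟩
  · simp [multisets, List.map_eq_flatMap]
  · have := tle 0 (Nat.zero_le _); omega
  · intro i hi
    refine ⟨tmono i hi, ?_⟩
    have h₁ := tle (i + 1) hi
    have h₂ := hd i hi
    have h₃ := hle i hi.le
    have h₄ : K ≤ K * (L[i].length + 1) := Nat.le_mul_of_pos_right _ (Nat.succ_pos _)
    rw [mul_assoc] at h₂ ⊢
    omega
  · exact fun i hi => ⟨tmem i hi, fun t' ht' => Nat.notMem_of_lt_sInf ht'⟩
  · have h₁ := tle _ le_rfl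
    have h₃ := hle _ le_rfl
    exact ⟨h L.length + T, by omega, by omega, hh, hout⟩

end Enumer

/-! ### Sums of sets of solutions -/

/-- All sums of an element of `S` and an element of `T`. -/
def conv (S T : Multiset (Multiset ℕ)) : Multiset (Multiset ℕ) :=
  S.bind fun a => T.map (a + ·)

section conv

variable (S S' T T' U : Multiset (Multiset ℕ))

@[simp] theorem zero_conv : conv 0 T = 0 := rfl
@[simp] theorem conv_zero : conv S 0 = 0 := by simp [conv]
theorem add_conv : conv (S + S') T = conv S T + conv S' T := Multiset.add_bind _ _ _
theorem conv_add : conv S (T + T') = conv S T + conv S T' := by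
  simp [conv, Multiset.map_add, Multiset.bind_add]
theorem singleton_conv (a : Multiset ℕ) : conv {a} T = T.map (a + ·) := by simp [conv]
theorem conv_singleton (a : Multiset ℕ) : conv S {a} = S.map (· + a) := by
  simp [conv, Multiset.bind_singleton]
@[simp] theorem one_conv : conv {0} T = T := by simp [singleton_conv]
@[simp] theorem conv_one : conv S {0} = S := by simp [conv_singleton]

theorem conv_assoc : conv (conv S T) U = conv S (conv T U) := by
  simp only [conv, Multiset.bind_assoc, Multiset.bind_map, Multiset.map_bind, Multiset.map_map,
    Function.comp_def, add_assoc]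

theorem mem_conv {s : Multiset ℕ} : s ∈ conv S T ↔ ∃ a ∈ S, ∃ b ∈ T, a + b = s := by
  simp [conv, Multiset.mem_bind, Multiset.mem_map]

end conv

/-! ### Trees that represent sets of solutions -/

section Trees

open Quiver (Path)

variable {V : Type} [Quiver.{0} V]

/-- Trees with leaves, products and disjoint unions; subtrees are linked by paths. -/
inductive Tr : V → Type
  | leaf (x : V) : Tr x
  | prod {x y z : V} (π₁ : Path x y) (t₁ : Tr y) (π₂ : Path x z) (t₂ : Tr z) : Tr x
  | union {x y z : V} (π₁ : Path x y) (t₁ : Tr y) (π₂ : Path x z) (t₂ : Tr z) : Tr x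

variable (cd : ∀ x y : V, Path x y → ℕ)

namespace Tr

/-- The set of solutions represented by a tree that is reached on the path `π`. -/
def sols : {y : V} → Tr y → {x : V} → Path x y → Multiset (Multiset ℕ)
  | _, leaf _, _, π => {{cd _ _ π}}
  | _, prod π₁ t₁ π₂ t₂, _, π => conv (t₁.sols (π.comp π₁)) (t₂.sols (π.comp π₂))
  | _, union π₁ t₁ π₂ t₂, _, π => t₁.sols (π.comp π₁) + t₂.sols (π.comp π₂)

/-- The tree is a union. -/
def IsUnion : {x : V} → Tr x → Prop
  | _, union _ _ _ _ => True
  | _, _ => False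

/-- The leftmost subtree that is not a union, and the path to it. -/
def leftmost : {x : V} → Tr x → Σ y : V, Path x y × Tr y
  | x, leaf _ => ⟨x, .nil, leaf x⟩
  | x, prod π₁ t₁ π₂ t₂ => ⟨x, .nil, prod π₁ t₁ π₂ t₂⟩
  | _, union π₁ t₁ _ _ => ⟨t₁.leftmost.1, π₁.comp t₁.leftmost.2.1, t₁.leftmost.2.2⟩

/-- The solutions that do not come from the leftmost subtree. -/
def rest : {y : V} → Tr y → {x : V} → Path x y → Multiset (Multiset ℕ)
  | _, leaf _, _, _ => 0
  | _, prod _ _ _ _, _, _ => 0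
  | _, union π₁ t₁ π₂ t₂, _, π => t₂.sols cd (π.comp π₂) + t₁.rest (π.comp π₁)

/-- The number of vertices of a tree. -/
def size : {x : V} → Tr x → ℕ
  | _, leaf _ => 1
  | _, prod _ t₁ _ t₂ => t₁.size + t₂.size + 1
  | _, union _ t₁ _ t₂ => t₁.size + t₂.size + 1

theorem size_pos {x : V} (t : Tr x) : 0 < t.size := by cases t <;> simp [size]

theorem size_leftmost_le {x : V} (t : Tr x) : t.leftmost.2.2.size ≤ t.size := by
  induction t with
  | leaf => exact le_rfl
  | prod => exact le_rfl
  | union π₁ t₁ π₂ t₂ ih _ => simp only [leftmost, size]; omega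

theorem not_isUnion_leftmost {x : V} (t : Tr x) : ¬ t.leftmost.2.2.IsUnion := by
  induction t with
  | leaf => exact id
  | prod => exact id
  | union π₁ t₁ π₂ t₂ ih _ => exact ih

theorem rest_of_not_isUnion {x y : V} {t : Tr y} (h : ¬ t.IsUnion) (π : Path x y) :
    t.rest cd π = 0 := by
  cases t with
  | leaf => rfl
  | prod => rfl
  | union => exact (h trivial).elim

/-- This justifies choice points: after a jump to the leftmost subtree exactly `rest` is left, and
one pointer to the upper union suffices to recover it. -/
theorem sols_eq_add_rest {x y : V} (t : Tr y) (π : Path x y) :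
    t.sols cd π = t.leftmost.2.2.sols cd (π.comp t.leftmost.2.1) + t.rest cd π := by
  induction t with
  | leaf => simp [leftmost, rest]
  | prod => simp [leftmost, rest]
  | union π₁ t₁ π₂ t₂ ih _ =>
    simp only [leftmost, rest, sols]
    rw [ih, Path.comp_assoc]
    abel

/-- There is no tree for the empty set of solutions, so a partial solution can always be completed.
-/
theorem sols_ne_zero {x y : V} (t : Tr y) (π : Path x y) : ∃ s, s ∈ t.sols cd π := by
  induction t with
  | leaf => exact ⟨_, Multiset.mem_singleton_self _⟩
  | prod π₁ t₁ π₂ t₂ ih₁ ih₂ =>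
    obtain ⟨a, ha⟩ := ih₁ (π.comp π₁)
    obtain ⟨b, hb⟩ := ih₂ (π.comp π₂)
    exact ⟨a + b, (mem_conv _ _).2 ⟨a, ha, b, hb, rfl⟩⟩
  | union π₁ t₁ π₂ t₂ ih₁ ih₂ =>
    obtain ⟨a, ha⟩ := ih₁ (π.comp π₁)
    exact ⟨a, Multiset.mem_add.2 (.inl ha)⟩

/-- Leaves contribute one element and products add. Hence pending goals are bounded by the size of
the solution under construction. -/
theorem card_pos_of_mem_sols {x y : V} (t : Tr y) (π : Path x y) {s : Multiset ℕ}
    (hs : s ∈ t.sols cd π) : 0 < s.card := by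
  induction t generalizing s with
  | leaf => rw [Multiset.mem_singleton.1 hs]; simp
  | prod π₁ t₁ π₂ t₂ ih₁ ih₂ =>
    obtain ⟨a, ha, b, hb, rfl⟩ := (mem_conv _ _).1 hs
    have := ih₁ _ ha
    rw [Multiset.card_add]; omega
  | union π₁ t₁ π₂ t₂ ih₁ ih₂ =>
    rcases Multiset.mem_add.1 hs with h | h
    exacts [ih₁ _ h, ih₂ _ h]

/-! ### Trees in memory -/

/-- The address of the leftmost subtree. -/
def leftmostAddr (mem : ℕ → ℕ) : {x : V} → Tr x → ℕ → ℕ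
  | _, union _ t₁ _ _, a => t₁.leftmostAddr mem (mem (a + 1))
  | _, _, a => a

/-- The tree is stored at address `a`, in the part of the memory between `lo` and `hi`. -/
def Rep (mem : ℕ → ℕ) (lo : ℕ) : {x : V} → Tr x → ℕ → ℕ → Prop
  | _, leaf _, hi, a => lo ≤ a ∧ a + 7 ≤ hi ∧ mem a = 0
  | _, prod π₁ t₁ π₂ t₂, hi, a => lo ≤ a ∧ a + 7 ≤ hi ∧ mem a = 1 ∧
    t₁.Rep mem lo a (mem (a + 1)) ∧ mem (a + 2) = cd _ _ π₁ ∧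
    t₂.Rep mem lo a (mem (a + 3)) ∧ mem (a + 4) = cd _ _ π₂
  | _, union π₁ t₁ π₂ t₂, hi, a => lo ≤ a ∧ a + 7 ≤ hi ∧ mem a = 2 ∧
    t₁.Rep mem lo a (mem (a + 1)) ∧ mem (a + 2) = cd _ _ π₁ ∧
    t₂.Rep mem lo a (mem (a + 3)) ∧ mem (a + 4) = cd _ _ π₂ ∧
    mem (a + 5) = t₁.leftmostAddr mem (mem (a + 1)) ∧
    mem (a + 6) = cd _ _ (π₁.comp t₁.leftmost.2.1)

variable {cd} {mem : ℕ → ℕ} {lo hi a : ℕ}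

theorem Rep.le {x : V} {t : Tr x} (h : t.Rep cd mem lo hi a) : lo ≤ a := by
  cases t <;> exact h.1

theorem Rep.add_le {x : V} {t : Tr x} (h : t.Rep cd mem lo hi a) : a + 7 ≤ hi := by
  cases t <;> exact h.2.1

theorem Rep.mono_hi {x : V} {t : Tr x} (h : t.Rep cd mem lo hi a) {hi' : ℕ} (hh : hi ≤ hi') :
    t.Rep cd mem lo hi' a := by
  cases t <;> exact ⟨h.1, h.2.1.trans hh, h.2.2⟩

theorem leftmostAddr_congr {x : V} {t : Tr x} (h : t.Rep cd mem lo hi a) {mem' : ℕ → ℕ}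
    (hm : ∀ b, lo ≤ b → b < hi → mem' b = mem b) :
    t.leftmostAddr mem' a = t.leftmostAddr mem a := by
  induction t generalizing hi a with
  | leaf => rfl
  | prod => rfl
  | union π₁ t₁ π₂ t₂ ih _ =>
    obtain ⟨h₁, h₂, h₃, h₄, h₅, h₆, h₇, h₈, h₉⟩ := h
    simp only [leftmostAddr]
    rw [hm (a + 1) (by omega) (by omega)]
    exact ih h₄ fun b hb hb' => hm b hb (by omega)

/-- Subtrees end below the address of their parent, so only cells between `lo` and `hi` are read;
neither allocation above nor changes of rows below can damage a tree. -/
theorem Rep.congr {x : V} {t : Tr x} (h : t.Rep cd mem lo hi a) {mem' : ℕ → ℕ}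
    (hm : ∀ b, lo ≤ b → b < hi → mem' b = mem b) : t.Rep cd mem' lo hi a := by
  induction t generalizing hi a with
  | leaf =>
    obtain ⟨h₁, h₂, h₃⟩ := h
    exact ⟨h₁, h₂, by rw [hm a (by omega) (by omega), h₃]⟩
  | prod π₁ t₁ π₂ t₂ ih₁ ih₂ =>
    obtain ⟨h₁, h₂, h₃, h₄, h₅, h₆, h₇⟩ := h
    have hm' : ∀ b, lo ≤ b → b < a → mem' b = mem b := fun b hb hb' => hm b hb (by omega)
    have e : ∀ k < 7, mem' (a + k) = mem (a + k) := fun k hk => hm _ (by omega) (by omega)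
    refine ⟨h₁, h₂, ?_, ?_, ?_, ?_, ?_⟩
    · rw [← h₃]; exact e 0 (by omega)
    · rw [e 1 (by omega)]; exact ih₁ h₄ hm'
    · rw [e 2 (by omega), h₅]
    · rw [e 3 (by omega)]; exact ih₂ h₆ hm'
    · rw [e 4 (by omega), h₇]
  | union π₁ t₁ π₂ t₂ ih₁ ih₂ =>
    obtain ⟨h₁, h₂, h₃, h₄, h₅, h₆, h₇, h₈, h₉⟩ := h
    have hm' : ∀ b, lo ≤ b → b < a → mem' b = mem b := fun b hb hb' => hm b hb (by omega)
    have e : ∀ k < 7, mem' (a + k) = mem (a + k) := fun k hk => hm _ (by omega) (by omega)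
    refine ⟨h₁, h₂, ?_, ?_, ?_, ?_, ?_, ?_, ?_⟩
    · rw [← h₃]; exact e 0 (by omega)
    · rw [e 1 (by omega)]; exact ih₁ h₄ hm'
    · rw [e 2 (by omega), h₅]
    · rw [e 3 (by omega)]; exact ih₂ h₆ hm'
    · rw [e 4 (by omega), h₇]
    · rw [e 5 (by omega), h₈, e 1 (by omega), leftmostAddr_congr h₄ hm']
    · rw [e 6 (by omega), h₉]

theorem Rep.leftmost {x : V} {t : Tr x} (h : t.Rep cd mem lo hi a) :
    t.leftmost.2.2.Rep cd mem lo hi (t.leftmostAddr mem a) := by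
  induction t generalizing hi a with
  | leaf => exact h
  | prod => exact h
  | union π₁ t₁ π₂ t₂ ih _ =>
    obtain ⟨h₁, h₂, h₃, h₄, h₅, h₆, h₇, h₈, h₉⟩ := h
    exact (ih h₄).mono_hi (by omega)

theorem Rep.isUnion_iff {x : V} {t : Tr x} (h : t.Rep cd mem lo hi a) :
    t.IsUnion ↔ mem a = 2 := by
  cases t with
  | leaf => simp [IsUnion, h.2.2]
  | prod => simp [IsUnion, h.2.2.1]
  | union => simp [IsUnion, h.2.2.1]

theorem leftmostAddr_of_not_isUnion {x : V} {t : Tr x} (h : ¬ t.IsUnion) :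
    t.leftmostAddr mem a = a := by
  cases t with
  | leaf => rfl
  | prod => rfl
  | union => exact (h trivial).elim

end Tr

end Trees

/-! ### The enumeration program -/

section Program

open Var Cmd Ex

/-- Push a choice point. -/
def pushChoice (node code : Var) : Cmd :=
  store heap node ⨟ store (heap + 1) code ⨟ store (heap + 2) goals ⨟ store (heap + 3) outs ⨟
  store (heap + 4) choices ⨟ choices ≔ heap ⨟ heap ≔ heap + 5

/-- If the current tree is a union, push a choice point and go to the leftmost subtree. -/
def descend : Cmd :=
  ite (.eq (mem tgt) 2)
    (saved ≔ mem (tgt + 5) ⨟ comp smor mor (mem (tgt + 6)) ⨟ pushChoice tgt mor ⨟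
      tgt ≔ saved ⨟ mor ≔ smor)
    skip

/-- Add a leaf to the current solution and go to the next goal, or replace a product by its
factors. -/
def expand : Cmd :=
  ite (.eq (mem tgt) 0)
    (smor ≔ mor ⨟
      ite (.eq goals 0) (tgt ≔ 0) (tgt ≔ mem goals ⨟ mor ≔ mem (goals + 1) ⨟ goals ≔ mem (goals + 2)) ⨟
      store heap smor ⨟ store (heap + 1) outs ⨟ outs ≔ heap ⨟ heap ≔ heap + 5)
    (saved ≔ mem (tgt + 3) ⨟ comp smor mor (mem (tgt + 4)) ⨟ comp mor mor (mem (tgt + 2)) ⨟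
      tgt ≔ mem (tgt + 1) ⨟
      store heap saved ⨟ store (heap + 1) smor ⨟ store (heap + 2) goals ⨟ goals ≔ heap ⨟
      heap ≔ heap + 5)

/-- Complete the current solution. -/
def forward : Cmd := loop (.lt 0 tgt) (descend ⨟ expand)

/-- Print the current solution. -/
def printOuts : Cmd :=
  saved ≔ outs ⨟ loop (.lt 0 saved) (print (mem saved) ⨟ saved ≔ mem (saved + 1))

/-- Return to the last choice point, if there is one. -/
def backtrack : Cmd :=
  ite (.eq choices 0) skip
    (saved ≔ mem choices ⨟ smor ≔ mem (choices + 1) ⨟ goals ≔ mem (choices + 2) ⨟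
      outs ≔ mem (choices + 3) ⨟ heap ≔ choices ⨟ choices ≔ mem (choices + 4) ⨟
      tgt ≔ mem (saved + 3) ⨟ comp mor smor (mem (saved + 4)) ⨟
      ite (.eq (mem (mem (saved + 1))) 2)
        (comp smor smor (mem (saved + 2)) ⨟ saved ≔ mem (saved + 1) ⨟ pushChoice saved smor)
        skip)

/-- Find the tree for the queried vertex. -/
def enumInit : Cmd :=
  table ≔ mem 0 ⨟ width ≔ mem 1 ⨟ heap ≔ mem 2 ⨟ fin ≔ mem 3 ⨟ row ≔ table + query * width ⨟
  tgt ≔ mem (row + 2) ⨟ mor ≔ mem (row + 3)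

/-- Print the empty solution if it is one. -/
def enumEmpty : Cmd := ite (.eq (mem (fin + mem (row + 1))) 1) sep skip

/-- Print all nonempty solutions. -/
def enumLoop : Cmd := loop (.lt 0 tgt) ((forward ⨟ printOuts) ⨟ (sep ⨟ backtrack))

/-- The enumeration program. -/
def enumCmd : Cmd := enumInit ⨟ enumEmpty ⨟ enumLoop

end Program

/-! ### The state of the enumeration -/

section State

open Quiver (Path)

variable {V : Type} [Quiver.{0} V] (cd : ∀ x y : V, Path x y → ℕ)

/-- The codes of paths have at most `N` bits, and `op` composes them. -/
structure Coding (op : ℕ → ℕ → ℕ) (N : ℕ) : Prop where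
  lt : ∀ {x y : V} (π : Path x y), cd x y π < 2 ^ N
  op_eq : ∀ {x y z : V} (π₁ : Path x y) (π₂ : Path y z),
    op (cd _ _ π₁) (cd _ _ π₂) = cd _ _ (π₁.comp π₂)

/-- A tree to be expanded, and the path on which it is reached. -/
abbrev Goal (x : V) : Type := Σ y : V, Path x y × Tr y

/-- A choice point: a union whose leftmost subtree has been dealt with, the goals and the leaves
chosen before. -/
structure Choice (x : V) : Type where
  goal : Goal x
  goals : List (Goal x)
  outs : List ℕ

/-- The combinations of solutions of the goals in a list. -/
def goalSols {x : V} : List (Goal x) → Multiset (Multiset ℕ)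
  | [] => {0}
  | g :: G => conv (g.2.2.sols cd g.2.1) (goalSols G)

/-- The solutions that are found after return to a choice point. -/
def Choice.sols {x : V} (c : Choice x) : Multiset (Multiset ℕ) :=
  conv {(c.outs : Multiset ℕ)} (conv (c.goal.2.2.rest cd c.goal.2.1) (goalSols cd c.goals))

/-- The solutions that are found after return to the choice points in a list. -/
def choiceSols {x : V} (K : List (Choice x)) : Multiset (Multiset ℕ) :=
  (K.map (Choice.sols cd)).sum

/-- Every goal has a solution, and this solution has at least one element. -/
theorem exists_mem_goalSols {x : V} (G : List (Goal x)) :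
    ∃ s ∈ goalSols cd G, G.length ≤ s.card := by
  induction G with
  | nil => exact ⟨0, Multiset.mem_singleton_self _, le_rfl⟩
  | cons g G ih =>
    obtain ⟨s, hs, hc⟩ := ih
    obtain ⟨a, ha⟩ := g.2.2.sols_ne_zero cd g.2.1
    have := g.2.2.card_pos_of_mem_sols cd g.2.1 ha
    refine ⟨a + s, (mem_conv _ _).2 ⟨a, ha, s, hs, rfl⟩, ?_⟩
    rw [Multiset.card_add, List.length_cons]; omega

/-- The solutions that are still to be printed. -/
def pending {x : V} (g : Goal x) (G : List (Goal x)) (O : List ℕ) (K : List (Choice x)) :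
    Multiset (Multiset ℕ) :=
  conv {(O : Multiset ℕ)} (goalSols cd (g :: G)) + choiceSols cd K

/-- Some completion of the current partial solution is among the pending ones; it contains the known
elements and at least one for each goal. So a bound on solution sizes bounds the stacks. -/
theorem length_le_of_pending {x : V} {g : Goal x} {G : List (Goal x)} {O : List ℕ}
    {K : List (Choice x)} {M : ℕ} (h : ∀ s ∈ pending cd g G O K, s.card ≤ M) :
    O.length + G.length + 1 ≤ M := by
  obtain ⟨s, hs, hc⟩ := exists_mem_goalSols cd (g :: G)
  have := h (O + s) (Multiset.mem_add.2 (.inl ((mem_conv _ _).2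
    ⟨_, Multiset.mem_singleton_self _, s, hs, rfl⟩)))
  rw [Multiset.card_add, Multiset.coe_card] at this
  rw [List.length_cons] at hc
  omega

/-- A list of goals in memory. Trees are stored between `lo` and `top`, goals below `hi`. -/
def GoalsRep (mem : ℕ → ℕ) (lo top : ℕ) {x : V} (hi : ℕ) : List (Goal x) → ℕ → Prop
  | [], p => p = 0
  | g :: G, p => p ≠ 0 ∧ p + 5 ≤ hi ∧ g.2.2.Rep cd mem lo top (mem p) ∧
    mem (p + 1) = cd _ _ g.2.1 ∧ GoalsRep mem lo top hi G (mem (p + 2))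

/-- A partial solution in memory. -/
def OutsRep (mem : ℕ → ℕ) (hi : ℕ) : List ℕ → ℕ → Prop
  | [], p => p = 0
  | o :: O, p => p ≠ 0 ∧ p + 5 ≤ hi ∧ mem p = o ∧ OutsRep mem hi O (mem (p + 1))

/-- A bound for the addresses that are in use while a solution with `o` known elements and
`g` goals is constructed. -/
def addrBound (top o g : ℕ) : ℕ := 6 * top + (2 * o + g) * (5 * top + 10)

/-- A list of choice points in memory. -/
def ChoicesRep (mem : ℕ → ℕ) (lo top : ℕ) {x : V} : List (Choice x) → ℕ → ℕ → Prop
  | [], _, p => p = 0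
  | c :: K, hi, p => p ≠ 0 ∧ top ≤ p ∧ p + 5 ≤ hi ∧ c.goal.2.2.Rep cd mem lo top (mem p) ∧
    c.goal.2.2.IsUnion ∧ mem (p + 1) = cd _ _ c.goal.2.1 ∧
    GoalsRep cd mem lo top p c.goals (mem (p + 2)) ∧ OutsRep mem p c.outs (mem (p + 3)) ∧
    ChoicesRep mem lo top K p (mem (p + 4)) ∧
    -- When the choice point is used, its five cells are released and possibly taken again for the
    -- left subtree, while the current tree becomes the right one. Both subtrees have smaller
    -- addresses, so the weighted sum of heap end and tree address does not grow.
    p + 5 * mem p ≤ addrBound top c.outs.length c.goals.length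

variable {cd} {mem mem' : ℕ → ℕ} {lo top hi hi' p : ℕ} {x : V}

theorem GoalsRep.congr {G : List (Goal x)} (h : GoalsRep cd mem lo top hi G p) (hh : hi ≤ hi')
    (ht : top ≤ hi) (hm : ∀ b < hi, mem' b = mem b) : GoalsRep cd mem' lo top hi' G p := by
  induction G generalizing p with
  | nil => exact h
  | cons g G ih =>
    obtain ⟨h₁, h₂, h₃, h₄, h₅⟩ := h
    refine ⟨h₁, h₂.trans hh, ?_, ?_, ?_⟩
    · rw [hm p (by omega)]
      exact h₃.congr fun b _ hb => hm b (by omega)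
    · rw [hm _ (by omega), h₄]
    · rw [hm _ (by omega)]; exact ih h₅

theorem OutsRep.congr {O : List ℕ} (h : OutsRep mem hi O p) (hh : hi ≤ hi')
    (hm : ∀ b < hi, mem' b = mem b) : OutsRep mem' hi' O p := by
  induction O generalizing p with
  | nil => exact h
  | cons o O ih =>
    obtain ⟨h₁, h₂, h₃, h₄⟩ := h
    refine ⟨h₁, h₂.trans hh, ?_, ?_⟩
    · rw [hm p (by omega), h₃]
    · rw [hm _ (by omega)]; exact ih h₄

theorem ChoicesRep.congr {K : List (Choice x)} (h : ChoicesRep cd mem lo top K hi p)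
    (hh : hi ≤ hi') (hm : ∀ b < hi, mem' b = mem b) : ChoicesRep cd mem' lo top K hi' p := by
  induction K generalizing p hi hi' with
  | nil => exact h
  | cons c K ih =>
    obtain ⟨h₀, h₁, h₂, h₃, h₄, h₅, h₆, h₇, h₈, h₉⟩ := h
    have hm' : ∀ b < p, mem' b = mem b := fun b hb => hm b (by omega)
    refine ⟨h₀, h₁, h₂.trans hh, ?_, h₄, ?_, ?_, ?_, ?_, ?_⟩
    · rw [hm p (by omega)]
      exact h₃.congr fun b _ hb => hm b (by omega)
    · rw [hm _ (by omega), h₅]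
    · rw [hm _ (by omega)]; exact h₆.congr le_rfl h₁ hm'
    · rw [hm _ (by omega)]; exact h₇.congr le_rfl hm'
    · rw [hm _ (by omega)]; exact ih h₈ le_rfl hm'
    · rwa [hm p (by omega)]

variable (cd lo top)

/-- The goals, the leaves chosen so far and the choice points in a state. -/
structure Stacks (s : St) (G : List (Goal x)) (O : List ℕ) (K : List (Choice x)) : Prop where
  top_pos : 0 < top
  top_le : top ≤ s.var .heap
  goals : GoalsRep cd s.mem lo top (s.var .heap) G (s.var .goals)
  outs : OutsRep s.mem (s.var .heap) O (s.var .outs)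
  choices : ChoicesRep cd s.mem lo top K (s.var .heap) (s.var .choices)

/-- The current goal in a state. -/
structure Current (s : St) (g : Goal x) : Prop where
  rep : g.2.2.Rep cd s.mem lo top (s.var .tgt)
  mor : s.var .mor = cd _ _ g.2.1

variable {cd lo top}

theorem Stacks.congr {s s' : St} {G : List (Goal x)} {O : List ℕ} {K : List (Choice x)}
    (h : Stacks cd lo top s G O K) (hh : s.var .heap ≤ s'.var .heap)
    (hm : ∀ b < s.var .heap, s'.mem b = s.mem b) (h₁ : s'.var .goals = s.var .goals)
    (h₂ : s'.var .outs = s.var .outs) (h₃ : s'.var .choices = s.var .choices) :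
    Stacks cd lo top s' G O K where
  top_pos := h.top_pos
  top_le := h.top_le.trans hh
  goals := h₁ ▸ h.goals.congr hh h.top_le hm
  outs := h₂ ▸ h.outs.congr hh hm
  choices := h₃ ▸ h.choices.congr hh hm

end State

/-! ### Descending to a leftmost subtree and expanding it. -/

section Steps

open Quiver (Path)

variable {V : Type} [Quiver.{0} V] {cd : ∀ x y : V, Path x y → ℕ} {op : ℕ → ℕ → ℕ} {N : ℕ}
  {lo top : ℕ} {x : V} {s : St} {g : Goal x} {G : List (Goal x)} {O : List ℕ}
  {K : List (Choice x)} {Q : St → Prop}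

theorem wp_pushChoice {node code : Var} (hs : Stacks cd lo top s G O K) {g : Goal x}
    (hrep : g.2.2.Rep cd s.mem lo top (s.var node)) (hu : g.2.2.IsUnion)
    (hcode : s.var code = cd _ _ g.2.1)
    (hb : s.var .heap + 5 * s.var node ≤ addrBound top O.length G.length)
    (hN : s.var .heap + 5 < 2 ^ N)
    (hQ : ∀ s' : St, Stacks cd lo top s' G O (⟨g, G, O⟩ :: K) →
      s'.var .heap = s.var .heap + 5 → (∀ b < s.var .heap, s'.mem b = s.mem b) →
      s'.out = s.out → (∀ y, y ≠ .heap → y ≠ .choices → s'.var y = s.var y) → Q s') :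
    (pushChoice node code).wp op N Q s := by
  simp only [pushChoice, Cmd.wp, Ex.safe_var, Ex.safe_add, Ex.eval_var, Ex.eval_add,
    Ex.eval_ofNat, St.put_var, St.set_var, true_and, if_true, reduceCtorEq, if_false]
  refine ⟨hN, hQ _ ?_ (by simp) ?_ rfl ?_⟩
  · have hm : ∀ b < s.var .heap, (((((s.put (s.var .heap) (s.var node)).put (s.var .heap + 1)
      (s.var code)).put (s.var .heap + 2) (s.var .goals)).put (s.var .heap + 3) (s.var .outs)).put
      (s.var .heap + 4) (s.var .choices)).mem b = s.mem b := by
      intro b hb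
      simp only [St.put_mem, Function.update_apply]
      repeat rw [if_neg (by omega)]
    have hp := hs.top_pos
    have ht := hs.top_le
    refine ⟨hp, ?_, ?_, ?_, ?_⟩
    · simp; omega
    · simpa using hs.goals.congr (hi' := s.var .heap + 5) (by omega) ht hm
    · simpa using hs.outs.congr (hi' := s.var .heap + 5) (by omega) hm
    · simp only [ChoicesRep, St.set_var, St.set_mem, if_true, reduceCtorEq, if_false]
      refine ⟨by omega, ht, le_rfl, ?_, hu, ?_, ?_, ?_, ?_, ?_⟩
      · have := hrep.congr fun b _ hb => hm b (by omega)
        simpa using this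
      · simpa using hcode
      · simpa using hs.goals.congr le_rfl ht hm
      · simpa using hs.outs.congr le_rfl hm
      · simpa using hs.choices.congr le_rfl hm
      · simpa using hb
  · intro b hb
    simp only [St.put_mem, St.set_mem, Function.update_apply]
    repeat rw [if_neg (by omega)]
  · intro y h₁ h₂
    simp [h₁, h₂]

/-- The pointer and the path code stored in a union replace a whole walk to the left. The solutions
skipped are moved to the new choice point, so the pending multiset is unchanged. -/
theorem wp_descend (hcd : Coding cd op N) (hs : Stacks cd lo top s G O K)
    (hg : Current cd lo top s g)
    (hb : s.var .heap + 5 * s.var .tgt ≤ addrBound top O.length G.length)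
    (hN : s.var .heap + 5 < 2 ^ N)
    (hQ : ∀ (s' : St) (g' : Goal x) (K' : List (Choice x)), Stacks cd lo top s' G O K' →
      Current cd lo top s' g' → ¬ g'.2.2.IsUnion → g'.2.2.size ≤ g.2.2.size →
      pending cd g' G O K' = pending cd g G O K → s'.var .heap ≤ s.var .heap + 5 →
      s'.out = s.out → Q s') :
    descend.wp op N Q s := by
  obtain ⟨y, π, t⟩ := g
  have hrep := hg.rep
  have hmor := hg.mor
  simp only at hrep hmor
  simp only [descend, Cmd.wp, Cond.eval, Ex.eval_mem, Ex.eval_var, Ex.eval_ofNat]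
  refine ⟨fun hu => ?_, fun hu => ?_⟩
  · have htu := hrep.isUnion_iff.2 hu
    cases t with
    | leaf => exact htu.elim
    | prod => exact htu.elim
    | @union _ y₁ y₂ π₁ t₁ π₂ t₂ =>
    obtain ⟨h₁, h₂, h₃, h₄, h₅, h₆, h₇, h₈, h₉⟩ := id hrep
    simp only [Ex.safe_mem, true_and, Ex.eval_mem, Ex.eval_add, Ex.eval_var, Ex.eval_ofNat,
      St.set_var, St.set_mem, if_false, reduceCtorEq, hmor, h₈, h₉, hcd.op_eq]
    refine ⟨hcd.lt _, ?_⟩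
    refine wp_pushChoice (cd := cd) (lo := lo) (top := top) (G := G) (O := O) (K := K)
      (g := ⟨y, π, .union π₁ t₁ π₂ t₂⟩) (hs.congr (by simp) (by simp) (by simp) (by simp) (by simp))
      (by simpa using hrep) trivial (by simpa using hmor) (by simpa using hb) (by simpa using hN)
      fun s' hs' hh hm ho hv => ?_
    simp only [Ex.safe_var, Ex.eval_var, true_and]
    have ht := hs.top_le
    refine hQ _ ⟨_, π.comp (π₁.comp t₁.leftmost.2.1), t₁.leftmost.2.2⟩ _ (hs'.congr (by simp)
      (by simp) (by simp) (by simp) (by simp)) ⟨?_, ?_⟩ t₁.not_isUnion_leftmost ?_ ?_ ?_ ?_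
    · simp only [St.set_var, if_true, St.set_mem, if_false, reduceCtorEq]
      rw [hv .saved (by simp) (by simp)]
      have := h₄.leftmost.mono_hi (hi' := top) (by omega)
      simpa using this.congr fun b _ hb => hm b (by simp; omega)
    · simp only [St.set_var, if_true, if_false, reduceCtorEq]
      rw [hv .smor (by simp) (by simp)]
      simp
    · have := t₁.size_leftmost_le
      simp only [Tr.size]; omega
    -- The first summand belongs to the new goal, the second to the new choice point.
    · have e := (Tr.union π₁ t₁ π₂ t₂).sols_eq_add_rest cd π
      simp only [pending, goalSols, choiceSols, List.map_cons, List.sum_cons, Choice.sols]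
      rw [e]
      simp only [Tr.leftmost, add_conv, conv_add]
      abel
    · simp [hh]
    · exact ho
  · exact hQ s _ K hs hg (fun h => hu (hrep.isUnion_iff.1 h)) le_rfl rfl (by omega) rfl

/-- The state in which a solution is complete. -/
structure Complete (cd : ∀ x y : V, Path x y → ℕ) (lo top : ℕ) (s : St) (O : List ℕ)
    (K : List (Choice x)) : Prop where
  tgt : s.var .tgt = 0
  top_pos : 0 < top
  top_le : top ≤ s.var .heap
  outs : OutsRep s.mem (s.var .heap) O (s.var .outs)
  choices : ChoicesRep cd s.mem lo top K (s.var .heap) (s.var .choices)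

/-- The number of vertices of the goals in a list. -/
def goalsSize (G : List (Goal x)) : ℕ := (G.map fun g => g.2.2.size).sum

/-- An expansion raises 2o + g by one and thereby the bound by `5 * top + 10`. This pays for five
cells of a choice point, five cells of the expansion, and the address of the next tree with weight
5. -/
theorem addrBound_step {o g o' g' H T : ℕ} (h : 2 * o + g + 1 ≤ 2 * o' + g')
    (hH : H ≤ addrBound top o g + 5) (hT : T ≤ top) :
    H + 5 + 5 * T ≤ addrBound top o' g' := by
  have : (2 * o + g + 1) * (5 * top + 10) ≤ (2 * o' + g') * (5 * top + 10) :=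
    Nat.mul_le_mul_right _ h
  simp only [addrBound, add_mul, one_mul] at *
  omega

/-- A leaf turns a goal into an element, a product adds a goal: 2o + g grows by one in both cases,
and the total size of the goals decreases, which gives termination. A leaf without further goals
completes the solution, signalled by the null pointer in `tgt`. -/
theorem wp_expand (hcd : Coding cd op N) (hs : Stacks cd lo top s G O K)
    (hg : Current cd lo top s g) (hu : ¬ g.2.2.IsUnion)
    (hb : s.var .heap ≤ addrBound top O.length G.length + 5)
    (hN : s.var .heap + 5 < 2 ^ N)
    (hQ : ∀ (s' : St) (g' : Goal x) (G' : List (Goal x)) (O' : List ℕ),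
      Stacks cd lo top s' G' O' K → Current cd lo top s' g' →
      goalsSize (g' :: G') < goalsSize (g :: G) →
      pending cd g' G' O' K = pending cd g G O K →
      2 * O'.length + G'.length = 2 * O.length + G.length + 1 →
      s'.var .heap + 5 * s'.var .tgt ≤ addrBound top O'.length G'.length →
      s'.out = s.out → Q s')
    (hQ' : ∀ (s' : St) (O' : List ℕ), Complete cd lo top s' O' K → G = [] →
      O'.length = O.length + 1 → {(O' : Multiset ℕ)} + choiceSols cd K = pending cd g G O K →
      s'.out = s.out → Q s') :
    expand.wp op N Q s := by
  obtain ⟨y, π, t⟩ := g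
  have hrep := hg.rep
  have hmor := hg.mor
  have hp := hs.top_pos
  have ht := hs.top_le
  simp only at hrep hmor
  have hm : ∀ a b, ∀ d < s.var .heap,
      ((s.put (s.var .heap) a).put (s.var .heap + 1) b).mem d = s.mem d := by
    intro a b d hd
    simp only [St.put_mem, Function.update_apply]
    repeat rw [if_neg (by omega)]
  simp only [expand, Cmd.wp, Cond.eval, Ex.eval_mem, Ex.eval_var, Ex.eval_ofNat]
  refine ⟨fun h0 => ⟨by simp, fun hG => ?_, fun hG => ?_⟩, fun h0 => ?_⟩
  · cases t with
    | union => exact (hu trivial).elim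
    | prod => rw [hrep.2.2.1] at h0; omega
    | leaf =>
    cases G with
    | cons g G => exact (hs.goals.1 (by simpa using hG)).elim
    | nil =>
    simp only [Ex.safe_var, Ex.safe_add, Ex.safe_ofNat, Ex.eval_var, Ex.eval_add,
      Ex.eval_ofNat, St.put_var, St.set_var, true_and, if_true, reduceCtorEq, if_false]
    refine ⟨by norm_num, hN, hQ' _ (cd _ _ π :: O) ⟨by simp, hp, ?_, ?_, ?_⟩ rfl rfl ?_ rfl⟩
    · simp; omega
    · simp only [OutsRep, St.set_var, if_true, St.set_mem, reduceCtorEq, if_false]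
      refine ⟨by omega, le_rfl, by simp [hmor], ?_⟩
      simpa using hs.outs.congr (hi' := s.var .heap + 5) (by omega) (hm _ _)
    · simpa using hs.choices.congr (hi' := s.var .heap + 5) (by omega) (hm _ _)
    · simp [pending, goalSols, Tr.sols, singleton_conv, ← Multiset.cons_coe]
      rw [add_comm, Multiset.singleton_add]
  · cases t with
    | union => exact (hu trivial).elim
    | prod => rw [hrep.2.2.1] at h0; omega
    | leaf =>
    cases G with
    | nil => exact (hG (by simpa [GoalsRep] using hs.goals)).elim
    | cons g G =>
    obtain ⟨hg₁, hg₂, hg₃, hg₄, hg₅⟩ := id hs.goals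
    simp only [Ex.safe_var, Ex.safe_add, Ex.safe_mem, Ex.eval_var, Ex.eval_add, Ex.eval_mem,
      Ex.eval_ofNat, St.put_var, St.set_var, St.set_mem, true_and, if_true, reduceCtorEq, if_false]
    refine ⟨hN, hQ _ g G (cd _ _ π :: O) ⟨hp, ?_, ?_, ?_, ?_⟩ ⟨?_, ?_⟩ ?_ ?_ ?_ ?_ rfl⟩
    · simp; omega
    · simpa using GoalsRep.congr (hi' := s.var .heap + 5) hg₅ (by omega) ht (hm _ _)
    · simp only [OutsRep, St.set_var, if_true, St.set_mem, reduceCtorEq, if_false]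
      refine ⟨by omega, le_rfl, by simp [hmor], ?_⟩
      simpa using hs.outs.congr (hi' := s.var .heap + 5) (by omega) (hm _ _)
    · simpa using hs.choices.congr (hi' := s.var .heap + 5) (by omega) (hm _ _)
    · simpa using hg₃.congr fun b _ hb => hm _ _ b (by omega)
    · simpa using hg₄
    · simp [goalsSize, Tr.size]
    · simp only [pending, goalSols, Tr.sols, ← conv_assoc, singleton_conv, Multiset.map_singleton]
      simp only [← Multiset.singleton_add, ← Multiset.cons_coe]
      rw [add_comm {cd _ _ π}, Multiset.map_map]
      simp only [Function.comp_def, add_assoc]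
    · simp; omega
    · have := hg₃.add_le
      have := addrBound_step (top := top) (o := O.length) (g := G.length + 1)
        (o' := O.length + 1) (g' := G.length) (T := s.mem (s.var .goals)) (by omega) hb (by omega)
      simpa using this
  · cases t with
    | union => exact (hu trivial).elim
    | leaf => exact (h0 hrep.2.2).elim
    | @prod _ y₁ y₂ π₁ t₁ π₂ t₂ =>
    obtain ⟨h₁, h₂, h₃, h₄, h₅, h₆, h₇⟩ := id hrep
    simp only [Ex.safe_var, Ex.safe_add, Ex.safe_mem, Ex.eval_var, Ex.eval_add, Ex.eval_mem,
      Ex.eval_ofNat, St.put_var, St.set_var, St.set_mem, true_and, if_true, reduceCtorEq, if_false,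
      hmor, h₅, h₇, hcd.op_eq]
    have hm' : ∀ a b c, ∀ d < s.var .heap, (((s.put (s.var .heap) a).put (s.var .heap + 1) b).put
        (s.var .heap + 2) c).mem d = s.mem d := by
      intro a b c d hd
      simp only [St.put_mem, Function.update_apply]
      repeat rw [if_neg (by omega)]
    refine ⟨hcd.lt _, hcd.lt _, hN, hQ _ ⟨_, π.comp π₁, t₁⟩ (⟨_, π.comp π₂, t₂⟩ :: G) O
      ⟨hp, ?_, ?_, ?_, ?_⟩ ⟨?_, ?_⟩ ?_ ?_ ?_ ?_ rfl⟩
    · simp; omega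
    · simp only [GoalsRep, St.set_var, if_true, St.set_mem, reduceCtorEq, if_false]
      refine ⟨by omega, le_rfl, ?_, by simp, ?_⟩
      -- Goals, outputs and choice points are allocated above `top`, hence the stored trees are
      -- unaffected.
      · have := (h₆.mono_hi (hi' := top) (by omega)).congr fun b _ hb =>
          hm' (s.mem (s.var .tgt + 3)) (cd _ _ (π.comp π₂)) (s.var .goals) b (by omega)
        simpa using this
      · simpa using hs.goals.congr (hi' := s.var .heap + 5) (by omega) ht (hm' _ _ _)
    · simpa using hs.outs.congr (hi' := s.var .heap + 5) (by omega) (hm' _ _ _)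
    · simpa using hs.choices.congr (hi' := s.var .heap + 5) (by omega) (hm' _ _ _)
    · have := (h₄.mono_hi (hi' := top) (by omega)).congr fun b _ hb =>
          hm' (s.mem (s.var .tgt + 3)) (cd _ _ (π.comp π₂)) (s.var .goals) b (by omega)
      simpa using this
    · simp
    · simp [goalsSize, Tr.size]; omega
    · simp only [pending, goalSols, Tr.sols, conv_assoc]
    · simp; omega
    · have := h₄.add_le
      have := addrBound_step (top := top) (o := O.length) (g := G.length)
        (o' := O.length) (g' := G.length + 1) (T := s.mem (s.var .tgt + 1)) (by omega) hb (by omega)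
      simpa using this

end Steps

/-! ### Completing a solution, printing it, and backtracking. -/

section Enumeration

open Quiver (Path)

variable {V : Type} [Quiver.{0} V] {cd : ∀ x y : V, Path x y → ℕ} {op : ℕ → ℕ → ℕ} {N M : ℕ}
  {lo top : ℕ} {x : V} {s : St} {g : Goal x} {G : List (Goal x)} {O : List ℕ}
  {K : List (Choice x)} {Q : St → Prop}

theorem addrBound_mono {o g o' g' : ℕ} (h : 2 * o + g ≤ 2 * o' + g') :
    addrBound top o g ≤ addrBound top o' g' :=
  Nat.add_le_add_left (Nat.mul_le_mul_right _ h) _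

/-- The time for one iteration of `forward`. -/
def forwardTime : ℕ := (Cond.lt 0 (Ex.var .tgt)).len + (descend.cost + expand.cost) + 1

/-- Induction on the total size of the goals, which may be huge and does not enter the time bound.
The time is charged to 2o + g, which grows by one per iteration; the surplus on the right covers the
final test. The bound refers to the length of the result, which is why it is stated for `Exec` and
not through `Tri`. -/
theorem exec_forward (hcd : Coding cd op N) (hlo : 0 < lo) (hN₂ : 2 ≤ N)
    (hN : addrBound top M M + 10 < 2 ^ N) (n : ℕ) :
    ∀ {s : St} {g : Goal x} {G : List (Goal x)} {O : List ℕ} {K : List (Choice x)},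
      goalsSize (g :: G) ≤ n → s.Bounded N → Stacks cd lo top s G O K → Current cd lo top s g →
      s.var .heap + 5 * s.var .tgt ≤ addrBound top O.length G.length →
      (∀ a ∈ pending cd g G O K, a.card ≤ M) →
      ∃ (T : ℕ) (s' : St) (O' : List ℕ) (K' : List (Choice x)), Exec op N forward s T s' ∧
        s'.Bounded N ∧ Complete cd lo top s' O' K' ∧ s'.out = s.out ∧
        {(O' : Multiset ℕ)} + choiceSols cd K' = pending cd g G O K ∧
        T + forwardTime * (2 * O.length + G.length) ≤ forwardTime * (2 * O'.length + 1) := by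
  induction n with
  | zero =>
    intro s g G O K hn
    have := g.2.2.size_pos
    simp [goalsSize] at hn; omega
  | succ n ih =>
    intro s g G O K hn hbd hs hg hb hM
    -- Both lengths stay below `M`, so every address fits although the number of iterations is not
    -- fixed in advance.
    have hlen := length_le_of_pending cd hM
    have hAB : addrBound top O.length G.length ≤ addrBound top M M := addrBound_mono (by omega)
    have htgt : (Cond.lt 0 (Ex.var .tgt)).eval s := by
      have := hg.rep.le
      simp only [Cond.eval, Ex.eval_var, Ex.eval_ofNat]; omega
    have step : Tri op N (descend ⨟ expand) s (descend.cost + expand.cost) fun s' =>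
        (∃ (g' : Goal x) (G' : List (Goal x)) (O' : List ℕ) (K' : List (Choice x)),
          Stacks cd lo top s' G' O' K' ∧ Current cd lo top s' g' ∧
          goalsSize (g' :: G') < goalsSize (g :: G) ∧
          pending cd g' G' O' K' = pending cd g G O K ∧
          2 * O'.length + G'.length = 2 * O.length + G.length + 1 ∧
          s'.var .heap + 5 * s'.var .tgt ≤ addrBound top O'.length G'.length ∧ s'.out = s.out) ∨
        ∃ (O' : List ℕ) (K' : List (Choice x)), Complete cd lo top s' O' K' ∧ G = [] ∧
          O'.length = O.length + 1 ∧
          {(O' : Multiset ℕ)} + choiceSols cd K' = pending cd g G O K ∧ s'.out = s.out := by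
      refine Tri.of_wp hN₂ (c := descend ⨟ expand) ?_
      refine wp_descend hcd hs hg hb (by omega) fun s₁ g₁ K₁ hs₁ hg₁ hu₁ hsz₁ hp₁ hh₁ ho₁ => ?_
      refine wp_expand hcd hs₁ hg₁ hu₁ (by omega) (by omega)
        (fun s₂ g₂ G₂ O₂ hs₂ hg₂ hsz₂ hp₂ hl₂ hb₂ ho₂ => .inl ⟨g₂, G₂, O₂, K₁, hs₂, hg₂, ?_,
          hp₂.trans hp₁, hl₂, hb₂, ho₂.trans ho₁⟩)
        (fun s₂ O₂ hc₂ hG hl₂ hp₂ ho₂ => .inr ⟨O₂, K₁, hc₂, hG, hl₂, hp₂.trans hp₁,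
          ho₂.trans ho₁⟩)
      simp only [goalsSize, List.map_cons, List.sum_cons] at hsz₂ ⊢
      omega
    obtain ⟨t₁, ht₁, s₁, e₁, b₁, h₁⟩ := step hbd
    rcases h₁ with ⟨g₁, G₁, O₁, K₁, hs₁, hg₁, hsz₁, hp₁, hl₁, hb₁, ho₁⟩ |
      ⟨O₁, K₁, hc₁, rfl, hl₁, hp₁, ho₁⟩
    · obtain ⟨T, s', O', K', e, b, hc, ho, hp, hT⟩ :=
        ih (by omega) b₁ hs₁ hg₁ hb₁ (by rwa [hp₁])
      refine ⟨_, s', O', K', .loop_true htgt e₁ e, b, hc, ho.trans ho₁, hp.trans hp₁, ?_⟩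
      rw [hl₁, mul_add _ _ 1, mul_one] at hT
      have : forwardTime = (Cond.lt 0 (Ex.var .tgt)).len + (descend.cost + expand.cost) + 1 := rfl
      omega
    · refine ⟨_, s₁, O₁, K₁, .loop_true htgt e₁ (.loop_false ?_), b₁, hc₁, ho₁, hp₁, ?_⟩
      · simp [Cond.eval, hc₁.tgt]
      · rw [hl₁]
        have : forwardTime = (Cond.lt 0 (Ex.var .tgt)).len + (descend.cost + expand.cost) + 1 := rfl
        simp only [mul_add, List.length_nil]
        omega

/-- A bound for the time to print one element of a solution. -/
def printTime : ℕ :=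
  (Cond.lt 0 (Ex.var .saved)).len +
    (Cmd.print (.mem (.var .saved)) ⨟ .assign .saved (.mem (.var .saved + 1))).cost + 1

theorem tri_printOuts (hN₂ : 2 ≤ N) (hc : Complete cd lo top s O K) :
    Tri op N printOuts s (printTime * (O.length + 2)) fun s' =>
      Complete cd lo top s' O K ∧ s'.out = s.out ++ O.map some := by
  have h₁ : Tri op N (.assign .saved (.var .outs)) s 2 fun s' => s' = s.set .saved (s.var .outs) :=
    Tri.of_wp hN₂ ⟨trivial, rfl⟩
  refine Tri.mono (T := 2 + (O.length * printTime + printTime)) (Tri.seq (h₁.mono le_rfl ?_)) ?_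
    fun _ => id
  · rintro s₁ rfl
    refine Tri.mono (Tri.loop (k := O.length) (T := (Cmd.print (.mem (.var .saved)) ⨟
      -- The list `R` consists of the elements that are still to be printed.
      .assign .saved (.mem (.var .saved + 1))).cost) (fun k s' => ∃ R : List ℕ, R.length = k ∧
      OutsRep s.mem (s.var .heap) R (s'.var .saved) ∧ s'.out ++ R.map some = s.out ++ O.map some ∧
      s'.mem = s.mem ∧ ∀ y, y ≠ .saved → s'.var y = s.var y) ?_
      (Q := fun s' => Complete cd lo top s' O K ∧ s'.out = s.out ++ O.map some) ?_ ?_) ?_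
      fun _ => id
    · rintro k s' ⟨R, rfl, hR, ho, hm, hv⟩ hcond
      refine Tri.of_wp hN₂ ?_
      simp only [Cond.eval, Ex.eval_var, Ex.eval_ofNat] at hcond
      cases R with
      | nil => simp [OutsRep] at hR; omega
      | cons o R =>
        obtain ⟨h₁, h₂, h₃, h₄⟩ := hR
        refine ⟨trivial, R.length, by simp, R, rfl, ?_, ?_, hm, ?_⟩
        · simpa [hm] using h₄
        · rw [← ho]; simp [hm, h₃]
        · intro y hy
          simp [hy, hv y hy]
    · rintro k s' ⟨R, rfl, hR, ho, hm, hv⟩ hcond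
      simp only [Cond.eval, Ex.eval_var, Ex.eval_ofNat] at hcond
      cases R with
      | cons o R => exact (hR.1 (by omega)).elim
      | nil =>
        refine ⟨⟨?_, hc.top_pos, ?_, ?_, ?_⟩, by simpa using ho⟩
        · rw [hv _ (by simp), hc.tgt]
        · rw [hv _ (by simp)]; exact hc.top_le
        · rw [hv .outs (by simp), hv .heap (by simp), hm]; exact hc.outs
        · rw [hv .choices (by simp), hv .heap (by simp), hm]; exact hc.choices
    · exact ⟨O, rfl, by simpa using hc.outs, rfl, rfl, fun y hy => by simp [hy]⟩
    · have : printTime = (Cond.lt 0 (Ex.var .saved)).len + (Cmd.print (.mem (.var .saved)) ⨟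
        .assign .saved (.mem (.var .saved + 1))).cost + 1 := rfl
      rw [← this]; omega
  · have : 2 ≤ printTime := by decide
    nlinarith

/-- What is left of a union is its right subtree together with the rest of its left subtree. The
former becomes the current goal, the latter a new choice point if the left subtree is a union.
Records older than a choice point lie below it, so the heap can be reset to its address before the
new one is pushed. -/
theorem wp_backtrack (hcd : Coding cd op N) (hc : Complete cd lo top s O K)
    (hb : ∀ c ∈ K, addrBound top c.outs.length c.goals.length + 5 < 2 ^ N)
    (hQ : ∀ (s' : St) (g' : Goal x) (G' : List (Goal x)) (O' : List ℕ) (K' : List (Choice x)),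
      Stacks cd lo top s' G' O' K' → Current cd lo top s' g' →
      pending cd g' G' O' K' = choiceSols cd K →
      s'.var .heap + 5 * s'.var .tgt ≤ addrBound top O'.length G'.length → s'.out = s.out → Q s')
    (hQ' : K = [] → Q s) :
    backtrack.wp op N Q s := by
  have hcs := hc.choices
  simp only [backtrack, Cmd.wp, Cond.eval, Ex.eval_mem, Ex.eval_var, Ex.eval_ofNat]
  refine ⟨fun h => ?_, fun h => ?_⟩
  · cases K with
    | nil => exact hQ' rfl
    | cons c K => exact (hcs.1 h).elim
  · cases K with
    | nil => exact (h hcs).elim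
    | cons c K =>
    obtain ⟨⟨y, π, t⟩, G, O⟩ := c
    obtain ⟨h₀, h₁, h₂, h₃, h₄, h₅, h₆, h₇, h₈, h₉⟩ := hcs
    have hbd := hb _ List.mem_cons_self
    simp only at h₃ h₄ h₅ h₆ h₇ h₉ hbd
    cases t with
    | leaf => exact h₄.elim
    | prod => exact h₄.elim
    | @union _ y₁ y₂ π₁ t₁ π₂ t₂ =>
    obtain ⟨i₁, i₂, i₃, i₄, i₅, i₆, i₇, i₈, i₉⟩ := id h₃
    have a₁ := i₄.add_le
    have a₂ := i₆.add_le
    simp only [Ex.safe_var, Ex.safe_add, Ex.safe_mem, Ex.eval_var, Ex.eval_add, Ex.eval_mem,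
      Ex.eval_ofNat, St.put_var, St.set_var, St.set_mem, true_and, if_true, reduceCtorEq, if_false,
      h₅, i₇, i₅, hcd.op_eq]
    refine ⟨hcd.lt _, fun hu => ⟨hcd.lt _, ?_⟩, fun hu => ?_⟩
    · refine wp_pushChoice (cd := cd) (lo := lo) (top := top) (G := G) (O := O) (K := K)
        (g := ⟨y₁, π.comp π₁, t₁⟩) ⟨hc.top_pos, ?_, ?_, ?_, ?_⟩ ?_ (i₄.isUnion_iff.2 hu) ?_ ?_ ?_
        fun s' hs' hh hm ho hv => ?_
      · simpa using h₁
      · simpa using h₆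
      · simpa using h₇
      · simpa using h₈
      · simpa using i₄.mono_hi (hi' := top) (by omega)
      · simp
      · simp; omega
      · simp; omega
      · refine hQ s' ⟨y₂, π.comp π₂, t₂⟩ G O _ hs' ⟨?_, ?_⟩ ?_ ?_ ?_
        · rw [hv .tgt (by simp) (by simp)]
          have := i₆.mono_hi (hi' := top) (by omega)
          simpa using this.congr fun b _ hb => hm b (by simp; omega)
        · rw [hv .mor (by simp) (by simp)]
          simp
        · simp only [pending, goalSols, choiceSols, List.map_cons, List.sum_cons, Choice.sols,
            Tr.rest, add_conv, conv_add]
          abel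
        · rw [hv .tgt (by simp) (by simp), hh]
          simp; omega
        · rw [ho]; simp
    · refine hQ _ ⟨y₂, π.comp π₂, t₂⟩ G O K ⟨hc.top_pos, ?_, ?_, ?_, ?_⟩ ⟨?_, ?_⟩ ?_ ?_ ?_
      · simpa using h₁
      · simpa using h₆
      · simpa using h₇
      · simpa using h₈
      · simpa using i₆.mono_hi (hi' := top) (by omega)
      · simp
      -- If the left subtree is not a union, it has already been dealt with completely.
      · have : t₁.rest cd (π.comp π₁) = 0 :=
          Tr.rest_of_not_isUnion cd (fun h => hu (i₄.isUnion_iff.1 h)) _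
        simp only [pending, goalSols, choiceSols, List.map_cons, List.sum_cons, Choice.sols,
            Tr.rest, this, add_zero]
      · simp; omega
      · simp

end Enumeration

/-! ### The complete enumeration phase. -/

section Enumeration

open Quiver (Path)

variable {V : Type} [Quiver.{0} V] {cd : ∀ x y : V, Path x y → ℕ} {op : ℕ → ℕ → ℕ} {N M : ℕ}
  {lo top : ℕ} {x : V}

/-- The right subtree of the union at a choice point yields a pending solution that extends the
saved elements and goals, so the argument for the current goal applies to saved ones too. -/
theorem ChoicesRep.length_le {mem : ℕ → ℕ} {hi p : ℕ} {K : List (Choice x)}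
    (h : ChoicesRep cd mem lo top K hi p) (hM : ∀ a ∈ choiceSols cd K, a.card ≤ M) :
    ∀ c ∈ K, c.outs.length + c.goals.length + 1 ≤ M := by
  induction K generalizing hi p with
  | nil => simp
  | cons c K ih =>
    obtain ⟨h₀, h₁, h₂, h₃, h₄, h₅, h₆, h₇, h₈, h₉⟩ := h
    have hM' : ∀ a ∈ choiceSols cd K, a.card ≤ M := fun a ha =>
      hM a (by rw [choiceSols, List.map_cons, List.sum_cons]; exact Multiset.mem_add.2 (.inr ha))
    refine List.forall_mem_cons.2 ⟨?_, ih h₈ hM'⟩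
    obtain ⟨⟨y, π, t⟩, G, O⟩ := c
    cases t with
    | leaf => exact h₄.elim
    | prod => exact h₄.elim
    | union π₁ t₁ π₂ t₂ =>
    refine length_le_of_pending cd (g := ⟨_, π.comp π₂, t₂⟩) (K := []) fun a ha => hM a ?_
    simp only [pending, goalSols, choiceSols, List.map_nil, List.sum_nil, add_zero] at ha
    simp only [choiceSols, List.map_cons, List.sum_cons, Choice.sols, Tr.rest, add_conv, conv_add]
    exact Multiset.mem_add.2 (.inl (Multiset.mem_add.2 (.inl ha)))

/-- The delay constant of the enumeration. -/
def enumTime : ℕ :=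
  (Cond.lt 0 (Ex.var .tgt)).len + 1 + 2 * forwardTime + 2 * printTime +
    (Cmd.sep ⨟ backtrack).cost + 1

/-- Induction on the number of pending solutions: a round prints one of them, and what remains is
what the choice points stand for. The structured loop is cut open here, because the delay refers to
intermediate times of its execution. -/
theorem enumer_enumLoop {P : Program} {W n : ℕ} (hcd : Coding cd op N) (hlo : 0 < lo) (hN₂ : 2 ≤ N)
    (hN : addrBound top M M + 10 < 2 ^ N) (hW : N * enumLoop.weight ≤ W)
    (hP : CodeAt P n (enumLoop.code n)) (hend : P[n + enumLoop.len]? = none) (k : ℕ) :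
    ∀ {σ : Config} {s : St} {g : Goal x} {G : List (Goal x)} {O : List ℕ} {K : List (Choice x)},
      (pending cd g G O K).card ≤ k → σ.pc = n → Sim s σ → σ.Fits W → s.Bounded N →
      Stacks cd lo top s G O K → Current cd lo top s g →
      s.var .heap + 5 * s.var .tgt ≤ addrBound top O.length G.length →
      (∀ a ∈ pending cd g G O K, a.card ≤ M) →
      ∃ L : List (List ℕ), Enumer op P W enumTime σ L ∧
        multisets L = pending cd g G O K := by
  classical
  have hN0 : 0 < N := by omega
  have hKK : enumTime = (Cond.lt 0 (Ex.var .tgt)).len + 1 + 2 * forwardTime + 2 * printTime +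
    (Cmd.sep ⨟ backtrack).cost + 1 := rfl
  have hP' : CodeAt P n (Cmd.code (.loop (.lt 0 (Ex.var .tgt))
    ((forward ⨟ printOuts) ⨟ (.sep ⨟ backtrack))) n) := hP
  have hW' : N * ((Cond.lt 0 (Ex.var .tgt)).weight + ((forward ⨟ printOuts).weight +
    (Cmd.sep ⨟ backtrack).weight)) ≤ W := hW
  have hend' : P[n + ((Cond.lt 0 (Ex.var .tgt)).len + (1 + ((forward ⨟ printOuts).len +
    (Cmd.sep ⨟ backtrack).len + 1)))]? = none := hend
  generalize hc : Cond.lt 0 (Ex.var .tgt) = c at *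
  simp only [mul_add] at hW'
  have hcode := hP'.left
  have hbody := hP'.right.right.left
  have hback := hP'.right.right.right.head
  have hexit := hP'.right.left.head
  simp only [Cond.length_code, List.length_singleton, Cmd.length_code] at hbody hback hexit
  have hA := hbody.left
  have hB := hbody.right
  simp only [Cmd.length_code] at hB
  induction k with
  | zero =>
    intro σ s g G O K hk hpc hsim hfit hbd hs hg hb hM
    -- A current goal always guarantees a pending solution, so the count cannot be zero.
    obtain ⟨a, ha⟩ := exists_mem_goalSols cd (g :: G)
    have hmem : (O : Multiset ℕ) + a ∈ pending cd g G O K := Multiset.mem_add.2 (.inl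
      ((mem_conv _ _).2 ⟨_, Multiset.mem_singleton_self _, a, ha.1, rfl⟩))
    rw [Nat.le_zero, Multiset.card_eq_zero] at hk
    rw [hk] at hmem
    exact absurd hmem (Multiset.notMem_zero _)
  | succ k ih =>
    intro σ s g G O K hk hpc hsim hfit hbd hs hg hb hM
    have htgt : c.eval s := by
      have := hg.rep.le
      rw [← hc]
      simp only [Cond.eval, Ex.eval_var, Ex.eval_ofNat]; omega
    obtain ⟨T₁, s₁, O₁, K₁, e₁, b₁, c₁, o₁, p₁, t₁⟩ :=
      exec_forward hcd hlo hN₂ hN _ le_rfl hbd hs hg hb hM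
    obtain ⟨T₂, ht₂, s₂, e₂, b₂, c₂, o₂⟩ := tri_printOuts (op := op) hN₂ c₁ b₁
    have hM₁ : ∀ a ∈ choiceSols cd K₁, a.card ≤ M := fun a ha =>
      hM a (by rw [← p₁]; exact Multiset.mem_add.2 (.inr ha))
    have hlen := c₂.choices.length_le hM₁
    have hstep : Tri op N (.sep ⨟ backtrack) s₂ (Cmd.sep ⨟ backtrack).cost fun s' =>
        s'.out = s₂.out ++ [none] ∧ ((K₁ = [] ∧ s'.var .tgt = 0) ∨
        ∃ (g' : Goal x) (G' : List (Goal x)) (O' : List ℕ) (K' : List (Choice x)),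
          Stacks cd lo top s' G' O' K' ∧ Current cd lo top s' g' ∧
          pending cd g' G' O' K' = choiceSols cd K₁ ∧
          s'.var .heap + 5 * s'.var .tgt ≤ addrBound top O'.length G'.length) := by
      refine Tri.of_wp hN₂ ?_
      refine wp_backtrack (O := O₁) (K := K₁) hcd (s := s₂.emit none)
        ⟨c₂.tgt, c₂.top_pos, c₂.top_le, c₂.outs, c₂.choices⟩ ?_ ?_ ?_
      · intro c hc
        have := hlen c hc
        have := addrBound_mono (top := top) (o := c.outs.length) (g := c.goals.length) (o' := M)
          (g' := M) (by omega)
        omega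
      · intro s' g' G' O' K' h₁ h₂ h₃ h₄ h₅
        exact ⟨h₅, .inr ⟨g', G', O', K', h₁, h₂, h₃, h₄⟩⟩
      · intro h
        exact ⟨rfl, .inl ⟨h, c₂.tgt⟩⟩
    obtain ⟨T₃, ht₃, s₃, e₃, b₃, o₃, h₃⟩ := hstep b₂
    obtain ⟨τ₀, r₀, q₀, m₀⟩ := c.reach (op := op) hN0 hbd (by omega) hcode hpc hsim hfit
    rw [if_pos htgt] at q₀
    obtain ⟨τ₂, r₂, q₂, m₂⟩ := (e₁.seq e₂).reach hN0 hbd (by omega) hA q₀ m₀ r₀.fits_right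
    obtain ⟨τ₃, r₃, q₃, m₃⟩ := e₃.reach hN0 b₂ (by omega) hB q₂ m₂ r₂.fits_right
    have hjump : P[τ₃.pc]? = some (.jump n) := by
      rw [q₃, ← hback]
      congr 1
    have r₄ := Reach.jump (op := op) hjump r₃.fits_right
    have hτ₂ : τ₂.out = σ.out ++ O₁.map some := by rw [m₂.2.2, o₂, o₁, hsim.2.2]
    have hτ₃ : τ₃.out = σ.out ++ (O₁.map some ++ [none]) := by
      rw [m₃.2.2, o₃, ← m₂.2.2, hτ₂, List.append_assoc]
    -- Completion takes a time linear in the number of elements, as does printing; the rest of a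
    -- round is constant.
    have ha : c.len + (T₁ + T₂) ≤ enumTime * (O₁.length + 1) := by
      have h1 : T₁ ≤ forwardTime * (2 * O₁.length + 1) := by omega
      rw [hKK]
      simp only [mul_add, add_mul, mul_one, one_mul] at *
      nlinarith
    have hsim' : Sim s₃ { τ₃ with pc := n } := m₃
    have hbT : T₃ + 1 ≤ enumTime := by omega
    rcases h₃ with ⟨hK, ht⟩ | ⟨g', G', O', K', hs', hg', hp', hb'⟩
    · refine ⟨[O₁], .cons (r₀.trans r₂) (r₃.trans r₄) ha hbT hτ₂ hτ₃ ?_, ?_⟩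
      -- Without a choice point, `backtrack` leaves the null pointer in `tgt`, and the loop ends.
      · have hf : ¬ c.eval s₃ := by
          rw [← hc]
          simp [Cond.eval, ht]
        obtain ⟨τ₅, r₅, q₅, m₅⟩ := c.reach (op := op) (σ := { τ₃ with pc := n }) hN0 b₃ (by omega)
          hcode rfl hsim' r₄.fits_right
        rw [if_neg hf] at q₅
        have hexit' : P[τ₅.pc]? = some (.jump (n + c.len + 1 +
            ((forward ⨟ printOuts) ⨟ (Cmd.sep ⨟ backtrack)).len + 1)) := by rw [q₅]; exact hexit
        have r₆ := Reach.jump (op := op) hexit' r₅.fits_right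
        refine .nil (t := c.len + 1) (by omega) (r₅.trans r₆) (.inl ?_) ?_
        · have : n + c.len + 1 + ((forward ⨟ printOuts).len + (Cmd.sep ⨟ backtrack).len) + 1
              = n + (c.len + (1 + ((forward ⨟ printOuts).len +
                (Cmd.sep ⨟ backtrack).len + 1))) := by omega
          exact (congrArg (fun k => P[k]?) this).trans hend'
        · exact m₅.2.2.trans hsim'.2.2.symm
      · rw [← p₁, hK]
        rfl
    · have hcard : (pending cd g' G' O' K').card ≤ k := by
        rw [hp']
        rw [← p₁, Multiset.card_add, Multiset.card_singleton] at hk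
        omega
      obtain ⟨L, hL, hL'⟩ := ih (σ := { τ₃ with pc := n }) hcard rfl hsim' r₄.fits_right b₃ hs' hg'
        hb' (by rwa [hp'])
      refine ⟨O₁ :: L, .cons (r₀.trans r₂) (r₃.trans r₄) ha hbT hτ₂ hτ₃ hL, ?_⟩
      rw [← p₁, ← hp', ← hL']
      rfl

/-- A pointer to a tree, or a null pointer for the empty set of solutions, together with the code
of a path. -/
def LinkRep (cd : ∀ x y : V, Path x y → ℕ) (mem : ℕ → ℕ) (lo hi : ℕ) {x : V}
    (S : ∀ v, Path v x → Multiset (Multiset ℕ)) (a : ℕ) : Prop :=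
  (mem a = 0 ∧ ∀ v ρ, S v ρ = 0) ∨
  ∃ g : Goal x, g.2.2.Rep cd mem lo hi (mem a) ∧ mem (a + 1) = cd _ _ g.2.1 ∧
    ∀ (v : V) (ρ : Path v x), S v ρ = g.2.2.sols cd (ρ.comp g.2.1)

theorem Enumer.mono {P : Program} {W K K' : ℕ} {σ : Config} {L : List (List ℕ)}
    (h : Enumer op P W K σ L) (hK : K ≤ K') : Enumer op P W K' σ L := by
  induction h with
  | nil ht h hτ ho => exact .nil (ht.trans hK) h hτ ho
  | cons h₁ h₂ ha hb hτ hρ _ ih =>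
    exact .cons h₁ h₂ (ha.trans (Nat.mul_le_mul_right _ hK)) (hb.trans hK) hτ hρ ih

/-- Silent initial work is charged to the first object, or to termination if there is none. -/
theorem Enumer.prepend {P : Program} {W K t : ℕ} {σ τ : Config} {L : List (List ℕ)}
    (h : Enumer op P W K τ L) (hr : Reach op P W t σ τ) (ho : τ.out = σ.out) :
    Enumer op P W (K + t) σ L := by
  cases h with
  | nil ht h hτ ho' => exact .nil (by omega) (hr.trans h) hτ (ho'.trans ho)
  | cons h₁ h₂ ha hb hτ hρ h =>
    refine .cons (hr.trans h₁) h₂ ?_ (by omega) (ho ▸ hτ) (ho ▸ hρ) (h.mono (by omega))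
    rw [add_mul]
    nlinarith

/-- The constant for the running times of the enumeration program. -/
def enumConst : ℕ := enumTime + (enumInit.cost + enumEmpty.cost) + 2

/-- The state in which the enumeration starts. -/
def queryState (mem : ℕ → ℕ) (q : ℕ) : St :=
  { var := fun y => if y = .query then q else 0, mem := mem, out := [] }

theorem sim_queryState (mem : ℕ → ℕ) (q : ℕ) : Sim (queryState mem q) (queryConfig mem q) := by
  refine ⟨fun y => ?_, rfl, rfl⟩
  cases y <;> rfl

/-- Trees represent nonempty solutions only; the empty one is output first, after a lookup of
whether the state for the empty selection is final. The row of the queried vertex holds this state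
in cell 1 and the link to the union over all final states in cells 2 and 3. -/
theorem enumer_enumCmd {W : ℕ} {mem : ℕ → ℕ} {q : ℕ} (hcd : Coding cd op N) (hlo : 0 < lo)
    (hN₂ : 2 ≤ N) (hN : addrBound top M M + 10 < 2 ^ N) (hW : N * enumCmd.weight ≤ W)
    (hNW : N ≤ W) (hbd : (queryState mem q).Bounded N) (htop : mem 2 = top) (htop0 : 0 < top)
    (hrow : mem 0 + q * mem 1 < 2 ^ N) {S : ∀ v, Path v x → Multiset (Multiset ℕ)}
    (hS : LinkRep cd mem lo top S (mem 0 + q * mem 1 + 2))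
    (hM : ∀ a ∈ S x .nil, a.card ≤ M) :
    ∃ L : List (List ℕ), Enumer op (enumCmd.code 0) W enumConst (queryConfig mem q) L ∧
      multisets L = (if mem (mem 3 + mem (mem 0 + q * mem 1 + 1)) = 1 then {0} else 0) + S x .nil := by
  classical
  have hN0 : 0 < N := by omega
  have hcode : CodeAt (enumCmd.code 0) 0 (enumCmd.code 0) := codeAt_self _
  have hinit := hcode.left
  have hempty := hcode.right.left
  have hloop := hcode.right.right
  simp only [Cmd.length_code, zero_add] at hinit hempty hloop
  have hend : (enumCmd.code 0)[enumInit.len + enumEmpty.len + enumLoop.len]? = none := by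
    rw [List.getElem?_eq_none_iff, Cmd.length_code, enumCmd, Cmd.len, Cmd.len]
    omega
  have hWs : N * (enumInit.weight + (enumEmpty.weight + enumLoop.weight)) ≤ W := hW
  simp only [mul_add] at hWs
  have hfit : (queryConfig mem q).Fits W := by
    have h2 : 2 ^ N ≤ 2 ^ W := Nat.pow_le_pow_right (by norm_num) hNW
    refine ⟨fun r => ?_, fun a => (hbd.2 a).trans_le h2⟩
    have h3 := hbd.1 .query
    simp only [queryState, if_true] at h3
    simp only [queryConfig]
    split_ifs <;> omega
  have hI : Tri op N enumInit (queryState mem q) enumInit.cost fun s => s.mem = mem ∧ s.out = [] ∧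
      s.var .heap = top ∧ s.var .fin = mem 3 ∧ s.var .row = mem 0 + q * mem 1 ∧
      s.var .tgt = mem (mem 0 + q * mem 1 + 2) ∧ s.var .mor = mem (mem 0 + q * mem 1 + 3) ∧
      s.var .goals = 0 ∧ s.var .outs = 0 ∧ s.var .choices = 0 := by
    refine Tri.of_wp hN₂ ?_
    simp [enumInit, Cmd.wp, queryState, htop, hrow]
  obtain ⟨T₁, ht₁, s₁, e₁, b₁, m₁, o₁, v₁, v₂, v₃, v₄, v₅, v₆, v₇, v₈⟩ := hI hbd
  have hE : Tri op N enumEmpty s₁ enumEmpty.cost fun s => s.mem = s₁.mem ∧ s.var = s₁.var ∧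
      s.out = if mem (mem 3 + mem (mem 0 + q * mem 1 + 1)) = 1 then [none] else [] := by
    refine Tri.of_wp hN₂ ?_
    simp [enumEmpty, Cmd.wp, Cond.eval, m₁, o₁, v₂, v₃]
  obtain ⟨T₂, ht₂, s₂, e₂, b₂, m₂, w₂, o₂⟩ := hE b₁
  obtain ⟨τ₁, r₁, q₁, i₁⟩ := e₁.reach hN0 (W := W) hbd (by omega) hinit rfl
    (sim_queryState mem q) hfit
  obtain ⟨τ₂, r₂, q₂, i₂⟩ := e₂.reach hN0 b₁ (by omega) hempty (by rw [q₁, zero_add]) i₁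
    r₁.fits_right
  obtain ⟨L, hL, hL'⟩ : ∃ L : List (List ℕ), Enumer op (enumCmd.code 0) W enumTime τ₂ L ∧
      multisets L = S x .nil := by
    rcases hS with ⟨h0, hS0⟩ | ⟨g, hg₁, hg₂, hg₃⟩
    · refine ⟨[], ?_, by rw [hS0]; rfl⟩
      have e₃ : Exec op N enumLoop s₂ _ s₂ := .loop_false (by simp [Cond.eval, w₂, v₄, h0])
      obtain ⟨τ₃, r₃, q₃, i₃⟩ := e₃.reach hN0 b₂ (by omega) hloop q₂ i₂ r₂.fits_right
      refine .nil ?_ r₃ (.inl (by rw [q₃, hend])) (i₃.2.2.trans i₂.2.2.symm)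
      unfold enumTime; omega
    · have hp : pending cd (⟨g.1, .comp .nil g.2.1, g.2.2⟩ : Goal x) [] [] [] = S x .nil := by
        simp [pending, goalSols, choiceSols, hg₃]
      rw [← hp]
      refine enumer_enumLoop (s := s₂) hcd hlo hN₂ hN (by omega) hloop hend _ le_rfl q₂ i₂
        r₂.fits_right b₂ ⟨htop0, ?_, ?_, ?_, ?_⟩ ⟨?_, ?_⟩ ?_ (by rwa [hp])
      · rw [w₂, v₁]
      · simp [GoalsRep, w₂, v₆]
      · simp [OutsRep, w₂, v₇]
      · simp [ChoicesRep, w₂, v₈]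
      · rw [m₂, m₁, w₂, v₄]; exact hg₁
      · rw [w₂, v₅]
        simpa using hg₂
      · rw [w₂, v₁, v₄]
        have := hg₁.add_le
        simp only [addrBound, List.length_nil]; omega
  have hT : enumTime + T₁ + T₂ ≤ enumConst := by unfold enumConst; omega
  have hσ : (queryConfig mem q).out = [] := rfl
  by_cases hacc : mem (mem 3 + mem (mem 0 + q * mem 1 + 1)) = 1
  · rw [if_pos hacc] at o₂ ⊢
    -- The initialization counts as the time before the separator of the empty object, the test and
    -- the separator as the time after.
    refine ⟨[] :: L, .cons r₁ r₂ (by simp; omega) (by omega) ?_ ?_ (hL.mono (by omega)), ?_⟩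
    · rw [i₁.2.2, o₁, hσ]; rfl
    · rw [i₂.2.2, o₂, hσ]; rfl
    · rw [← hL', Multiset.singleton_add]; rfl
  · rw [if_neg hacc] at o₂ ⊢
    refine ⟨L, (hL.prepend (r₁.trans r₂) ?_).mono (by omega), by rw [hL', zero_add]⟩
    rw [i₂.2.2, o₂, hσ]

end Enumeration

/-! ### The preprocessing program -/

section Program

open Var Cmd Ex

/-- Store a union of the tree `tgt` and the tree at which the pointer in `cell` points; the address
of its leftmost subtree and the code of the path to it have been computed before. -/
def pushUnion : Cmd :=
  old ≔ mem cell ⨟ omor ≔ mem (cell + 1) ⨟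
  store heap 2 ⨟ store (heap + 1) tgt ⨟ store (heap + 2) mor ⨟ store (heap + 3) old ⨟
  store (heap + 4) omor ⨟ store (heap + 5) saved ⨟ store (heap + 6) smor ⨟
  store cell heap ⨟ store (cell + 1) ident ⨟ heap ≔ heap + 7

/-- Add the solutions of the tree `tgt` to those of the tree at which the pointer in `cell`
points. -/
def addLink : Cmd :=
  ite (.eq (mem cell) 0)
    (store cell tgt ⨟ store (cell + 1) mor)
    (ite (.eq (mem tgt) 2)
        (saved ≔ mem (tgt + 5) ⨟ comp smor mor (mem (tgt + 6)))
        (saved ≔ tgt ⨟ smor ≔ mor) ⨟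
      pushUnion)

/-- Construct a tree for the solutions that consist of a solution for the left child with state `i`
and one for the right child with state `j`; the empty solution is represented by the number of
states. -/
def combine : Cmd :=
  tgt ≔ 0 ⨟
  ite (.lt i states)
    (ite (.eq (mem (lrow + 4 + 2 * i)) 0) skip
      (comp mor lmor (mem (lrow + 4 + 2 * i + 1)) ⨟
        ite (.lt j states)
          (ite (.eq (mem (rrow + 4 + 2 * j)) 0) skip
            (comp smor rmor (mem (rrow + 4 + 2 * j + 1)) ⨟ saved ≔ mem (rrow + 4 + 2 * j) ⨟
              old ≔ mem (lrow + 4 + 2 * i) ⨟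
              store heap 1 ⨟ store (heap + 1) old ⨟ store (heap + 2) mor ⨟
              store (heap + 3) saved ⨟ store (heap + 4) smor ⨟
              tgt ≔ heap ⨟ mor ≔ ident ⨟ heap ≔ heap + 7))
          (tgt ≔ mem (lrow + 4 + 2 * i))))
    (ite (.lt j states)
      (ite (.eq (mem (rrow + 4 + 2 * j)) 0) skip
        (comp mor rmor (mem (rrow + 4 + 2 * j + 1)) ⨟ tgt ≔ mem (rrow + 4 + 2 * j)))
      skip)

/-- Find the pointer to which the solutions for the states `i` and `j` contribute. -/
def findCell : Cmd :=
  p ≔ lempty ⨟ q ≔ rempty ⨟ ite (.lt i states) (p ≔ i) skip ⨟ ite (.lt j states) (q ≔ j) skip ⨟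
  cell ≔ row + 4 + 2 * mem (tabNode + ((label * states + p) * states + q))

/-- Deal with the states `i` and `j` of the children. -/
def pairStep : Cmd :=
  findCell ⨟ combine ⨟ ite (.eq tgt 0) skip addLink ⨟ j ≔ j + 1

/-- Deal with the state `i` of the left child. -/
def rowStep : Cmd :=
  j ≔ 0 ⨟ loop (.lt j (states + 1)) pairStep ⨟ i ≔ i + 1

/-- Deal with all states of the children of an inner vertex. -/
def pairLoop : Cmd := i ≔ 0 ⨟ loop (.lt i (states + 1)) rowStep

/-- Add the solutions with final state `i`. -/
def rootStep : Cmd :=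
  ite (.eq (mem (fin + i)) 0) skip
    (tgt ≔ mem (row + 4 + 2 * i) ⨟
      ite (.eq tgt 0) skip (mor ≔ mem (row + 4 + 2 * i + 1) ⨟ cell ≔ row + 2 ⨟ addLink)) ⨟
  i ≔ i + 1

/-- Collect the solutions with final states. -/
def rootLoop : Cmd := i ≔ 0 ⨟ loop (.lt i states) rootStep

/-- Construct the trees of a leaf. -/
def leafTrees : Cmd :=
  store (row + 1) (mem (tabLeaf + 2 * label)) ⨟ q ≔ mem (tabLeaf + 2 * label + 1) ⨟
  store heap 0 ⨟ cell ≔ row + 4 + 2 * q ⨟ store cell heap ⨟ store (cell + 1) ident ⨟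
  heap ≔ heap + 7

/-- Load the data of the children of an inner vertex, and compute its state for the empty
solution. -/
def nodeInit : Cmd :=
  lempty ≔ mem (lrow + 1) ⨟ rempty ≔ mem (rrow + 1) ⨟
  lmor ≔ mem (record + 5) ⨟ rmor ≔ mem (record + 6) ⨟
  store (row + 1) (mem (tabNode + ((label * states + lempty) * states + rempty)))

/-- Construct the trees of an inner vertex. -/
def nodeTrees : Cmd := nodeInit ⨟ pairLoop

/-- Mark the current vertex as done and go back to its parent. -/
def leave : Cmd := store row 1 ⨟ depth ≔ depth - 1

/-- Finish the treatment of a vertex. -/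
def finish : Cmd := rootLoop ⨟ leave

/-- Go to a child that has not been dealt with. -/
def visit (e : Ex) : Cmd := depth ≔ depth + 1 ⨟ store (stack + depth) e

/-- Load the data of the current vertex. -/
def fetch : Cmd :=
  cur ≔ mem (stack + depth) ⨟ row ≔ table + cur * width ⨟ record ≔ 4 + 7 * cur ⨟
  label ≔ mem (record + 1) ⨟ ident ≔ mem (record + 4)

/-- Compute the addresses of the rows of the children. -/
def fetchRows : Cmd :=
  lrow ≔ table + mem (record + 2) * width ⨟ rrow ≔ table + mem (record + 3) * width

/-- Start a search at the next vertex. -/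
def advance : Cmd := vert ≔ vert + 1 ⨟ store stack vert

/-- One step of the depth-first search. -/
def searchStep : Cmd :=
  fetch ⨟
  ite (.eq (mem row) 0)
    (ite (.eq (mem record) 0)
      (leafTrees ⨟ finish)
      (fetchRows ⨟
        ite (.eq (mem lrow) 0) (visit (mem (record + 2)))
          (ite (.eq (mem rrow) 0) (visit (mem (record + 3)))
            (nodeTrees ⨟ finish))))
    advance

/-- Compute the addresses of all parts of the data structure. -/
def preInit : Cmd :=
  cnt ≔ mem 0 ⨟ states ≔ mem 1 ⨟ tabLeaf ≔ 4 + 7 * cnt ⨟ tabNode ≔ tabLeaf + 2 * mem 2 ⨟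
  fin ≔ tabNode + mem 3 * states * states ⨟ table ≔ fin + states ⨟ width ≔ 2 * states + 4 ⨟
  stack ≔ table + cnt * width ⨟ heap ≔ stack + cnt + 1

/-- Leave the addresses needed by the enumeration. -/
def preExit : Cmd := store 0 table ⨟ store 1 width ⨟ store 2 heap ⨟ store 3 fin

/-- The preprocessing program. -/
def preCmd : Cmd := preInit ⨟ loop (.lt vert cnt) searchStep ⨟ preExit

end Program

/-! ### Adding a tree to a set of solutions. -/

section Trees

open Quiver (Path)

variable {V : Type} [Quiver.{0} V] {cd : ∀ x y : V, Path x y → ℕ} {op : ℕ → ℕ → ℕ} {N : ℕ}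
  {lo : ℕ} {x : V} {s : St} {Q : St → Prop}

/-- Sets of solutions, as functions of the path on which a vertex is reached. -/
abbrev Sem (x : V) : Type := ∀ v, Path v x → Multiset (Multiset ℕ)

theorem LinkRep.congr {mem mem' : ℕ → ℕ} {hi hi' a : ℕ} {S : Sem x}
    (h : LinkRep cd mem lo hi S a) (hh : hi ≤ hi') (hm : ∀ b, lo ≤ b → b < hi → mem' b = mem b)
    (h₀ : mem' a = mem a) (h₁ : mem' (a + 1) = mem (a + 1)) : LinkRep cd mem' lo hi' S a := by
  rcases h with ⟨h, hS⟩ | ⟨g, hg, hc, hS⟩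
  · exact .inl ⟨h₀.trans h, hS⟩
  · exact .inr ⟨g, by rw [h₀]; exact (hg.congr hm).mono_hi hh, h₁.trans hc, hS⟩

/-- The current tree in a state has the set `S` of solutions. -/
def TgtRep (cd : ∀ x y : V, Path x y → ℕ) (lo : ℕ) (s : St) (S : Sem x) : Prop :=
  (s.var .tgt = 0 ∧ ∀ v ρ, S v ρ = 0) ∨
  ∃ g : Goal x, g.2.2.Rep cd s.mem lo (s.var .heap) (s.var .tgt) ∧ s.var .mor = cd _ _ g.2.1 ∧
    ∀ (v : V) (ρ : Path v x), S v ρ = g.2.2.sols cd (ρ.comp g.2.1)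

/-- The variables that are changed when a tree is added. -/
def Var.Scratch : Var → Prop
  | .heap | .saved | .smor | .old | .omor | .tgt | .mor | .cell | .p | .q => True
  | _ => False

/-- A null link is simply redirected. Otherwise a union with the old tree on the right is allocated;
its leftmost subtree is that of the new tree, found in constant time. Links lie below `lo` and trees
above, so overwriting a link leaves all trees intact; `0 < lo` keeps tree addresses apart from the
null pointer. -/
theorem wp_addLink (hcd : Coding cd op N) (hlo : 0 < lo) {S : Sem x}
    (hS : LinkRep cd s.mem lo (s.var .heap) S (s.var .cell)) {g : Goal x}
    (hg : g.2.2.Rep cd s.mem lo (s.var .heap) (s.var .tgt)) (hgc : s.var .mor = cd _ _ g.2.1)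
    (hcell : s.var .cell + 2 ≤ lo)
    (hid : s.var .ident = cd x x .nil) (hN : s.var .heap + 7 < 2 ^ N)
    (hQ : ∀ s' : St, LinkRep cd s'.mem lo (s'.var .heap)
      (fun v ρ => S v ρ + g.2.2.sols cd (ρ.comp g.2.1)) (s.var .cell) →
      s.var .heap ≤ s'.var .heap → s'.var .heap ≤ s.var .heap + 7 →
      (∀ b < s.var .heap, b ≠ s.var .cell → b ≠ s.var .cell + 1 → s'.mem b = s.mem b) →
      (∀ y : Var, ¬ y.Scratch → s'.var y = s.var y) → s'.out = s.out → Q s') :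
    addLink.wp op N Q s := by
  have hle := hg.le
  have hadd := hg.add_le
  simp only [addLink, Cmd.wp, Cond.eval, Ex.eval_mem, Ex.eval_var, Ex.eval_ofNat, Ex.eval_add,
    Ex.safe_var, Ex.safe_mem, true_and, St.put_var]
  refine ⟨fun h0 => ?_, fun h0 => ?_⟩
  · rcases hS with ⟨-, hS⟩ | ⟨g', hg', -, -⟩
    · refine hQ _ (.inr ⟨g, ?_, ?_, ?_⟩) le_rfl (by simp) ?_ (fun _ _ => rfl) rfl
      · have := hg.congr (mem' := ((s.put (s.var .cell) (s.var .tgt)).put (s.var .cell + 1)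
          (s.var .mor)).mem) fun b hb _ => by
            simp only [St.put_mem, Function.update_apply]
            repeat rw [if_neg (by omega)]
        simpa using this
      · simpa using hgc
      · intro v ρ; simp only [hS, zero_add]
      · intro b _ h₁ h₂
        simp only [St.put_mem, Function.update_apply]
        repeat rw [if_neg (by omega)]
    · have := hg'.le; omega
  · rcases hS with ⟨h, -⟩ | ⟨g', hg', hc', hS⟩
    · exact (h0 h).elim
    -- The two cases below differ only in the origin of the data on the leftmost subtree: they are
    -- read from the new tree if it is a union, and otherwise are the tree itself.
    have key : ∀ s₁ : St, s₁.mem = s.mem →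
        (∀ y : Var, ¬ y.Scratch → s₁.var y = s.var y) → s₁.out = s.out →
        s₁.var .heap = s.var .heap → s₁.var .tgt = s.var .tgt → s₁.var .mor = s.var .mor →
        s₁.var .cell = s.var .cell →
        s₁.var .saved = g.2.2.leftmostAddr s.mem (s.var .tgt) →
        s₁.var .smor = cd _ _ (g.2.1.comp g.2.2.leftmost.2.1) →
        pushUnion.wp op N Q s₁ := by
      intro s₁ hm hv ho hh ht hmo hce hsa hsm
      simp only [pushUnion, Cmd.wp, Ex.eval_mem, Ex.eval_var, Ex.eval_ofNat, Ex.eval_add, Ex.safe_add,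
        Ex.safe_ofNat, St.set_var, St.set_mem, if_true, if_false, reduceCtorEq,
        Ex.safe_var, Ex.safe_mem, true_and, St.put_var, hm, hh, ht, hmo, hce, hsa, hsm,
        hv .ident (by simp [Var.Scratch])]
      refine ⟨by norm_num, hN, ?_⟩
      set H := s.var .heap with hH
      set s₂ : St := ((((((((((s₁.set .old (s.mem (s.var .cell))).set .omor
        (s.mem (s.var .cell + 1))).put H 2).put (H + 1) (s.var .tgt)).put (H + 2)
        (s.var .mor)).put (H + 3) (s.mem (s.var .cell))).put (H + 4)
        (s.mem (s.var .cell + 1))).put (H + 5) (g.2.2.leftmostAddr s.mem (s.var .tgt))).put (H + 6)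
        (cd _ _ (g.2.1.comp g.2.2.leftmost.2.1))).put (s.var .cell) H).put
        (s.var .cell + 1) (s.var .ident) with hs₂
      have hold : ∀ b < H, b ≠ s.var .cell → b ≠ s.var .cell + 1 → s₂.mem b = s.mem b := by
        intro b hb h₁ h₂
        simp only [hs₂, St.put_mem, St.set_mem, Function.update_apply, hm]
        repeat rw [if_neg (by omega)]
      have hnew : ∀ k, s₂.mem (H + k) = if k = 6 then cd _ _ (g.2.1.comp g.2.2.leftmost.2.1) else
          if k = 5 then g.2.2.leftmostAddr s.mem (s.var .tgt) else
          if k = 4 then s.mem (s.var .cell + 1) else if k = 3 then s.mem (s.var .cell) else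
          if k = 2 then s.var .mor else if k = 1 then s.var .tgt else if k = 0 then 2 else
          s.mem (H + k) := by
        intro k
        simp only [hs₂, St.put_mem, St.set_mem, Function.update_apply, hm]
        rw [if_neg (by omega), if_neg (by omega)]
        simp
      have hold' : ∀ b, lo ≤ b → b < H → s₂.mem b = s.mem b := fun b h₁ h₂ =>
        hold b h₂ (by omega) (by omega)
      have hc₀ : s₂.mem (s.var .cell) = H := by simp [hs₂]
      have hc₁ : s₂.mem (s.var .cell + 1) = s.var .ident := by simp [hs₂]
      have hrep : (Tr.union g.2.1 g.2.2 g'.2.1 g'.2.2).Rep cd s₂.mem lo (H + 7) H := by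
        refine ⟨by omega, le_rfl, by simpa using hnew 0, ?_, ?_, ?_, ?_, ?_, ?_⟩
        · rw [hnew 1]; exact hg.congr hold'
        · rw [hnew 2]; exact hgc
        · rw [hnew 3]; exact hg'.congr hold'
        · rw [hnew 4]; exact hc'
        · rw [hnew 5, hnew 1]
          exact (Tr.leftmostAddr_congr hg hold').symm
        · rw [hnew 6]; rfl
      -- The new node belongs to `x` itself, so its link carries the empty path, whose code is in
      -- `ident`.
      refine hQ _ (.inr ⟨⟨x, .nil, .union g.2.1 g.2.2 g'.2.1 g'.2.2⟩, ?_, ?_, ?_⟩) ?_ ?_ ?_ ?_ ?_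
      · rw [St.set_mem, hc₀]
        simpa using hrep
      · rw [St.set_mem, hc₁, hid]
      · intro v ρ
        change S v ρ + _ = _ + _
        rw [hS, add_comm]; rfl
      · simp
      · simp
      · exact fun b hb h₁ h₂ => hold b hb h₁ h₂
      · intro y hy
        have e : ∀ z : Var, z.Scratch → y ≠ z := fun z hz h => hy (h ▸ hz)
        simp [hs₂, e .heap trivial, e .omor trivial, e .old trivial, hv y hy]
      · exact ho
    refine ⟨fun hu => ?_, fun hu => ?_⟩
    · obtain ⟨y, π, t⟩ := g
      simp only at hg hgc key
      have htu := hg.isUnion_iff.2 hu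
      cases t with
      | leaf => exact htu.elim
      | prod => exact htu.elim
      | @union _ y₁ y₂ π₁ t₁ π₂ t₂ =>
      obtain ⟨h₁, h₂, h₃, h₄, h₅, h₆, h₇, h₈, h₉⟩ := id hg
      simp only [St.set_var, St.set_mem, reduceCtorEq, if_false, hgc, h₉, hcd.op_eq, h₈]
      refine ⟨hcd.lt _, key _ rfl ?_ rfl ?_ ?_ ?_ ?_ ?_ ?_⟩
      · intro y hy
        have e : ∀ z : Var, z.Scratch → y ≠ z := fun z hz h => hy (h ▸ hz)
        simp [e .saved trivial, e .smor trivial]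
      all_goals simp [Tr.leftmostAddr, Tr.leftmost]
    · have hnu : ¬ g.2.2.IsUnion := fun h => hu (hg.isUnion_iff.1 h)
      refine key _ rfl ?_ rfl ?_ ?_ ?_ ?_ ?_ ?_
      · intro y hy
        have e : ∀ z : Var, z.Scratch → y ≠ z := fun z hz h => hy (h ▸ hz)
        simp [e .saved trivial, e .smor trivial]
      · simp
      · simp
      · simp
      · simp
      · simp [Tr.leftmostAddr_of_not_isUnion hnu]
      · simp only [St.set_var, if_true, reduceCtorEq, if_false, hgc]
        obtain ⟨y, π, t⟩ := g
        cases t with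
        | leaf => rfl
        | prod => rfl
        | union => exact (hnu trivial).elim

end Trees

/-! ### Combining one tree of each child. -/

section Pairs

open Quiver (Path)

variable {V : Type} [Quiver.{0} V] {cd : ∀ x y : V, Path x y → ℕ} {op : ℕ → ℕ → ℕ} {N : ℕ}
  {lo : ℕ} {x l r : V} {s : St} {Q : St → Prop}

/-- The combinations of solutions for two children; the empty solution has number `m`. -/
def combSem (m i j : ℕ) (eL : Path x l) (eR : Path x r) (SL : Sem l) (SR : Sem r) : Sem x :=
  fun v ρ =>
    if i < m then
      if j < m then conv (SL v (ρ.comp eL)) (SR v (ρ.comp eR)) else SL v (ρ.comp eL)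
    else if j < m then SR v (ρ.comp eR) else 0

/-- Extending a link by an edge costs one composition and no memory; only a product needs a new
node. A null pointer on a side that has to contribute makes the result null, which keeps trees for
empty sets out of the data structure. If both sides are empty, so is the solution, and it is not
recorded. -/
theorem wp_combine (hcd : Coding cd op N) (hlo : 0 < lo) (hH : lo ≤ s.var .heap)
    {eL : Path x l} {eR : Path x r} {SL : Sem l} {SR : Sem r}
    (hl : s.var .i < s.var .states →
      LinkRep cd s.mem lo (s.var .heap) SL (s.var .lrow + 4 + 2 * s.var .i))
    (hr : s.var .j < s.var .states →
      LinkRep cd s.mem lo (s.var .heap) SR (s.var .rrow + 4 + 2 * s.var .j))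
    (hlm : s.var .lmor = cd _ _ eL) (hrm : s.var .rmor = cd _ _ eR)
    (hid : s.var .ident = cd x x .nil) (hN : s.var .heap + 7 < 2 ^ N)
    (hQ : ∀ s' : St,
      TgtRep cd lo s' (combSem (s.var .states) (s.var .i) (s.var .j) eL eR SL SR) →
      s.var .heap ≤ s'.var .heap → s'.var .heap ≤ s.var .heap + 7 →
      (∀ b < s.var .heap, s'.mem b = s.mem b) → s'.var .cell = s.var .cell →
      (∀ y : Var, ¬ y.Scratch → s'.var y = s.var y) → s'.out = s.out → Q s') :
    combine.wp op N Q s := by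
  have scr : ∀ {y : Var}, ¬ y.Scratch → ∀ z : Var, z.Scratch → y ≠ z :=
    fun hy z hz h => hy (h ▸ hz)
  simp only [combine, Cmd.wp, Cond.eval, Ex.eval_mem, Ex.eval_var, Ex.eval_ofNat, Ex.eval_add,
    Ex.eval_mul, Ex.safe_ofNat, Ex.safe_add, Ex.safe_var, Ex.safe_mem, true_and, St.put_var,
    St.set_var, St.set_mem, reduceCtorEq, if_false, if_true]
  refine ⟨by norm_num, fun hi => ⟨fun h0 => ?_, fun h0 => ?_⟩, fun hi => ⟨fun hj =>
    ⟨fun h0 => ?_, fun h0 => ?_⟩, fun hj => ?_⟩⟩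
  · obtain ⟨-, hS⟩ | ⟨g, hg, -, -⟩ := hl hi
    · refine hQ _ (.inl ⟨by simp, fun v ρ => ?_⟩) (by simp) (by simp) (by simp) (by simp)
        (fun y hy => by simp [scr hy .tgt trivial]) rfl
      simp [combSem, hi, hS]
    · have := hg.le; omega
  · obtain ⟨h, -⟩ | ⟨g, hg, hgc, hS⟩ := hl hi
    · exact (h0 h).elim
    rw [hlm, hgc, hcd.op_eq]
    refine ⟨hcd.lt _, fun hj => ⟨fun h1 => ?_, fun h1 => ?_⟩, fun hj => ?_⟩
    · obtain ⟨-, hS'⟩ | ⟨g', hg', -, -⟩ := hr hj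
      · refine hQ _ (.inl ⟨by simp, fun v ρ => ?_⟩) (by simp) (by simp) (by simp) (by simp)
          (fun y hy => by simp [scr hy .tgt trivial, scr hy .mor trivial]) rfl
        simp [combSem, hi, hj, hS']
      · have := hg'.le; omega
    · obtain ⟨h, -⟩ | ⟨g', hg', hgc', hS'⟩ := hr hj
      · exact (h1 h).elim
      rw [hrm, hgc', hcd.op_eq]
      refine ⟨hcd.lt _, by norm_num, hN, ?_⟩
      have hold : ∀ a b c d e f, f < s.var .heap →
          (((((s.put (s.var .heap) a).put (s.var .heap + 1) b).put (s.var .heap + 2) c).put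
            (s.var .heap + 3) d).put (s.var .heap + 4) e).mem f = s.mem f := by
        intro a b c d e f hf
        simp only [St.put_mem, Function.update_apply]
        repeat rw [if_neg (by omega)]
      refine hQ _ (.inr ⟨⟨x, .nil, .prod (eL.comp g.2.1) g.2.2 (eR.comp g'.2.1) g'.2.2⟩, ?_, ?_, ?_⟩)
        ?_ ?_ ?_ ?_ ?_ rfl
      · refine ⟨by simpa using hH, by simp, by simp, ?_, by simp, ?_, by simp⟩
        · simpa using hg.congr fun b _ hb => hold 1 (s.mem (s.var .lrow + 4 + 2 * s.var .i))
            (cd _ _ (eL.comp g.2.1)) (s.mem (s.var .rrow + 4 + 2 * s.var .j))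
            (cd _ _ (eR.comp g'.2.1)) b hb
        · simpa using hg'.congr fun b _ hb => hold 1 (s.mem (s.var .lrow + 4 + 2 * s.var .i))
            (cd _ _ (eL.comp g.2.1)) (s.mem (s.var .rrow + 4 + 2 * s.var .j))
            (cd _ _ (eR.comp g'.2.1)) b hb
      · simpa using hid
      · intro v ρ
        simp only [combSem, hi, hj, if_true, hS, hS', Tr.sols, Path.comp_nil, Path.comp_assoc]
      · simp
      · simp
      · intro b hb
        simpa using hold _ _ _ _ _ b hb
      · simp
      · intro y hy
        simp [scr hy .heap trivial, scr hy .mor trivial, scr hy .tgt trivial, scr hy .old trivial,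
          scr hy .saved trivial, scr hy .smor trivial]
    · refine hQ _ (.inr ⟨⟨g.1, eL.comp g.2.1, g.2.2⟩, ?_, ?_, ?_⟩) (by simp) (by simp) (by simp)
        (by simp) (fun y hy => by simp [scr hy .tgt trivial, scr hy .mor trivial]) rfl
      · simpa using hg
      · simp
      · intro v ρ
        simp only [combSem, hi, hj, if_true, if_false, hS, Path.comp_assoc]
  · obtain ⟨-, hS⟩ | ⟨g, hg, -, -⟩ := hr hj
    · refine hQ _ (.inl ⟨by simp, fun v ρ => ?_⟩) (by simp) (by simp) (by simp) (by simp)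
        (fun y hy => by simp [scr hy .tgt trivial]) rfl
      simp [combSem, hi, hj, hS]
    · have := hg.le; omega
  · obtain ⟨h, -⟩ | ⟨g, hg, hgc, hS⟩ := hr hj
    · exact (h0 h).elim
    rw [hrm, hgc, hcd.op_eq]
    refine ⟨hcd.lt _, hQ _ (.inr ⟨⟨g.1, eR.comp g.2.1, g.2.2⟩, ?_, ?_, ?_⟩) (by simp) (by simp)
      (by simp) (by simp) (fun y hy => by simp [scr hy .tgt trivial, scr hy .mor trivial]) rfl⟩
    · simpa using hg
    · simp
    · intro v ρ
      simp only [combSem, hi, hj, if_true, if_false, hS, Path.comp_assoc]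
  · refine hQ _ (.inl ⟨by simp, fun v ρ => ?_⟩) (by simp) (by simp) (by simp) (by simp)
      (fun y hy => by simp [scr hy .tgt trivial]) rfl
    simp [combSem, hi, hj]

end Pairs

/-! ### The loop over all pairs of child states. -/

section Pairs

open Quiver (Path)
open Finset (range)

variable {V : Type} [Quiver.{0} V] {cd : ∀ x y : V, Path x y → ℕ} {op : ℕ → ℕ → ℕ} {N : ℕ}
  {lo : ℕ} {x l r : V} {Q : St → Prop}

theorem LinkRep.ext {mem : ℕ → ℕ} {hi a : ℕ} {S S' : Sem x} (h : LinkRep cd mem lo hi S a)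
    (hS : ∀ v ρ, S' v ρ = S v ρ) : LinkRep cd mem lo hi S' a := by
  obtain rfl : S' = S := funext fun v => funext fun ρ => hS v ρ
  exact h

theorem LinkRep.zero {mem : ℕ → ℕ} {hi a : ℕ} (h : mem a = 0) :
    LinkRep cd mem lo hi (fun _ _ => 0 : Sem x) a := .inl ⟨h, fun _ _ => rfl⟩

/-- The situation before the trees of an inner vertex `x` with children `l` and `r` are
constructed. -/
structure PairPre (cd : ∀ x y : V, Path x y → ℕ) (N lo m : ℕ) (st : ℕ → ℕ → ℕ)
    (eL : Path x l) (eR : Path x r) (SL : ℕ → Sem l) (SR : ℕ → Sem r) (s₀ : St) : Prop where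
  lo_pos : 0 < lo
  lo_le : lo ≤ s₀.var .heap
  states : s₀.var .states = m
  row_le : s₀.var .row + 4 + 2 * m ≤ lo
  lmor : s₀.var .lmor = cd _ _ eL
  rmor : s₀.var .rmor = cd _ _ eR
  ident : s₀.var .ident = cd x x .nil
  left : ∀ i < m, LinkRep cd s₀.mem lo (s₀.var .heap) (SL i) (s₀.var .lrow + 4 + 2 * i)
  right : ∀ i < m, LinkRep cd s₀.mem lo (s₀.var .heap) (SR i) (s₀.var .rrow + 4 + 2 * i)
  lrow_le : s₀.var .lrow + 4 + 2 * m ≤ lo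
  rrow_le : s₀.var .rrow + 4 + 2 * m ≤ lo
  -- The links start at offset 4 in both rows, so this separates the links of the child from those
  -- being written.
  lrow_disj : s₀.var .lrow + 2 * m ≤ s₀.var .row ∨ s₀.var .row + 2 * m ≤ s₀.var .lrow
  rrow_disj : s₀.var .rrow + 2 * m ≤ s₀.var .row ∨ s₀.var .row + 2 * m ≤ s₀.var .rrow
  st_lt : ∀ i ≤ m, ∀ j ≤ m, st i j < m
  addr_lt : ∀ i ≤ m, ∀ j ≤ m, s₀.var .tabNode +
    ((s₀.var .label * m + if i < m then i else s₀.var .lempty) * m +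
      if j < m then j else s₀.var .rempty) < s₀.var .row
  st_eq : ∀ i ≤ m, ∀ j ≤ m, s₀.mem (s₀.var .tabNode +
    ((s₀.var .label * m + if i < m then i else s₀.var .lempty) * m +
      if j < m then j else s₀.var .rempty)) = st i j
  empty : ∀ t < m, s₀.mem (s₀.var .row + 4 + 2 * t) = 0
  -- Each pair creates at most one product and one union, of seven cells each.
  room : s₀.var .heap + 14 * ((m + 1) * (m + 1)) + 14 < 2 ^ N

/-- The contribution of the states `i` and `j` of the children to the set of solutions with
state `t`. -/
def pairSem (m : ℕ) (st : ℕ → ℕ → ℕ) (eL : Path x l) (eR : Path x r) (SL : ℕ → Sem l)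
    (SR : ℕ → Sem r) (t i j : ℕ) : Sem x := fun v ρ =>
  if st i j = t then combSem m i j eL eR (SL i) (SR j) v ρ else 0

/-- The contribution of all pairs of states before `(i, j)`. -/
def accSem (m : ℕ) (st : ℕ → ℕ → ℕ) (eL : Path x l) (eR : Path x r) (SL : ℕ → Sem l)
    (SR : ℕ → Sem r) (t i j : ℕ) : Sem x := fun v ρ =>
  (∑ i' ∈ range i, ∑ j' ∈ range (m + 1), pairSem m st eL eR SL SR t i' j' v ρ) +
    ∑ j' ∈ range j, pairSem m st eL eR SL SR t i j' v ρ

/-- The situation when all pairs of states before `(i, j)` have been dealt with. -/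
structure PairInv (cd : ∀ x y : V, Path x y → ℕ) (lo m : ℕ) (st : ℕ → ℕ → ℕ)
    (eL : Path x l) (eR : Path x r) (SL : ℕ → Sem l) (SR : ℕ → Sem r) (s₀ : St) (i j : ℕ)
    (s : St) : Prop where
  var : ∀ y : Var, ¬ y.Scratch → y ≠ .i → y ≠ .j → s.var y = s₀.var y
  out : s.out = s₀.out
  i_eq : s.var .i = i
  j_eq : s.var .j = j
  heap_ge : s₀.var .heap ≤ s.var .heap
  heap_le : s.var .heap ≤ s₀.var .heap + 14 * (i * (m + 1) + j)
  mem : ∀ b < s₀.var .heap, (b < s₀.var .row + 4 ∨ s₀.var .row + 4 + 2 * m ≤ b) →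
    s.mem b = s₀.mem b
  links : ∀ t < m, LinkRep cd s.mem lo (s.var .heap) (accSem m st eL eR SL SR t i j)
    (s₀.var .row + 4 + 2 * t)

variable {m : ℕ} {st : ℕ → ℕ → ℕ} {eL : Path x l} {eR : Path x r} {SL : ℕ → Sem l}
  {SR : ℕ → Sem r} {s₀ s : St} {i j : ℕ}

theorem wp_findCell {t : ℕ}
    (ht : s.mem (s.var .tabNode + ((s.var .label * s.var .states +
      if s.var .i < s.var .states then s.var .i else s.var .lempty) * s.var .states +
      if s.var .j < s.var .states then s.var .j else s.var .rempty)) = t)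
    (hN : s.var .row + 4 + 2 * t < 2 ^ N)
    (hQ : ∀ s' : St, s'.var .cell = s.var .row + 4 + 2 * t → s'.var .heap = s.var .heap →
      s'.mem = s.mem → (∀ y : Var, ¬ y.Scratch → s'.var y = s.var y) → s'.out = s.out → Q s') :
    findCell.wp op N Q s := by
  have scr : ∀ {y : Var}, ¬ y.Scratch → ∀ z : Var, z.Scratch → y ≠ z :=
    fun hy z hz h => hy (h ▸ hz)
  by_cases h₁ : s.var .i < s.var .states <;> by_cases h₂ : s.var .j < s.var .states <;>
    simp only [h₁, h₂, if_true, if_false] at ht <;>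
    simp only [findCell, Cmd.wp, Cond.eval, Ex.eval_mem, Ex.eval_var, Ex.eval_ofNat, Ex.eval_add,
      Ex.eval_mul, Ex.safe_ofNat, Ex.safe_add, Ex.safe_var, Ex.safe_mem, true_and, St.put_var,
      St.set_var, St.set_mem, reduceCtorEq, if_false, if_true, h₁, h₂, not_true_eq_false,
      not_false_eq_true, false_implies, true_implies, and_true, ht, hN] <;>
    refine hQ _ (by simp) (by simp) rfl (fun y hy => ?_) rfl <;>
    simp [scr hy .cell trivial, scr hy .p trivial, scr hy .q trivial]

theorem accSem_succ (t i j : ℕ) (v : V) (ρ : Path v x) :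
    accSem m st eL eR SL SR t i (j + 1) v ρ
      = accSem m st eL eR SL SR t i j v ρ + pairSem m st eL eR SL SR t i j v ρ := by
  rw [accSem, accSem, Finset.sum_range_succ, add_assoc]

theorem PairInv.step {s' : St} (h : PairInv cd lo m st eL eR SL SR s₀ i j s)
    (hv : ∀ y : Var, ¬ y.Scratch → s'.var y = s.var y) (ho : s'.out = s.out)
    (hge : s.var .heap ≤ s'.var .heap) (hle : s'.var .heap ≤ s.var .heap + 14)
    (hm : ∀ b < s₀.var .heap, (b < s₀.var .row + 4 ∨ s₀.var .row + 4 + 2 * m ≤ b) →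
      s'.mem b = s.mem b)
    (hl : ∀ t < m, LinkRep cd s'.mem lo (s'.var .heap) (accSem m st eL eR SL SR t i (j + 1))
      (s₀.var .row + 4 + 2 * t)) :
    PairInv cd lo m st eL eR SL SR s₀ i (j + 1) (s'.set .j (s'.var .j + 1)) where
  var y hy hyi hyj := by
    rw [St.set_var, if_neg hyj, hv y hy, h.var y hy hyi hyj]
  out := ho.trans h.out
  i_eq := by
    rw [St.set_var, if_neg (by simp), hv _ (by simp [Var.Scratch]), h.i_eq]
  j_eq := by
    rw [St.set_var, if_pos rfl, hv _ (by simp [Var.Scratch]), h.j_eq]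
  heap_ge := by
    rw [St.set_var, if_neg (by simp)]
    exact h.heap_ge.trans hge
  heap_le := by
    rw [St.set_var, if_neg (by simp)]
    have := h.heap_le
    omega
  mem b hb hb' := (hm b hb hb').trans (h.mem b hb hb')
  links t ht := by
    rw [St.set_var, if_neg (by simp)]
    exact hl t ht

-- A pair of child states determines the state of the parent, so it contributes to exactly one link;
-- the other accumulated sets only have to be carried across the changes of memory.
set_option maxHeartbeats 1000000 in
theorem wp_pairStep (hcd : Coding cd op N) (h₀ : PairPre cd N lo m st eL eR SL SR s₀)
    (h : PairInv cd lo m st eL eR SL SR s₀ i j s) (hi : i ≤ m) (hj : j ≤ m) :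
    pairStep.wp op N (PairInv cd lo m st eL eR SL SR s₀ i (j + 1)) s := by
  have hheap : s.var .heap + 14 ≤ s₀.var .heap + 14 * ((m + 1) * (m + 1)) + 14 := by
    have h1 : i * (m + 1) + j ≤ (m + 1) * (m + 1) := by nlinarith
    have := h.heap_le
    omega
  have hroom := h₀.room
  have hlo := h₀.lo_le
  have hge := h.heap_ge
  have hst := h₀.st_lt i hi j hj
  have hrow := h₀.row_le
  have v₁ := h.var .tabNode (by simp [Var.Scratch]) (by simp) (by simp)
  have v₂ := h.var .label (by simp [Var.Scratch]) (by simp) (by simp)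
  have v₃ := (h.var .states (by simp [Var.Scratch]) (by simp) (by simp)).trans h₀.states
  have v₄ := h.var .lempty (by simp [Var.Scratch]) (by simp) (by simp)
  have v₅ := h.var .rempty (by simp [Var.Scratch]) (by simp) (by simp)
  have v₆ := h.var .row (by simp [Var.Scratch]) (by simp) (by simp)
  have v₇ := h.var .lrow (by simp [Var.Scratch]) (by simp) (by simp)
  have v₈ := h.var .rrow (by simp [Var.Scratch]) (by simp) (by simp)
  have v₉ := h.var .lmor (by simp [Var.Scratch]) (by simp) (by simp)
  have v₁₀ := h.var .rmor (by simp [Var.Scratch]) (by simp) (by simp)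
  have v₁₁ := h.var .ident (by simp [Var.Scratch]) (by simp) (by simp)
  have haddr := h₀.addr_lt i hi j hj
  refine wp_findCell (t := st i j) ?_ (by omega) fun s₁ c₁ k₁ m₁ w₁ o₁ => ?_
  · rw [v₁, v₂, v₃, v₄, v₅, h.i_eq, h.j_eq, ← h₀.st_eq i hi j hj]
    -- The transition table lies below the current row and has not been touched.
    exact h.mem _ (by omega) (.inl (by omega))
  have w_i := (w₁ .i (by simp [Var.Scratch])).trans h.i_eq
  have w_j := (w₁ .j (by simp [Var.Scratch])).trans h.j_eq
  have w_s := (w₁ .states (by simp [Var.Scratch])).trans v₃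
  have w_l := (w₁ .lrow (by simp [Var.Scratch])).trans v₇
  have w_r := (w₁ .rrow (by simp [Var.Scratch])).trans v₈
  have hmem₀ : ∀ b, lo ≤ b → b < s₀.var .heap → s.mem b = s₀.mem b :=
    fun b hb hb' => h.mem b hb' (.inr (by omega))
  have hll := h₀.lrow_le
  have hrl := h₀.rrow_le
  have hld := h₀.lrow_disj
  have hrd := h₀.rrow_disj
  refine wp_combine (s := s₁) (lo := lo) (eL := eL) (eR := eR) (SL := SL i) (SR := SR j) hcd
    h₀.lo_pos (by omega) ?_ ?_ ?_ ?_ ?_ (by omega) fun s₂ t₂ g₂ l₂ m₂ c₂ w₂ o₂ => ?_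
  · rw [w_i, w_s, w_l, m₁, k₁]
    intro hi'
    exact (h₀.left i hi').congr hge hmem₀ (h.mem _ (by omega) (by omega))
      (h.mem _ (by omega) (by omega))
  · rw [w_j, w_s, w_r, m₁, k₁]
    intro hj'
    exact (h₀.right j hj').congr hge hmem₀ (h.mem _ (by omega) (by omega))
      (h.mem _ (by omega) (by omega))
  · rw [w₁ .lmor (by simp [Var.Scratch]), v₉, h₀.lmor]
  · rw [w₁ .rmor (by simp [Var.Scratch]), v₁₀, h₀.rmor]
  · rw [w₁ .ident (by simp [Var.Scratch]), v₁₁, h₀.ident]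
  rw [w_i, w_j, w_s] at t₂
  have hc₂ : s₂.var .cell = s₀.var .row + 4 + 2 * st i j := by rw [c₂, c₁, v₆]
  have hv₂ : ∀ y : Var, ¬ y.Scratch → y ≠ .i → y ≠ .j → s₂.var y = s₀.var y :=
    fun y hy hyi hyj => by rw [w₂ y hy, w₁ y hy, h.var y hy hyi hyj]
  have hi₂ : s₂.var .i = i := (w₂ .i (by simp [Var.Scratch])).trans w_i
  have hj₂ : s₂.var .j = j := (w₂ .j (by simp [Var.Scratch])).trans w_j
  have ho₂ : s₂.out = s₀.out := by rw [o₂, o₁, h.out]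
  have hm₂ : ∀ b < s.var .heap, s₂.mem b = s.mem b := fun b hb => by
    rw [m₂ b (by omega), m₁]
  have hl₂ : ∀ t < m, LinkRep cd s₂.mem lo (s₂.var .heap) (accSem m st eL eR SL SR t i j)
      (s₀.var .row + 4 + 2 * t) := fun t ht =>
    (h.links t ht).congr (by omega) (fun b _ hb => hm₂ b hb) (hm₂ _ (by omega)) (hm₂ _ (by omega))
  have hN₂ : s₂.var .j + 1 < 2 ^ N := by
    have : m < (m + 1) * (m + 1) := by nlinarith
    omega
  have hgs : s.var .heap ≤ s₂.var .heap := by omega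
  have hls : s₂.var .heap ≤ s.var .heap + 7 := by omega
  have hv₃ : ∀ y : Var, ¬ y.Scratch → s₂.var y = s.var y := fun y hy => by rw [w₂ y hy, w₁ y hy]
  have ho₃ : s₂.out = s.out := by rw [o₂, o₁]
  have hid := (hv₂ .ident (by simp [Var.Scratch]) (by simp) (by simp)).trans h₀.ident
  clear m₂ w₂ w₁ m₁ o₁ o₂ c₁ c₂ g₂ l₂ k₁
  simp only [Cmd.wp, Cond.eval, Ex.eval_var, Ex.eval_ofNat, Ex.eval_add, Ex.safe_add]
  refine ⟨fun h0 => ⟨hN₂, ?_⟩, fun h0 => ?_⟩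
  · rcases t₂ with ⟨-, hS⟩ | ⟨g, hg, -, -⟩
    · refine h.step hv₃ ho₃ hgs (by omega) (fun b hb _ => hm₂ b (by omega)) fun t ht => ?_
      refine LinkRep.ext (hl₂ t ht) fun v ρ => ?_
      rw [accSem_succ, pairSem, hS, ite_self, add_zero]
    · have := hg.le
      have := h₀.lo_pos
      omega
  · rcases t₂ with ⟨h, -⟩ | ⟨g, hg, hgc, hS⟩
    · exact (h0 h).elim
    refine wp_addLink hcd h₀.lo_pos (S := accSem m st eL eR SL SR (st i j) i j) (g := g)
      (by rw [hc₂]; exact hl₂ _ hst) hg hgc (by omega) hid (by omega)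
      fun s₃ l₃ g₃ k₃ m₃ w₃ o₃ => ?_
    rw [hc₂] at l₃
    refine ⟨by rw [w₃ .j (by simp [Var.Scratch])]; exact hN₂, ?_⟩
    refine h.step (fun y hy => (w₃ y hy).trans (hv₃ y hy)) (o₃.trans ho₃) (by omega) (by omega)
      (fun b hb hb' => (m₃ b (by omega) (by omega) (by omega)).trans (hm₂ b (by omega)))
      fun t ht => ?_
    by_cases e : st i j = t
    · subst e
      refine LinkRep.ext l₃ fun v ρ => ?_
      rw [accSem_succ, pairSem, if_pos rfl, hS]
    · have := (hl₂ t ht).congr (mem' := s₃.mem) g₃ (fun b hb hb' => m₃ b hb' (by omega) (by omega))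
        (m₃ _ (by omega) (by omega) (by omega)) (m₃ _ (by omega) (by omega) (by omega))
      refine LinkRep.ext this fun v ρ => ?_
      rw [accSem_succ, pairSem, if_neg e, add_zero]

/-- A bound for the time needed for one state of the left child. -/
def rowTime (m : ℕ) : ℕ :=
  (Cmd.assign .j 0).cost + ((((m + 1) * ((Cond.lt (.var .j) (.var .states + 1)).len + pairStep.cost + 1)) +
    ((Cond.lt (.var .j) (.var .states + 1)).len + 1)) + (Cmd.assign .i (.var .i + 1)).cost)

/-- A bound for the time needed for an inner vertex. -/
def pairTime (m : ℕ) : ℕ :=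
  (Cmd.assign .i 0).cost + ((m + 1) * ((Cond.lt (.var .i) (.var .states + 1)).len +
    rowTime m + 1) + ((Cond.lt (.var .i) (.var .states + 1)).len + 1))

theorem PairInv.states_eq (h : PairInv cd lo m st eL eR SL SR s₀ i j s)
    (h₀ : PairPre cd N lo m st eL eR SL SR s₀) : s.var .states = m :=
  (h.var .states (by simp [Var.Scratch]) (by simp) (by simp)).trans h₀.states

theorem accSem_row (t i : ℕ) (v : V) (ρ : Path v x) :
    accSem m st eL eR SL SR t (i + 1) 0 v ρ = accSem m st eL eR SL SR t i (m + 1) v ρ := by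
  rw [accSem, accSem, Finset.sum_range_succ, Finset.sum_range_zero, add_zero]

theorem PairInv.set_i {s : St} (h : PairInv cd lo m st eL eR SL SR s₀ i (m + 1) s) :
    PairInv cd lo m st eL eR SL SR s₀ (i + 1) 0 ((s.set .i (s.var .i + 1)).set .j 0) where
  var y hy hyi hyj := by
    rw [St.set_var, if_neg hyj, St.set_var, if_neg hyi, h.var y hy hyi hyj]
  out := h.out
  i_eq := by simp [h.i_eq]
  j_eq := by simp
  heap_ge := by simpa using h.heap_ge
  heap_le := by
    have := h.heap_le
    simp only [St.set_var, reduceCtorEq, if_false]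
    rw [add_mul i 1]
    omega
  mem b hb hb' := h.mem b hb hb'
  links t ht := LinkRep.ext (by simpa using h.links t ht) fun v ρ => accSem_row t i v ρ

/-- The invariant between rows is stated with `j` set to 0, since the row step begins by resetting
`j`, which still has its final value from the preceding row. -/
theorem tri_rowStep (hcd : Coding cd op N) (hN₂ : 2 ≤ N)
    (h₀ : PairPre cd N lo m st eL eR SL SR s₀)
    (h : PairInv cd lo m st eL eR SL SR s₀ i 0 (s.set .j 0)) (hi : i ≤ m) :
    Tri op N rowStep s (rowTime m)
      fun s' => PairInv cd lo m st eL eR SL SR s₀ (i + 1) 0 (s'.set .j 0) := by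
  have hroom := h₀.room
  have hm : m < (m + 1) * (m + 1) := by nlinarith
  refine Tri.seq (Tri.of_wp hN₂ ?_)
  refine ⟨by simp, ?_⟩
  refine Tri.seq (Tri.loop (fun k s => ∃ j, j + k = m + 1 ∧ PairInv cd lo m st eL eR SL SR s₀ i j s)
    ?_ ?_ (k := m + 1) ⟨0, by simp, h⟩)
  · rintro k s ⟨j, hj, hs⟩ hc
    simp only [Cond.eval, Ex.eval_var, Ex.eval_add, Ex.eval_ofNat, hs.j_eq, hs.states_eq h₀] at hc
    exact (Tri.of_wp hN₂ (wp_pairStep hcd h₀ hs hi (by omega))).mono le_rfl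
      fun s' h' => ⟨k - 1, by omega, j + 1, by omega, h'⟩
  · rintro k s ⟨j, hj, hs⟩ hc
    simp only [Cond.eval, Ex.eval_var, Ex.eval_add, Ex.eval_ofNat, hs.j_eq, hs.states_eq h₀] at hc
    obtain rfl : j = m + 1 := by omega
    refine Tri.of_wp hN₂ ⟨?_, hs.set_i⟩
    rw [Ex.safe_add, Ex.eval_var, hs.i_eq]
    change i + 1 < 2 ^ N
    omega

theorem tri_pairLoop (hcd : Coding cd op N) (hN₂ : 2 ≤ N)
    (h₀ : PairPre cd N lo m st eL eR SL SR s₀) :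
    Tri op N pairLoop s₀ (pairTime m)
      fun s' => PairInv cd lo m st eL eR SL SR s₀ (m + 1) 0 (s'.set .j 0) := by
  refine Tri.seq (Tri.of_wp hN₂ ?_)
  refine ⟨by simp, ?_⟩
  refine Tri.loop (fun k s => ∃ i, i + k = m + 1 ∧
    PairInv cd lo m st eL eR SL SR s₀ i 0 (s.set .j 0)) ?_ ?_ (k := m + 1) ⟨0, by simp, ?_⟩
  · rintro k s ⟨i, hi, hs⟩ hc
    have h₁ := hs.i_eq
    have h₂ := hs.states_eq h₀
    simp only [St.set_var, reduceCtorEq, if_false] at h₁ h₂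
    simp only [Cond.eval, Ex.eval_var, Ex.eval_add, Ex.eval_ofNat, h₁, h₂] at hc
    exact (tri_rowStep hcd hN₂ h₀ hs (by omega)).mono le_rfl
      fun s' h' => ⟨k - 1, by omega, i + 1, by omega, h'⟩
  · rintro k s ⟨i, hi, hs⟩ hc
    have h₁ := hs.i_eq
    have h₂ := hs.states_eq h₀
    simp only [St.set_var, reduceCtorEq, if_false] at h₁ h₂
    simp only [Cond.eval, Ex.eval_var, Ex.eval_add, Ex.eval_ofNat, h₁, h₂] at hc
    obtain rfl : i = m + 1 := by omega
    exact hs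
  · refine ⟨fun y hy hyi hyj => by simp [hyi, hyj], rfl, by simp, by simp, by simp, by simp,
      fun b hb hb' => rfl, fun t ht => ?_⟩
    exact LinkRep.ext (LinkRep.zero (h₀.empty t ht)) fun v ρ => by simp [accSem]

end Pairs

/-! ### The solutions of decorated trees -/

section conv

theorem conv_sum {ι : Type} (s : Finset ι) (S : Multiset (Multiset ℕ))
    (T : ι → Multiset (Multiset ℕ)) : conv S (∑ i ∈ s, T i) = ∑ i ∈ s, conv S (T i) :=
  map_sum (⟨⟨conv S, conv_zero S⟩, conv_add S⟩ : Multiset (Multiset ℕ) →+ _) T s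

theorem sum_conv {ι : Type} (s : Finset ι) (S : ι → Multiset (Multiset ℕ))
    (T : Multiset (Multiset ℕ)) : conv (∑ i ∈ s, S i) T = ∑ i ∈ s, conv (S i) T :=
  map_sum (⟨⟨fun S => conv S T, zero_conv T⟩, fun S S' => add_conv S S' T⟩ :
    Multiset (Multiset ℕ) →+ _) S s

end conv

section TreeSols

variable {C : Type u} [Category.{v} C] {Q A F : Type}
  (B : DBUTA Q (A × Bool) F)

/-- The state to which a tree with a given set of selected leaves is evaluated. -/
def stateOf {x : C} (T : DecTree C A F x) (S : Finset T.Leaves) : Q :=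
  B.eval (T.mark fun p => decide (p ∈ S))

/-- The multiset of the values under `h` of the leaves in `S`. -/
def valueOf {x : C} (T : DecTree C A F x) (h : (Σ y : C, (x ⟶ y)) → ℕ) (S : Finset T.Leaves) :
    Multiset ℕ :=
  S.val.map fun p => h (T.leafMor p)

/-- Sets of leaves of a node are disjoint sums of sets of leaves of the two subtrees. -/
theorem stateOf_node {x y z : C} (f : F) (α : x ⟶ y) (β : x ⟶ z) (l : DecTree C A F y)
    (r : DecTree C A F z) (S₁ : Finset l.Leaves) (S₂ : Finset r.Leaves) :
    stateOf B (.node f α β l r) (S₁.disjSum S₂ : Finset (l.Leaves ⊕ r.Leaves))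
      = B.δ₂ (stateOf B l S₁) (stateOf B r S₂) f := by
  change B.δ₂ (B.eval (l.mark _)) (B.eval (r.mark _)) f = _
  congr 3 <;> funext p <;> rw [decide_eq_decide]
  · exact Finset.inl_mem_disjSum
  · exact Finset.inr_mem_disjSum

theorem valueOf_node {x y z : C} (f : F) (α : x ⟶ y) (β : x ⟶ z) (l : DecTree C A F y)
    (r : DecTree C A F z) (h : (Σ y : C, (x ⟶ y)) → ℕ) (S₁ : Finset l.Leaves)
    (S₂ : Finset r.Leaves) :
    valueOf (.node f α β l r) h (S₁.disjSum S₂ : Finset (l.Leaves ⊕ r.Leaves))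
      = valueOf l (fun γ => h ⟨γ.1, α ≫ γ.2⟩) S₁ + valueOf r (fun γ => h ⟨γ.1, β ≫ γ.2⟩) S₂ := by
  refine (Multiset.map_add _ (S₁.val.map Sum.inl) (S₂.val.map Sum.inr)).trans ?_
  congr 1 <;> exact Multiset.map_map _ _ _

theorem card_valueOf_le {x : C} (T : DecTree C A F x) (h : (Σ y : C, (x ⟶ y)) → ℕ)
    (S : Finset T.Leaves) : (valueOf T h S).card ≤ Fintype.card T.Leaves := by
  rw [valueOf, Multiset.card_map]
  exact Finset.card_le_univ S

variable [DecidableEq Q]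

/-- The solutions with state `q`. -/
def allSols {x : C} (T : DecTree C A F x) (h : (Σ y : C, (x ⟶ y)) → ℕ) (q : Q) :
    Multiset (Multiset ℕ) :=
  ∑ S : Finset T.Leaves, if stateOf B T S = q then {valueOf T h S} else 0

/-- The nonempty solutions with state `q`. -/
def properSols {x : C} (T : DecTree C A F x) (h : (Σ y : C, (x ⟶ y)) → ℕ) (q : Q) :
    Multiset (Multiset ℕ) :=
  ∑ S ∈ (Finset.univ : Finset (Finset T.Leaves)).erase ∅,
    if stateOf B T S = q then {valueOf T h S} else 0

theorem allSols_eq {x : C} (T : DecTree C A F x) (h : (Σ y : C, (x ⟶ y)) → ℕ) (q : Q) :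
    allSols B T h q = (if stateOf B T ∅ = q then {0} else 0) + properSols B T h q := by
  rw [allSols, properSols, ← Finset.add_sum_erase _ _ (Finset.mem_univ ∅)]
  rfl

theorem properSols_leaf (x : C) (a : A) (h : (Σ y : C, (x ⟶ y)) → ℕ) (q : Q) :
    properSols B (.leaf x a) h q = if B.δ₀ (a, true) = q then {{h ⟨x, 𝟙 x⟩}} else 0 := by
  have : (Finset.univ : Finset (Finset (DecTree.leaf (C := C) (F := F) x a).Leaves)).erase ∅
      = {{()}} := by
    change (Finset.univ : Finset (Finset Unit)).erase ∅ = {{()}}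
    decide
  rw [properSols, this, Finset.sum_singleton]
  rfl

theorem card_le_of_mem_properSols {x : C} (T : DecTree C A F x) {h : (Σ y : C, (x ⟶ y)) → ℕ}
    {q : Q} {a : Multiset ℕ} (ha : a ∈ properSols B T h q) : a.card ≤ Fintype.card T.Leaves := by
  rw [properSols, Multiset.mem_sum] at ha
  obtain ⟨S, -, hS⟩ := ha
  split_ifs at hS
  · rw [Multiset.mem_singleton.1 hS]
    exact card_valueOf_le T h S
  · simp at hS

variable [Fintype Q]

/-- Sets of leaves correspond to pairs of sets, and these are grouped by the states of the two
parts. Determinism puts each pair into exactly one group, so multiplicities are right. -/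
theorem allSols_node {x y z : C} (f : F) (α : x ⟶ y) (β : x ⟶ z) (l : DecTree C A F y)
    (r : DecTree C A F z) (h : (Σ y : C, (x ⟶ y)) → ℕ) (q : Q) :
    allSols B (.node f α β l r) h q = ∑ p, ∑ p' : Q, if B.δ₂ p p' f = q then
      conv (allSols B l (fun γ => h ⟨γ.1, α ≫ γ.2⟩) p)
        (allSols B r (fun γ => h ⟨γ.1, β ≫ γ.2⟩) p') else 0 := by
  have h₁ : allSols B (.node f α β l r) h q = ∑ S₁ : Finset l.Leaves, ∑ S₂ : Finset r.Leaves,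
      if B.δ₂ (stateOf B l S₁) (stateOf B r S₂) f = q then
        conv {valueOf l (fun γ => h ⟨γ.1, α ≫ γ.2⟩) S₁}
          {valueOf r (fun γ => h ⟨γ.1, β ≫ γ.2⟩) S₂} else 0 := by
    rw [← Fintype.sum_prod_type', allSols]
    refine Fintype.sum_equiv (Finset.sumEquiv (α := l.Leaves) (β := r.Leaves)).toEquiv _ _ fun S => ?_
    obtain ⟨⟨S₁, S₂⟩, rfl⟩ := (Finset.sumEquiv (α := l.Leaves) (β := r.Leaves)).symm.surjective S
    have e : (Finset.sumEquiv (α := l.Leaves) (β := r.Leaves)).toEquiv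
      ((Finset.sumEquiv (α := l.Leaves) (β := r.Leaves)).symm (S₁, S₂)) = (S₁, S₂) :=
        (Finset.sumEquiv (α := l.Leaves) (β := r.Leaves)).apply_symm_apply _
    rw [e]
    have e₁ := stateOf_node B f α β l r S₁ S₂
    have e₂ := valueOf_node f α β l r h S₁ S₂
    simp only [conv_singleton, Multiset.map_singleton]
    rw [← e₁, ← e₂]
    rfl
  rw [h₁]
  -- The grouped sum is expanded with indicators of the two states; summing over `p` and `p'` then
  -- collapses them.
  have h₂ : ∀ p p' : Q, (if B.δ₂ p p' f = q then
      conv (allSols B l (fun γ => h ⟨γ.1, α ≫ γ.2⟩) p)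
        (allSols B r (fun γ => h ⟨γ.1, β ≫ γ.2⟩) p') else 0)
      = ∑ S₁ : Finset l.Leaves, ∑ S₂ : Finset r.Leaves,
        if stateOf B l S₁ = p then if stateOf B r S₂ = p' then if B.δ₂ p p' f = q then
          conv {valueOf l (fun γ => h ⟨γ.1, α ≫ γ.2⟩) S₁}
          {valueOf r (fun γ => h ⟨γ.1, β ≫ γ.2⟩) S₂} else 0 else 0 else 0 := by
    intro p p'
    by_cases e : B.δ₂ p p' f = q
    · simp only [if_pos e, allSols, conv_sum, sum_conv]
      rw [Finset.sum_comm]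
      refine Finset.sum_congr rfl fun S₁ _ => Finset.sum_congr rfl fun S₂ _ => ?_
      split_ifs <;> simp
    · simp [e]
  simp only [h₂]
  have h₃ : ∀ p : Q, (∑ p' : Q, ∑ S₁ : Finset l.Leaves, ∑ S₂ : Finset r.Leaves,
        if stateOf B l S₁ = p then if stateOf B r S₂ = p' then if B.δ₂ p p' f = q then
          conv {valueOf l (fun γ => h ⟨γ.1, α ≫ γ.2⟩) S₁}
          {valueOf r (fun γ => h ⟨γ.1, β ≫ γ.2⟩) S₂} else 0 else 0 else 0)
      = ∑ S₁ : Finset l.Leaves, ∑ S₂ : Finset r.Leaves, if stateOf B l S₁ = p then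
        if B.δ₂ p (stateOf B r S₂) f = q then
          conv {valueOf l (fun γ => h ⟨γ.1, α ≫ γ.2⟩) S₁}
          {valueOf r (fun γ => h ⟨γ.1, β ≫ γ.2⟩) S₂} else 0 else 0 := by
    intro p
    rw [Finset.sum_comm]
    refine Finset.sum_congr rfl fun S₁ _ => ?_
    rw [Finset.sum_comm]
    refine Finset.sum_congr rfl fun S₂ _ => ?_
    by_cases e : stateOf B l S₁ = p <;> simp [Finset.sum_ite_eq, e]
  simp only [h₃]
  symm
  rw [Finset.sum_comm]
  refine Finset.sum_congr rfl fun S₁ _ => ?_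
  rw [Finset.sum_comm]
  refine Finset.sum_congr rfl fun S₂ _ => ?_
  simp [Finset.sum_ite_eq]

/-- Both factors of `allSols_node` are split into the empty solution and the rest. The product of
the two empty solutions is the empty solution of the node, and it is cancelled. -/
theorem properSols_node {x y z : C} (f : F) (α : x ⟶ y) (β : x ⟶ z) (l : DecTree C A F y)
    (r : DecTree C A F z) (h : (Σ y : C, (x ⟶ y)) → ℕ) (q : Q) :
    properSols B (.node f α β l r) h q =
      (∑ p, ((∑ p', if B.δ₂ p p' f = q then
        conv (properSols B l (fun γ => h ⟨γ.1, α ≫ γ.2⟩) p)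
          (properSols B r (fun γ => h ⟨γ.1, β ≫ γ.2⟩) p') else 0) +
        if B.δ₂ p (stateOf B r ∅) f = q then
          properSols B l (fun γ => h ⟨γ.1, α ≫ γ.2⟩) p else 0)) +
      ∑ p', if B.δ₂ (stateOf B l ∅) p' f = q then
          properSols B r (fun γ => h ⟨γ.1, β ≫ γ.2⟩) p' else 0 := by
  have e : stateOf B (.node f α β l r) ∅ = B.δ₂ (stateOf B l ∅) (stateOf B r ∅) f :=
    stateOf_node B f α β l r ∅ ∅
  have h₁ := allSols_node B f α β l r h q
  rw [allSols_eq, e] at h₁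
  refine Multiset.add_right_inj.1 (h₁.trans ?_)
  have h₂ : ∀ p p' : Q, (if B.δ₂ p p' f = q then
      conv (allSols B l (fun γ => h ⟨γ.1, α ≫ γ.2⟩) p)
        (allSols B r (fun γ => h ⟨γ.1, β ≫ γ.2⟩) p') else 0)
      = (if stateOf B l ∅ = p then if stateOf B r ∅ = p' then if B.δ₂ p p' f = q then
          {0} else 0 else 0 else 0)
      + (if stateOf B l ∅ = p then if B.δ₂ p p' f = q then
          properSols B r (fun γ => h ⟨γ.1, β ≫ γ.2⟩) p' else 0 else 0)
      + (if stateOf B r ∅ = p' then if B.δ₂ p p' f = q then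
          properSols B l (fun γ => h ⟨γ.1, α ≫ γ.2⟩) p else 0 else 0)
      + if B.δ₂ p p' f = q then
        conv (properSols B l (fun γ => h ⟨γ.1, α ≫ γ.2⟩) p)
          (properSols B r (fun γ => h ⟨γ.1, β ≫ γ.2⟩) p') else 0 := by
    intro p p'
    rw [allSols_eq, allSols_eq, add_conv, conv_add, conv_add]
    split_ifs <;> simp [add_assoc]
  simp only [h₂, Finset.sum_add_distrib]
  -- The side with the empty selection is in one fixed state, so one of the two sums disappears.
  have h₄ : ∀ (G : Q → Q → Multiset (Multiset ℕ)) (a : Q),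
      (∑ p, ∑ p', if a = p then G p p' else 0) = ∑ p', G a p' := by
    intro G a
    rw [Finset.sum_comm]
    simp [Finset.sum_ite_eq]
  rw [h₄, h₄]
  simp only [Finset.sum_ite_eq, Finset.mem_univ, if_true]
  abel

end TreeSols

/-! ### The solutions of decorated graphs -/

namespace DecDAG

variable {C : Type u} [Category.{v} C] {A F : Type} (D : DecDAG C A F)

theorem unfold_leaf {x : D.V} {a : A} (h : D.node x = Sum.inl a) :
    D.unfold x = .leaf _ a := by
  rw [unfold]
  split
  · rename_i a' h'
    rw [h] at h'
    cases h'
    rfl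
  · rename_i h'
    rw [h] at h'
    cases h'

theorem unfold_node {x l r : D.V} {f : F} (h : D.node x = Sum.inr (f, l, r)) :
    D.unfold x = .node f (D.γ.map (D.leftEdge h)) (D.γ.map (D.rightEdge h)) (D.unfold l)
      (D.unfold r) := by
  rw [unfold]
  split
  · rename_i h'
    rw [h] at h'
    cases h'
  · rename_i f' l' r' h'
    obtain ⟨rfl, rfl, rfl⟩ : f = f' ∧ l = l' ∧ r = r' := by
      rw [h] at h'
      cases h'
      exact ⟨rfl, rfl, rfl⟩
    rfl

theorem pathMor_comp {x y z : D.V} (π : Quiver.Path x y) (ρ : Quiver.Path y z) :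
    D.pathMor (π.comp ρ) = D.pathMor π ≫ D.pathMor ρ := by
  simp [pathMor, Prefunctor.mapPath_comp, composePath_comp]

theorem pathMor_toPath {x y : D.V} (e : x ⟶ y) : D.pathMor e.toPath = D.γ.map e := by
  simp [pathMor, Quiver.Hom.toPath, composePath]

/-- The vertices that can be reached by a nonempty path. -/
noncomputable def below (x : D.V) : Finset (Fin D.n) := by
  classical
  exact Finset.univ.filter fun y => Relation.TransGen (fun y z => ∃ d, IsEdge D.node y d z) x y

theorem mem_below {x y : D.V} : y ∈ D.below x ↔
    Relation.TransGen (fun y z => ∃ d, IsEdge D.node y d z) x y := by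
  classical
  unfold below
  exact Finset.mem_filter_univ (α := Fin D.n) _

/-- By acyclicity, `y` is reachable from `x` but not from itself by a nonempty path. This decreasing
rank bounds both the unfolding and the search stack. -/
theorem card_below_lt {x y : D.V} {d : Bool} (h : D.Edge x d y) :
    (D.below y).card < (D.below x).card :=
  Finset.card_lt_card (Finset.ssubset_iff_of_subset
    (fun _ hz => D.mem_below.2 (.head ⟨d, h⟩ (D.mem_below.1 hz))) |>.2
      ⟨y, D.mem_below.2 (.single ⟨d, h⟩), fun hy => D.acyclic y (D.mem_below.1 hy)⟩)

/-- The rank drops by at least one towards each child, so the two subtrees contribute at most half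
of the bound each. -/
theorem card_leaves_le (x : D.V) :
    Fintype.card (D.unfold x).Leaves ≤ 2 ^ (D.below x).card := by
  induction x using D.wf.induction with
  | _ x ih =>
  match h : D.node x with
  | .inl a =>
    rw [D.unfold_leaf h]
    exact Nat.one_le_two_pow
  | .inr (f, l, r) =>
    have h₁ := ih l ⟨false, f, l, r, h, rfl⟩
    have h₂ := ih r ⟨true, f, l, r, h, rfl⟩
    have h₃ := D.card_below_lt (y := l) (d := false) ⟨f, l, r, h, rfl⟩
    have h₄ := D.card_below_lt (y := r) (d := true) ⟨f, l, r, h, rfl⟩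
    rw [D.unfold_node h]
    have h₅ : Fintype.card (DecTree.node f (D.γ.map (D.leftEdge h)) (D.γ.map (D.rightEdge h))
        (D.unfold l) (D.unfold r)).Leaves
        = Fintype.card (D.unfold l).Leaves + Fintype.card (D.unfold r).Leaves :=
      Fintype.card_sum
    rw [h₅]
    calc _ ≤ 2 ^ ((D.below x).card - 1) + 2 ^ ((D.below x).card - 1) := by
          refine add_le_add (h₁.trans ?_) (h₂.trans ?_) <;>
            exact Nat.pow_le_pow_right (by norm_num) (by omega)
      _ = 2 ^ ((D.below x).card - 1 + 1) := by rw [pow_succ]; omega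
      _ = _ := by congr 1; omega

theorem card_leaves_le_two_pow (x : D.V) : Fintype.card (D.unfold x).Leaves ≤ 2 ^ D.n :=
  (D.card_leaves_le x).trans (Nat.pow_le_pow_right (by norm_num)
    ((Finset.card_le_univ _).trans_eq (Fintype.card_fin _)))

end DecDAG

section VertexSols

open Quiver (Path)
open Finset (range)

variable {C : Type u} [Category.{v} C] {m s₀ s₂ : ℕ}
  (B : DBUTA (Fin m) (Fin s₀ × Bool) (Fin s₂)) (D : DecDAG C (Fin s₀) (Fin s₂))
  (code : ∀ x y : C, (x ⟶ y) → ℕ)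

/-- The code of a path. -/
def pathCode (x y : D.V) (π : Path x y) : ℕ := code _ _ (D.pathMor π)

theorem RegisterAssumption.coding {op : ℕ → ℕ → ℕ} {w N : ℕ} {D : DecDAG C (Fin s₀) (Fin s₂)}
    {code : ∀ x y : C, (x ⟶ y) → ℕ} (h : RegisterAssumption D code op w) (hN : w ≤ N) :
    Coding (pathCode D code) op N where
  lt π := (h.mor_fits π).trans_le (Nat.pow_le_pow_right (by norm_num) hN)
  op_eq π₁ π₂ := by
    rw [pathCode, pathCode, pathCode, h.op_eq, D.pathMor_comp]

/-- The state of a vertex if no leaf is selected. -/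
def emptyState (x : D.V) : Fin m := stateOf B (D.unfold x) ∅

/-- The nonempty solutions of a vertex with state `t`. -/
def vertexSols (x : D.V) (t : ℕ) : Sem x := fun _ ρ =>
  if h : t < m then
    properSols B (D.unfold x) (fun α => code _ _ (D.pathMor ρ ≫ α.2)) ⟨t, h⟩
  else 0

/-- The transition function on numbers; the number `m` stands for the empty solution. -/
def pairState (f : Fin s₂) (l r : D.V) (i j : ℕ) : ℕ :=
  B.δ₂ (if h : i < m then ⟨i, h⟩ else emptyState B D l)
    (if h : j < m then ⟨j, h⟩ else emptyState B D r) f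

theorem emptyState_leaf {x : D.V} {a : Fin s₀} (h : D.node x = Sum.inl a) :
    emptyState B D x = B.δ₀ (a, false) := by
  rw [emptyState, D.unfold_leaf h]
  rfl

theorem emptyState_node {x l r : D.V} {f : Fin s₂} (h : D.node x = Sum.inr (f, l, r)) :
    emptyState B D x = B.δ₂ (emptyState B D l) (emptyState B D r) f := by
  rw [emptyState, D.unfold_node h]
  exact stateOf_node B f _ _ _ _ ∅ ∅

theorem vertexSols_leaf {x : D.V} {a : Fin s₀} (h : D.node x = Sum.inl a) {t : ℕ} (ht : t < m)
    (v : D.V) (ρ : Path v x) : vertexSols B D code x t v ρ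
      = if (B.δ₀ (a, true)).val = t then {{pathCode D code v x ρ}} else 0 := by
  rw [vertexSols, dif_pos ht, D.unfold_leaf h, properSols_leaf]
  simp only [Category.comp_id, Fin.ext_iff]
  rfl

/-- With the number `m` standing for the empty selection, the three sums of `properSols_node` become
one sum over a square of side `m + 1`, the range of the two nested loops; the corner `(m, m)`
contributes nothing. -/
theorem vertexSols_node {x l r : D.V} {f : Fin s₂} (h : D.node x = Sum.inr (f, l, r)) {t : ℕ}
    (ht : t < m) (v : D.V) (ρ : Path v x) :
    vertexSols B D code x t v ρ
      = ∑ i ∈ range (m + 1), ∑ j ∈ range (m + 1), pairSem m (pairState B D f l r)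
        (D.leftEdge h).toPath (D.rightEdge h).toPath (vertexSols B D code l)
        (vertexSols B D code r) t i j v ρ := by
  rw [vertexSols, dif_pos ht, D.unfold_node h, properSols_node]
  rw [Finset.sum_range_succ]
  simp only [Finset.sum_range_succ _ m, Finset.sum_range]
  have hm : ∀ i : Fin m, (i : ℕ) < m := fun i => i.2
  simp only [pairSem, combSem, pairState, hm, dif_pos, if_pos, lt_irrefl, dif_neg, if_neg,
    not_false_eq_true, Fin.eta, ite_self, add_zero, vertexSols, D.pathMor_comp, D.pathMor_toPath,
    Category.assoc, Fin.ext_iff]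
  rfl

/-- The empty set is split off, and every other selected set is counted under its unique state. -/
theorem answers_eq (x : D.V) :
    answers B D code x = (if emptyState B D x ∈ B.final then {0} else 0)
      + ∑ t ∈ range m, if h : t < m then
          if (⟨t, h⟩ : Fin m) ∈ B.final then vertexSols B D code x t x .nil else 0 else 0 := by
  have h₁ : answers B D code x = ∑ S : Finset (D.unfold x).Leaves,
      if stateOf B (D.unfold x) S ∈ B.final then
        {valueOf (D.unfold x) (fun α => code _ _ α.2) S} else 0 := by
    -- The multiset image is written as a sum of singletons, in order to compare it with the sums
    -- above.
    rw [← Finset.sum_filter, answers, ← Multiset.sum_map_singleton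
      (Multiset.map _ (B.select (D.unfold x)).val), Multiset.map_map]
    simp only [DecTree.setMor, Multiset.map_map]
    rfl
  rw [h₁, ← Finset.add_sum_erase _ _ (Finset.mem_univ ∅)]
  congr 1
  simp only [Finset.sum_range, Fin.is_lt, dif_pos, Fin.eta, vertexSols]
  have h₂ : ∀ t : Fin m, (if t ∈ B.final then properSols B (D.unfold x)
      (fun α => code _ _ (D.pathMor (Path.nil : Path x x) ≫ α.2)) t else 0)
      = ∑ S ∈ (Finset.univ : Finset (Finset (D.unfold x).Leaves)).erase ∅,
        if stateOf B (D.unfold x) S = t then if t ∈ B.final then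
          {valueOf (D.unfold x) (fun α => code _ _ α.2) S} else 0 else 0 := by
    intro t
    have e : D.pathMor (Path.nil : Path x x) = 𝟙 _ := rfl
    simp only [e, Category.id_comp]
    split_ifs
    · rfl
    · simp
  simp only [h₂]
  rw [Finset.sum_comm]
  simp [Finset.sum_ite_eq]

theorem card_le_of_mem_vertexSols {x v : D.V} {ρ : Path v x} {t : ℕ} {a : Multiset ℕ}
    (ha : a ∈ vertexSols B D code x t v ρ) : a.card ≤ 2 ^ D.n := by
  rw [vertexSols] at ha
  split_ifs at ha
  · exact (card_le_of_mem_properSols B _ ha).trans (D.card_leaves_le_two_pow x)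
  · simp at ha

end VertexSols

/-! ### Collecting the solutions with final states. -/

section Root

open Quiver (Path)
open Finset (range)

variable {V : Type} [Quiver.{0} V] {cd : ∀ x y : V, Path x y → ℕ} {op : ℕ → ℕ → ℕ} {N : ℕ}
  {lo : ℕ} {x : V} {Q : St → Prop}

/-- The situation before the solutions with final states are collected. -/
structure RootPre (cd : ∀ x y : V, Path x y → ℕ) (N lo m : ℕ) (S : ℕ → Sem x) (s₀ : St) : Prop where
  lo_pos : 0 < lo
  lo_le : lo ≤ s₀.var .heap
  states : s₀.var .states = m
  row_le : s₀.var .row + 4 + 2 * m ≤ lo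
  fin_le : s₀.var .fin + m ≤ s₀.var .row
  ident : s₀.var .ident = cd x x .nil
  links : ∀ t < m, LinkRep cd s₀.mem lo (s₀.var .heap) (S t) (s₀.var .row + 4 + 2 * t)
  empty : s₀.mem (s₀.var .row + 2) = 0
  room : s₀.var .heap + 7 * m + 7 < 2 ^ N

/-- The solutions whose states are among the first `i` states and are marked as final. -/
def finalSem (F : ℕ → ℕ) (S : ℕ → Sem x) (i : ℕ) : Sem x := fun v ρ =>
  ∑ t ∈ range i, if F t = 0 then 0 else S t v ρ

/-- The situation when the first `i` states have been dealt with. -/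
structure RootInv (cd : ∀ x y : V, Path x y → ℕ) (lo : ℕ) (S : ℕ → Sem x) (s₀ : St) (i : ℕ)
    (s : St) : Prop where
  var : ∀ y : Var, ¬ y.Scratch → y ≠ .i → s.var y = s₀.var y
  i_eq : s.var .i = i
  heap_ge : s₀.var .heap ≤ s.var .heap
  heap_le : s.var .heap ≤ s₀.var .heap + 7 * i
  mem : ∀ b < s₀.var .heap, b ≠ s₀.var .row + 2 → b ≠ s₀.var .row + 3 → s.mem b = s₀.mem b
  link : LinkRep cd s.mem lo (s.var .heap)
    (finalSem (fun t => s₀.mem (s₀.var .fin + t)) S i) (s₀.var .row + 2)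

variable {m : ℕ} {S : ℕ → Sem x} {s₀ s : St} {i : ℕ}

theorem RootInv.step {s' : St} (h : RootInv cd lo S s₀ i s)
    (hv : ∀ y : Var, ¬ y.Scratch → s'.var y = s.var y)
    (hge : s.var .heap ≤ s'.var .heap) (hle : s'.var .heap ≤ s.var .heap + 7)
    (hm : ∀ b < s₀.var .heap, b ≠ s₀.var .row + 2 → b ≠ s₀.var .row + 3 → s'.mem b = s.mem b)
    (hl : LinkRep cd s'.mem lo (s'.var .heap)
      (finalSem (fun t => s₀.mem (s₀.var .fin + t)) S (i + 1)) (s₀.var .row + 2)) :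
    RootInv cd lo S s₀ (i + 1) (s'.set .i (s'.var .i + 1)) where
  var y hy hyi := by
    rw [St.set_var, if_neg hyi, hv y hy, h.var y hy hyi]
  i_eq := by
    rw [St.set_var, if_pos rfl, hv _ (by simp [Var.Scratch]), h.i_eq]
  heap_ge := by
    rw [St.set_var, if_neg (by simp)]
    exact h.heap_ge.trans hge
  heap_le := by
    rw [St.set_var, if_neg (by simp)]
    have := h.heap_le
    omega
  mem b hb h₁ h₂ := (hm b hb h₁ h₂).trans (h.mem b hb h₁ h₂)
  link := by
    rw [St.set_var, if_neg (by simp)]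
    exact hl

/-- Only final states with a nonempty link change the root link; the links of the states themselves
stay, as parents need them. -/
theorem wp_rootStep (hcd : Coding cd op N) (h₀ : RootPre cd N lo m S s₀)
    (h : RootInv cd lo S s₀ i s) (hi : i < m) :
    rootStep.wp op N (RootInv cd lo S s₀ (i + 1)) s := by
  have hroom := h₀.room
  have hlo := h₀.lo_le
  have hlo0 := h₀.lo_pos
  have hge := h.heap_ge
  have hle := h.heap_le
  have hrow := h₀.row_le
  have hfin := h₀.fin_le
  have v₁ := h.var .fin (by simp [Var.Scratch]) (by simp)
  have v₂ := h.var .row (by simp [Var.Scratch]) (by simp)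
  have v₃ := (h.var .ident (by simp [Var.Scratch]) (by simp)).trans h₀.ident
  have m₁ := h.mem (s₀.var .fin + i) (by omega) (by omega) (by omega)
  have m₂ := h.mem (s₀.var .row + 4 + 2 * i) (by omega) (by omega) (by omega)
  have m₃ := h.mem (s₀.var .row + 4 + 2 * i + 1) (by omega) (by omega) (by omega)
  have hsum : ∀ v ρ, finalSem (fun t => s₀.mem (s₀.var .fin + t)) S (i + 1) v ρ
      = finalSem (fun t => s₀.mem (s₀.var .fin + t)) S i v ρ
        + if s₀.mem (s₀.var .fin + i) = 0 then 0 else S i v ρ :=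
    fun v ρ => Finset.sum_range_succ _ _
  have hlink := (h₀.links i hi).congr (mem' := s.mem) hge
    (fun b hb hb' => h.mem b hb' (by omega) (by omega)) m₂ m₃
  have scr : ∀ {y : Var}, ¬ y.Scratch → ∀ z : Var, z.Scratch → y ≠ z :=
    fun hy z hz h => hy (h ▸ hz)
  simp only [rootStep, Cmd.wp, Cond.eval, Ex.eval_mem, Ex.eval_var, Ex.eval_ofNat, Ex.eval_add,
    Ex.eval_mul, Ex.safe_ofNat, Ex.safe_add, Ex.safe_var, Ex.safe_mem, true_and, St.set_var,
    St.set_mem, reduceCtorEq, if_false, if_true, h.i_eq, v₁, v₂, m₁, m₂, m₃]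
  refine ⟨fun h0 => ⟨by omega, ?_⟩, fun h0 => ⟨fun h1 => ⟨by omega, ?_⟩, fun h1 => ⟨by omega, ?_⟩⟩⟩
  · have := h.step (s' := s) (fun _ _ => rfl) le_rfl (by omega) (fun _ _ _ _ => rfl)
      (h.link.ext fun v ρ => by rw [hsum, if_pos h0, add_zero])
    rwa [h.i_eq] at this
  · have := h.step (s' := s.set .tgt (s₀.mem (s₀.var .row + 4 + 2 * i)))
      (fun y hy => by simp [scr hy .tgt trivial]) (by simp) (by simp) (fun _ _ _ _ => rfl)
      (LinkRep.ext (by simpa using h.link) fun v ρ => by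
        obtain ⟨-, hS⟩ | ⟨g, hg, -, -⟩ := h₀.links i hi
        · rw [hsum, if_neg h0, hS, add_zero]
        · have := hg.le; omega)
    simpa [h.i_eq] using this
  · obtain ⟨h2, -⟩ | ⟨g, hg, hgc, hS⟩ := hlink
    · exact (h1 (m₂.symm.trans h2)).elim
    rw [m₂] at hg
    rw [m₃] at hgc
    refine wp_addLink hcd hlo0 (S := finalSem (fun t => s₀.mem (s₀.var .fin + t)) S i) (g := g)
      ?_ ?_ ?_ ?_ ?_ ?_ fun s₃ l₃ g₃ k₃ m₃ w₃ _ => ⟨?_, ?_⟩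
    · simpa using h.link
    · simpa using hg
    · simpa using hgc
    · simp; omega
    · simpa using v₃
    · simp; omega
    · rw [w₃ .i (by simp [Var.Scratch])]
      simp [h.i_eq]
      omega
    · simp only [St.set_var, St.set_mem, reduceCtorEq, if_false, if_true] at l₃ g₃ k₃ m₃ w₃
      refine h.step (fun y hy => ?_) g₃ k₃
        (fun b hb h₁ h₂ => m₃ b (by omega) h₁ h₂) (l₃.ext fun v ρ => ?_)
      · rw [w₃ y hy]
        simp [scr hy .tgt trivial, scr hy .mor trivial, scr hy .cell trivial]
      · rw [hsum, if_neg h0, hS]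

/-- A bound for the time needed to collect the solutions with final states. -/
def rootTime (m : ℕ) : ℕ :=
  (Cmd.assign .i 0).cost + (m * ((Cond.lt (.var .i) (.var .states)).len + rootStep.cost + 1) +
    ((Cond.lt (.var .i) (.var .states)).len + 1))

theorem tri_rootLoop (hcd : Coding cd op N) (hN₂ : 2 ≤ N) (h₀ : RootPre cd N lo m S s₀) :
    Tri op N rootLoop s₀ (rootTime m) (RootInv cd lo S s₀ m) := by
  refine Tri.seq (Tri.of_wp hN₂ ?_)
  refine ⟨by simp, ?_⟩
  have hst : ∀ {i s}, RootInv cd lo S s₀ i s → s.var .states = m := fun h =>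
    (h.var .states (by simp [Var.Scratch]) (by simp)).trans h₀.states
  refine Tri.loop (fun k s => ∃ i, i + k = m ∧ RootInv cd lo S s₀ i s) ?_ ?_ (k := m)
    ⟨0, by simp, ?_⟩
  · rintro k s ⟨i, hi, hs⟩ hc
    simp only [Cond.eval, Ex.eval_var, hs.i_eq, hst hs] at hc
    exact (Tri.of_wp hN₂ (wp_rootStep hcd h₀ hs hc)).mono le_rfl
      fun s' h' => ⟨k - 1, by omega, i + 1, by omega, h'⟩
  · rintro k s ⟨i, hi, hs⟩ hc
    simp only [Cond.eval, Ex.eval_var, hs.i_eq, hst hs] at hc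
    obtain rfl : i = m := by omega
    exact hs
  · refine ⟨fun y hy hyi => by simp [hyi], by simp, by simp, by simp, fun b hb _ _ => rfl, ?_⟩
    exact (LinkRep.zero h₀.empty).ext fun v ρ => by simp [finalSem]

end Root

/-! ### The input in memory -/

theorem length_flatMap_finRange {n c : ℕ} (g : Fin n → List ℕ) (hg : ∀ x, (g x).length = c) :
    ((List.finRange n).flatMap g).length = n * c := by
  simp [List.length_flatMap, hg]

theorem getD_flatMap_finRange {n c : ℕ} (g : Fin n → List ℕ) (hg : ∀ x, (g x).length = c)
    (x : Fin n) {k : ℕ} (hk : k < c) :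
    ((List.finRange n).flatMap g).getD (x * c + k) 0 = (g x).getD k 0 := by
  induction n with
  | zero => exact x.elim0
  | succ n ih =>
    rw [List.finRange_succ, List.flatMap_cons, List.flatMap_map]
    refine Fin.cases ?_ (fun x => ?_) x
    · rw [List.getD_append _ _ _ _ (by simp [hg, hk])]
      simp
    · have h := ih (fun y => g y.succ) (fun y => hg _) x
      rw [List.getD_append_right _ _ _ _ (by rw [hg, Fin.val_succ, add_mul]; omega), hg, ← h]
      congr 1
      rw [Fin.val_succ, add_mul]
      omega

/-! ### Addresses of the parts of the memory. -/

section Layout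

variable (n m s₀ s₂ : ℕ)

/-- The address of the table of `δ₀`. -/
def leafAddr : ℕ := 4 + 7 * n

/-- The address of the table of `δ₂`. -/
def nodeAddr : ℕ := leafAddr n + 2 * s₀

/-- The address of the table of final states. -/
def finAddr : ℕ := nodeAddr n s₀ + s₂ * m * m

/-- The end of the input, and the address of the rows of the data structure. -/
def tableAddr : ℕ := finAddr n m s₀ s₂ + m

/-- The row of the vertex with number `x`. -/
def rowAddr (x : ℕ) : ℕ := tableAddr n m s₀ s₂ + x * (2 * m + 4)

/-- The address of the stack of the depth-first search. -/
def stackAddr : ℕ := tableAddr n m s₀ s₂ + n * (2 * m + 4)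

/-- The address of the trees. -/
def heapAddr : ℕ := stackAddr n m s₀ s₂ + n + 1

end Layout

section Input

open Quiver (Path)

variable {C : Type u} [Category.{v} C] {m s₀ s₂ : ℕ}
  (B : DBUTA (Fin m) (Fin s₀ × Bool) (Fin s₂)) (D : DecDAG C (Fin s₀) (Fin s₂))
  (code : ∀ x y : C, (x ⟶ y) → ℕ)

theorem vertexRecord_leaf {x : D.V} {a : Fin s₀} (h : D.node x = Sum.inl a) :
    vertexRecord D code x = [0, a.val, 0, 0, pathCode D code x x .nil, 0, 0] := by
  rw [vertexRecord]
  split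
  · rename_i a' h'
    rw [h] at h'
    cases h'
    rfl
  · rename_i h'
    rw [h] at h'
    cases h'

theorem vertexRecord_node {x l r : D.V} {f : Fin s₂} (h : D.node x = Sum.inr (f, l, r)) :
    vertexRecord D code x = [1, f.val, l.val, r.val, pathCode D code x x .nil,
      pathCode D code x l (D.leftEdge h).toPath, pathCode D code x r (D.rightEdge h).toPath] := by
  simp only [vertexRecord, pathCode, D.pathMor_toPath]
  split
  · rename_i h'
    rw [h] at h'
    cases h'
  · rename_i f' l' r' h'
    obtain ⟨rfl, rfl, rfl⟩ : f = f' ∧ l = l' ∧ r = r' := by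
      rw [h] at h'
      cases h'
      exact ⟨rfl, rfl, rfl⟩
    rfl

theorem length_vertexRecord (x : D.V) : (vertexRecord D code x).length = 7 := by
  match h : D.node x with
  | .inl a => rw [vertexRecord_leaf D code h]; rfl
  | .inr (f, l, r) => rw [vertexRecord_node D code h]; rfl

/-- The memory contains the input. -/
structure InputMem (mem : ℕ → ℕ) : Prop where
  cnt : mem 0 = D.n
  states : mem 1 = m
  leaves : mem 2 = s₀
  nodes : mem 3 = s₂
  record : ∀ (x : Fin D.n), ∀ k < 7, mem (4 + 7 * x.val + k) = (vertexRecord D code x).getD k 0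
  leaf : ∀ (a : Fin s₀) (b : Bool), mem (leafAddr D.n + 2 * a + b.toNat) = (B.δ₀ (a, b)).val
  node : ∀ (f : Fin s₂) (p q : Fin m),
    mem (nodeAddr D.n s₀ + ((f * m + p) * m + q)) = (B.δ₂ p q f).val
  final : ∀ q : Fin m, mem (finAddr D.n m s₀ s₂ + q) = if q ∈ B.final then 1 else 0
  zero : ∀ a, tableAddr D.n m s₀ s₂ ≤ a → mem a = 0

theorem inputMem : InputMem B D code fun a => (encodeInput B D code).getD a 0 := by
  set L₁ := (List.finRange D.n).flatMap fun x => vertexRecord D code x with hL₁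
  set L₂ := (List.finRange s₀).flatMap fun a => [(B.δ₀ (a, false)).val, (B.δ₀ (a, true)).val] with hL₂
  set G : Fin s₂ → List ℕ := fun f => (List.finRange m).flatMap fun p =>
    (List.finRange m).map fun q => (B.δ₂ p q f).val with hG
  set L₃ := (List.finRange s₂).flatMap G with hL₃
  set L₄ := (List.finRange m).map fun q => if q ∈ B.final then 1 else 0 with hL₄
  have hG' : ∀ f, (G f).length = m * m := fun f => length_flatMap_finRange _ (by simp)
  have e : encodeInput B D code = [D.n, m, s₀, s₂] ++ (L₁ ++ (L₂ ++ (L₃ ++ L₄))) := by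
    simp [encodeInput, automatonTables, hL₁, hL₂, hL₃, hL₄, hG]
  have l₀ : [D.n, m, s₀, s₂].length = 4 := rfl
  have l₁ : L₁.length = D.n * 7 := length_flatMap_finRange _ (length_vertexRecord D code)
  have l₂ : L₂.length = s₀ * 2 := length_flatMap_finRange _ (by simp)
  have l₃ : L₃.length = s₂ * (m * m) := length_flatMap_finRange _ hG'
  have l₄ : L₄.length = m := by simp [hL₄]
  -- Each of the following equations strips one more block from the front of the input.
  have g₁ : ∀ k, (encodeInput B D code).getD (4 + k) 0 = (L₁ ++ (L₂ ++ (L₃ ++ L₄))).getD k 0 := by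
    intro k
    rw [e, List.getD_append_right _ _ _ _ (by rw [l₀]; omega), l₀, Nat.add_sub_cancel_left]
  have g₂ : ∀ k, (encodeInput B D code).getD (leafAddr D.n + k) 0
      = (L₂ ++ (L₃ ++ L₄)).getD k 0 := by
    intro k
    rw [leafAddr, add_assoc, g₁, List.getD_append_right _ _ _ _ (by omega), l₁]
    congr 1
    omega
  have g₃ : ∀ k, (encodeInput B D code).getD (nodeAddr D.n s₀ + k) 0 = (L₃ ++ L₄).getD k 0 := by
    intro k
    rw [nodeAddr, add_assoc, g₂, List.getD_append_right _ _ _ _ (by omega), l₂]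
    congr 1
    omega
  have g₄ : ∀ k, (encodeInput B D code).getD (finAddr D.n m s₀ s₂ + k) 0 = L₄.getD k 0 := by
    intro k
    rw [finAddr, mul_assoc, add_assoc, g₃, List.getD_append_right _ _ _ _ (by omega), l₃,
      Nat.add_sub_cancel_left]
  refine ⟨by rw [e]; rfl, by rw [e]; rfl, by rw [e]; rfl, by rw [e]; rfl, fun x k hk => ?_,
    fun a b => ?_, fun f p q => ?_, fun q => ?_, fun a ha => ?_⟩
  · have := x.2
    rw [add_assoc, g₁, List.getD_append _ _ _ _ (by omega), mul_comm]
    exact getD_flatMap_finRange _ (length_vertexRecord D code) x hk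
  · have := a.2
    have hb : b.toNat < 2 := by cases b <;> simp
    rw [add_assoc, g₂, List.getD_append _ _ _ _ (by omega), mul_comm]
    rw [hL₂, getD_flatMap_finRange _ (by simp) a hb]
    cases b <;> rfl
  · have h₁ : (p : ℕ) * m + q < m * m := by
      have := p.2; have := q.2; nlinarith
    have h₂ : (f : ℕ) * (m * m) + ((p : ℕ) * m + q) < s₂ * (m * m) := by
      have := Nat.mul_le_mul_right (m * m) (show (f : ℕ) + 1 ≤ s₂ from f.2)
      rw [add_mul] at this
      omega
    -- The table is a two-level concatenation, and the index is regrouped accordingly.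
    have h₃ : ((f : ℕ) * m + p) * m + q = f * (m * m) + (p * m + q) := by ring
    rw [h₃, g₃, List.getD_append _ _ _ _ (by omega), hL₃, getD_flatMap_finRange _ hG' f h₁, hG,
      getD_flatMap_finRange _ (by simp) p q.2]
    simp [List.getD_eq_getElem?_getD]
  · rw [g₄]
    simp [hL₄, List.getD_eq_getElem?_getD]
  · obtain ⟨k, rfl⟩ := Nat.exists_eq_add_of_le ha
    rw [tableAddr, add_assoc, g₄, List.getD_eq_default _ _ (by omega)]

theorem encodeInput_lt {op : ℕ → ℕ → ℕ} {w N : ℕ} (h : RegisterAssumption D code op w)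
    (hm : m ≤ 2 ^ w) (h₀ : s₀ ≤ 2 ^ w) (h₂ : s₂ ≤ 2 ^ w) (hN : w < N) (a : ℕ) :
    (encodeInput B D code).getD a 0 < 2 ^ N := by
  have hw : 2 ^ w < 2 ^ N := Nat.pow_lt_pow_right (by norm_num) hN
  have hn := h.vertex_fits
  have key : ∀ b ∈ encodeInput B D code, b < 2 ^ N := by
    intro b hb
    have h1 : 1 ≤ 2 ^ w := Nat.one_le_two_pow
    simp only [encodeInput, automatonTables, List.mem_append, List.mem_flatMap, List.mem_cons,
      List.mem_map, List.mem_finRange, true_and, List.not_mem_nil, or_false] at hb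
    rcases hb with ((rfl | rfl | rfl | rfl) | hx) | (⟨a, rfl | rfl⟩ | ⟨f, p, q, rfl⟩) | ⟨q, rfl⟩
    · omega
    · omega
    · omega
    · omega
    · obtain ⟨x, -, hx⟩ := List.mem_flatMap.1 hx
      have hc : ∀ {x y : D.V} (π : Path x y), pathCode D code x y π < 2 ^ N :=
        (h.coding hN.le).lt
      match hn : D.node x with
      | .inl a =>
        have := a.2
        rw [vertexRecord_leaf D code hn] at hx
        simp only [List.mem_cons, List.not_mem_nil, or_false] at hx
        rcases hx with rfl | rfl | rfl | rfl | rfl | rfl | rfl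
        all_goals first | exact hc _ | omega
      | .inr (f, l, r) =>
        have := f.2
        have := l.2
        have := r.2
        rw [vertexRecord_node D code hn] at hx
        simp only [List.mem_cons, List.not_mem_nil, or_false] at hx
        rcases hx with rfl | rfl | rfl | rfl | rfl | rfl | rfl
        all_goals first | exact hc _ | omega
    · have := (B.δ₀ (a, false)).2; omega
    · have := (B.δ₀ (a, true)).2; omega
    · have := (B.δ₂ p q f).2; omega
    · split_ifs <;> omega
  rcases lt_or_ge a (encodeInput B D code).length with ha | ha
  · rw [List.getD_eq_getElem _ _ ha]
    exact key _ (List.getElem_mem ha)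
  · rw [List.getD_eq_default _ _ ha]
    exact Nat.two_pow_pos _

end Input

/-! ### Correctness of the preprocessing -/

section Layout

variable {n m s₀ s₂ : ℕ}

theorem rowAddr_add_le {x y : ℕ} (h : x < y) :
    rowAddr n m s₀ s₂ x + (2 * m + 4) ≤ rowAddr n m s₀ s₂ y := by
  have := Nat.mul_le_mul_right (2 * m + 4) (show x + 1 ≤ y from h)
  rw [add_mul, one_mul] at this
  simp only [rowAddr]
  omega

theorem rowAddr_add_le_stackAddr {x : ℕ} (h : x < n) :
    rowAddr n m s₀ s₂ x + (2 * m + 4) ≤ stackAddr n m s₀ s₂ :=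
  rowAddr_add_le h

theorem rowAddr_disj {x y : ℕ} (h : x ≠ y) :
    rowAddr n m s₀ s₂ x + (2 * m + 4) ≤ rowAddr n m s₀ s₂ y ∨
      rowAddr n m s₀ s₂ y + (2 * m + 4) ≤ rowAddr n m s₀ s₂ x :=
  (Nat.lt_or_gt_of_ne h).imp rowAddr_add_le rowAddr_add_le

theorem nodeAddr_add_lt {f p q : ℕ} (hf : f < s₂) (hp : p < m) (hq : q < m) :
    nodeAddr n s₀ + ((f * m + p) * m + q) < finAddr n m s₀ s₂ := by
  have h₁ : p * m + q < m * m := by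
    have := Nat.mul_le_mul_right m (show p + 1 ≤ m from hp)
    rw [add_mul] at this
    omega
  have h₂ := Nat.mul_le_mul_right (m * m) (show f + 1 ≤ s₂ from hf)
  have h₃ : (f * m + p) * m + q = f * (m * m) + (p * m + q) := by ring
  rw [add_mul] at h₂
  rw [finAddr, h₃, mul_assoc]
  omega

theorem tableAddr_le_rowAddr (x : ℕ) : tableAddr n m s₀ s₂ ≤ rowAddr n m s₀ s₂ x :=
  Nat.le_add_right _ _

end Layout

/-- A bound for the memory needed for the trees of one vertex. -/
def growth (m : ℕ) : ℕ := 14 * ((m + 1) * (m + 1)) + 7 + 7 * m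

/-- The variables that are not changed when the trees of a vertex are constructed. -/
def Var.Kept : Var → Prop
  | .cnt | .states | .tabLeaf | .tabNode | .fin | .table | .width | .stack | .vert | .depth
  | .row | .ident => True
  | _ => False

theorem Var.Kept.ne {y z : Var} (hy : y.Kept) (hz : ¬ z.Kept) : y ≠ z := fun h => hz (h ▸ hy)

theorem Var.Kept.not_scratch {y : Var} (hy : y.Kept) : ¬ y.Scratch := by
  cases y <;> simp_all [Var.Kept, Var.Scratch]

/-! ### Invariants of the data structure, and completion of a vertex. -/

section Search

open Quiver (Path)

variable {C : Type u} [Category.{v} C] {m s₀ s₂ : ℕ}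
  (B : DBUTA (Fin m) (Fin s₀ × Bool) (Fin s₂)) (D : DecDAG C (Fin s₀) (Fin s₂))
  (code : ∀ x y : C, (x ⟶ y) → ℕ)

/-- The row of a vertex for which the trees have been constructed. -/
structure RowDone (mem₀ mem : ℕ → ℕ) (hi : ℕ) (x : D.V) : Prop where
  flag : mem (rowAddr D.n m s₀ s₂ x.val) = 1
  empty : mem (rowAddr D.n m s₀ s₂ x.val + 1) = (emptyState B D x).val
  root : LinkRep (pathCode D code) mem (heapAddr D.n m s₀ s₂) hi
    (finalSem (fun t => mem₀ (finAddr D.n m s₀ s₂ + t)) (vertexSols B D code x) m)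
    (rowAddr D.n m s₀ s₂ x.val + 2)
  links : ∀ t < m, LinkRep (pathCode D code) mem (heapAddr D.n m s₀ s₂) hi
    (vertexSols B D code x t) (rowAddr D.n m s₀ s₂ x.val + 4 + 2 * t)

/-- The variables that contain the addresses of the parts of the memory have the right values. -/
structure Globals (m : ℕ) (s : St) : Prop where
  cnt : s.var .cnt = D.n
  states : s.var .states = m
  tabLeaf : s.var .tabLeaf = leafAddr D.n
  tabNode : s.var .tabNode = nodeAddr D.n s₀
  fin : s.var .fin = finAddr D.n m s₀ s₂
  table : s.var .table = tableAddr D.n m s₀ s₂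
  width : s.var .width = 2 * m + 4
  stack : s.var .stack = stackAddr D.n m s₀ s₂

variable {D} in
theorem Globals.congr {s s' : St} (h : Globals D m s) (hv : ∀ y : Var, y.Kept → y ≠ .vert →
    y ≠ .depth → y ≠ .row → y ≠ .ident → s'.var y = s.var y) : Globals D m s' where
  cnt := (hv .cnt trivial (by simp) (by simp) (by simp) (by simp)).trans h.cnt
  states := (hv .states trivial (by simp) (by simp) (by simp) (by simp)).trans h.states
  tabLeaf := (hv .tabLeaf trivial (by simp) (by simp) (by simp) (by simp)).trans h.tabLeaf
  tabNode := (hv .tabNode trivial (by simp) (by simp) (by simp) (by simp)).trans h.tabNode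
  fin := (hv .fin trivial (by simp) (by simp) (by simp) (by simp)).trans h.fin
  table := (hv .table trivial (by simp) (by simp) (by simp) (by simp)).trans h.table
  width := (hv .width trivial (by simp) (by simp) (by simp) (by simp)).trans h.width
  stack := (hv .stack trivial (by simp) (by simp) (by simp) (by simp)).trans h.stack

/-- The invariant of the depth-first search for the data structure. -/
structure DataInv (mem₀ : ℕ → ℕ) (done : Finset (Fin D.n)) (s : St) : Prop extends Globals D m s where
  input : ∀ b < tableAddr D.n m s₀ s₂, s.mem b = mem₀ b
  heap_ge : heapAddr D.n m s₀ s₂ ≤ s.var .heap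
  heap_le : s.var .heap ≤ heapAddr D.n m s₀ s₂ + growth m * done.card
  rows : ∀ x : D.V, x ∈ done → RowDone B D code mem₀ s.mem (s.var .heap) x
  fresh : ∀ x : D.V, x ∉ done → ∀ k < 2 * m + 4, s.mem (rowAddr D.n m s₀ s₂ x.val + k) = 0

/-- The situation when the trees for the states of the vertex `x` have been constructed. -/
structure Filled (x : D.V) (s₁ s : St) : Prop where
  var : ∀ y : Var, y.Kept → s.var y = s₁.var y
  heap_ge : s₁.var .heap ≤ s.var .heap
  heap_le : s.var .heap ≤ s₁.var .heap + (14 * ((m + 1) * (m + 1)) + 7)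
  mem : ∀ b < s₁.var .heap, (b < rowAddr D.n m s₀ s₂ x.val ∨
    rowAddr D.n m s₀ s₂ x.val + (2 * m + 4) ≤ b) → s.mem b = s₁.mem b
  empty : s.mem (rowAddr D.n m s₀ s₂ x.val + 1) = (emptyState B D x).val
  root : s.mem (rowAddr D.n m s₀ s₂ x.val + 2) = 0
  links : ∀ t < m, LinkRep (pathCode D code) s.mem (heapAddr D.n m s₀ s₂) (s.var .heap)
    (vertexSols B D code x t) (rowAddr D.n m s₀ s₂ x.val + 4 + 2 * t)

/-- The situation when the vertex `x` has been dealt with. -/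
structure Finished (mem₀ : ℕ → ℕ) (done : Finset (Fin D.n)) (x : D.V) (s₁ s : St) : Prop where
  data : DataInv B D code mem₀ (insert x done) s
  vert : s.var .vert = s₁.var .vert
  depth : s.var .depth = s₁.var .depth - 1
  stack : ∀ k ≤ D.n, s.mem (stackAddr D.n m s₀ s₂ + k) = s₁.mem (stackAddr D.n m s₀ s₂ + k)

variable {B D code} {op : ℕ → ℕ → ℕ} {N : ℕ} {mem₀ : ℕ → ℕ} {done : Finset (Fin D.n)} {s s₁ : St}
  {x : D.V}

theorem RowDone.congr {mem mem' : ℕ → ℕ} {hi hi' : ℕ} (h : RowDone B D code mem₀ mem hi x)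
    (hh : hi ≤ hi')
    (h₁ : ∀ k < 2 * m + 4, mem' (rowAddr D.n m s₀ s₂ x.val + k) = mem (rowAddr D.n m s₀ s₂ x.val + k))
    (h₂ : ∀ b, heapAddr D.n m s₀ s₂ ≤ b → b < hi → mem' b = mem b) :
    RowDone B D code mem₀ mem' hi' x where
  flag := (h₁ 0 (by omega)).trans h.flag
  empty := (h₁ 1 (by omega)).trans h.empty
  root := h.root.congr hh h₂ (h₁ 2 (by omega)) (h₁ 3 (by omega))
  links t ht := by
    refine (h.links t ht).congr hh h₂ ?_ ?_
    · have := h₁ (4 + 2 * t) (by omega)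
      rwa [← add_assoc] at this
    · have := h₁ (4 + 2 * t + 1) (by omega)
      rwa [← add_assoc, ← add_assoc] at this

theorem DataInv.mem_done (h : DataInv B D code mem₀ done s)
    (hx : s.mem (rowAddr D.n m s₀ s₂ x.val) ≠ 0) : x ∈ done := by
  by_contra hx'
  exact hx (h.fresh x hx' 0 (by omega))

/-- A bound for the time needed to finish the treatment of a vertex. -/
def finishTime (m : ℕ) : ℕ :=
  rootTime m + leave.cost

-- Only the row of `x` and fresh heap cells have changed, so all other rows keep their meaning. The
-- depth decreases by truncated subtraction: it stays 0 when the start vertex itself is completed.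
set_option maxHeartbeats 1000000 in
theorem tri_finish (hcd : Coding (pathCode D code) op N) (hN₂ : 2 ≤ N)
    (hroom : heapAddr D.n m s₀ s₂ + growth m * D.n + growth m + 14 < 2 ^ N)
    (h : DataInv B D code mem₀ done s₁) (hx : x ∉ done)
    (hrow : s₁.var .row = rowAddr D.n m s₀ s₂ x.val)
    (hid : s₁.var .ident = pathCode D code x x .nil) (hd : s₁.var .depth ≤ D.n)
    (hf : Filled B D code x s₁ s) :
    Tri op N finish s (finishTime m) (Finished B D code mem₀ done x s₁) := by
  have hcard : done.card ≤ D.n := (Finset.card_le_univ _).trans_eq (Fintype.card_fin _)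
  have hgc := Nat.mul_le_mul_left (growth m) hcard
  have hle₁ := h.heap_le
  have hge₁ := h.heap_ge
  have hle := hf.heap_le
  have hge := hf.heap_ge
  have hxs : rowAddr D.n m s₀ s₂ x.val + (2 * m + 4) ≤ stackAddr D.n m s₀ s₂ :=
    rowAddr_add_le_stackAddr x.2
  have htr : tableAddr D.n m s₀ s₂ ≤ rowAddr D.n m s₀ s₂ x.val := tableAddr_le_rowAddr _
  have hheap : heapAddr D.n m s₀ s₂ = stackAddr D.n m s₀ s₂ + D.n + 1 := rfl
  have htab : tableAddr D.n m s₀ s₂ = finAddr D.n m s₀ s₂ + m := rfl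
  have hgr : growth m = 14 * ((m + 1) * (m + 1)) + 7 + 7 * m := rfl
  have v₁ := (hf.var .row trivial).trans hrow
  have v₂ := (hf.var .fin trivial).trans h.fin
  have v₃ := (hf.var .states trivial).trans h.states
  have hpre : RootPre (pathCode D code) N (heapAddr D.n m s₀ s₂) m (vertexSols B D code x) s := by
    refine ⟨by omega, by omega, v₃, by omega, by omega, (hf.var .ident trivial).trans hid, ?_, ?_,
      by omega⟩
    · rw [v₁]; exact hf.links
    · rw [v₁]; exact hf.root
  refine Tri.seq ((tri_rootLoop hcd hN₂ hpre).mono le_rfl fun s₂' hr => Tri.of_wp hN₂ ?_)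
  have hv : ∀ y : Var, y.Kept → s₂'.var y = s₁.var y := fun y hy =>
    (hr.var y hy.not_scratch (hy.ne (by simp [Var.Kept]))).trans (hf.var y hy)
  have hle₂ := hr.heap_le
  have hge₂ := hr.heap_ge
  have hmr := hr.mem
  have hlr := hr.link
  rw [v₁] at hmr hlr
  rw [v₂] at hlr
  have hout : ∀ b < s₁.var .heap, (b < rowAddr D.n m s₀ s₂ x.val ∨
      rowAddr D.n m s₀ s₂ x.val + (2 * m + 4) ≤ b) → s₂'.mem b = s₁.mem b := fun b hb hb' =>
    (hmr b (by omega) (by omega) (by omega)).trans (hf.mem b hb hb')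
  have hrow₂ := (hv .row trivial).trans hrow
  simp only [leave, Cmd.wp, Ex.eval_var, Ex.eval_sub, Ex.eval_ofNat, Ex.safe_ofNat, Ex.safe_sub,
    St.put_var, hrow₂, hv .depth trivial]
  refine ⟨by norm_num, by omega, ?_⟩
  set s₃ : St := (s₂'.put (rowAddr D.n m s₀ s₂ x.val) 1).set .depth (s₁.var .depth - 1) with hs₃
  have hv₃ : ∀ y : Var, y.Kept → y ≠ .depth → s₃.var y = s₁.var y := fun y hy hyd => by
    simp only [hs₃, St.set_var, if_neg hyd, St.put_var, hv y hy]
  have hh₃ : s₃.var .heap = s₂'.var .heap := by simp [hs₃]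
  have hm₃ : ∀ b, b ≠ rowAddr D.n m s₀ s₂ x.val → s₃.mem b = s₂'.mem b := fun b hb => by
    simp [hs₃, Function.update_apply, hb]
  have hout₃ : ∀ b < s₁.var .heap, (b < rowAddr D.n m s₀ s₂ x.val ∨
      rowAddr D.n m s₀ s₂ x.val + (2 * m + 4) ≤ b) → s₃.mem b = s₁.mem b := fun b hb hb' =>
    (hm₃ b (by omega)).trans (hout b hb hb')
  -- The invariant refers to the original input; the final-state table read now is still the same.
  have hfin : finalSem (fun t => s.mem (finAddr D.n m s₀ s₂ + t)) (vertexSols B D code x) m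
      = finalSem (fun t => mem₀ (finAddr D.n m s₀ s₂ + t)) (vertexSols B D code x) m := by
    funext v ρ
    refine Finset.sum_congr rfl fun t ht => ?_
    have := Finset.mem_range.1 ht
    simp only [hf.mem (finAddr D.n m s₀ s₂ + t) (by omega) (by omega),
      h.input (finAddr D.n m s₀ s₂ + t) (by omega)]
  have hother : ∀ y : D.V, y ≠ x → ∀ k < 2 * m + 4,
      s₃.mem (rowAddr D.n m s₀ s₂ y.val + k) = s₁.mem (rowAddr D.n m s₀ s₂ y.val + k) := by
    intro y hy k hk
    have h₁ := rowAddr_disj (n := D.n) (m := m) (s₀ := s₀) (s₂ := s₂) (x := y.val) (y := x.val)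
      fun e => hy (Fin.ext e)
    have h₂ : rowAddr D.n m s₀ s₂ y.val + (2 * m + 4) ≤ stackAddr D.n m s₀ s₂ :=
      rowAddr_add_le_stackAddr y.2
    exact hout₃ _ (by omega) (by omega)
  refine ⟨?_, hv₃ .vert trivial (by simp), by simp [hs₃], fun k hk => hout₃ _ (by omega) (by omega)⟩
  refine ⟨h.toGlobals.congr fun y hy _ hd _ _ => hv₃ y hy hd,
    fun b hb => (hout₃ b (by omega) (by omega)).trans (h.input b hb), by omega, ?_, ?_, ?_⟩
  · have hc : (insert x done).card = done.card + 1 := Finset.card_insert_of_notMem hx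
    have : growth m * (insert x done).card = growth m * done.card + growth m := by
      rw [hc, mul_add, mul_one]
    omega
  · intro y hy
    by_cases e : y = x
    · subst e
      refine ⟨by simp [hs₃], ?_, ?_, fun t ht => ?_⟩
      · rw [hm₃ _ (by omega), hmr _ (by omega) (by omega) (by omega), hf.empty]
      · rw [← hfin]
        exact hlr.congr hh₃.ge (fun b hb _ => hm₃ b (by omega)) (hm₃ _ (by omega)) (hm₃ _ (by omega))
      · refine (hf.links t ht).congr (by omega) (fun b hb hb' => ?_) ?_ ?_ <;>
          rw [hm₃ _ (by omega), hmr _ (by omega) (by omega) (by omega)]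
    · have hy' : y ∈ done := (Finset.mem_insert (α := Fin D.n).1 hy).resolve_left e
      exact (h.rows y hy').congr (by omega) (hother y e) fun b hb hb' => hout₃ b hb' (by omega)
  · intro y hy k hk
    have hy' := fun h => hy (Finset.mem_insert (α := Fin D.n).2 h)
    rw [hother y (fun e => hy' (.inl e)) k hk]
    exact h.fresh y (fun e => hy' (.inr e)) k hk

end Search

/-! ### The trees of a leaf and of an inner vertex. -/

section Vertices

open Quiver (Path)

variable {C : Type u} [Category.{v} C] {m s₀ s₂ : ℕ}
  {B : DBUTA (Fin m) (Fin s₀ × Bool) (Fin s₂)} {D : DecDAG C (Fin s₀) (Fin s₂)}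
  {code : ∀ x y : C, (x ⟶ y) → ℕ}
  {op : ℕ → ℕ → ℕ} {N : ℕ} {mem₀ : ℕ → ℕ} {done : Finset (Fin D.n)} {s : St} {x : D.V}

-- A leaf has a single nonempty selection, so exactly one link gets a tree; the others are still
-- zero because the row is fresh.
set_option maxHeartbeats 1000000 in
theorem wp_leafTrees (hin : InputMem B D code mem₀)
    (hroom : heapAddr D.n m s₀ s₂ + growth m * D.n + growth m + 14 < 2 ^ N)
    (h : DataInv B D code mem₀ done s) (hx : x ∉ done)
    (hrow : s.var .row = rowAddr D.n m s₀ s₂ x.val)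
    (hid : s.var .ident = pathCode D code x x .nil) {a : Fin s₀} (ha : D.node x = Sum.inl a)
    (hl : s.var .label = a.val) :
    leafTrees.wp op N (Filled B D code x s) s := by
  have hcard : done.card ≤ D.n := (Finset.card_le_univ _).trans_eq (Fintype.card_fin _)
  have hgc := Nat.mul_le_mul_left (growth m) hcard
  have hle := h.heap_le
  have hge := h.heap_ge
  have hxs : rowAddr D.n m s₀ s₂ x.val + (2 * m + 4) ≤ stackAddr D.n m s₀ s₂ :=
    rowAddr_add_le_stackAddr x.2
  have htr : tableAddr D.n m s₀ s₂ ≤ rowAddr D.n m s₀ s₂ x.val := tableAddr_le_rowAddr _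
  have hheap : heapAddr D.n m s₀ s₂ = stackAddr D.n m s₀ s₂ + D.n + 1 := rfl
  have htab : tableAddr D.n m s₀ s₂ = nodeAddr D.n s₀ + s₂ * m * m + m := rfl
  have hnode : nodeAddr D.n s₀ = leafAddr D.n + 2 * s₀ := rfl
  have hgr : growth m = 14 * ((m + 1) * (m + 1)) + 7 + 7 * m := rfl
  have ha2 := a.2
  have m₀ : s.mem (leafAddr D.n + 2 * a.val) = (B.δ₀ (a, false)).val := by
    rw [h.input _ (by omega)]
    exact hin.leaf a false
  have m₁ : s.mem (leafAddr D.n + 2 * a.val + 1) = (B.δ₀ (a, true)).val := by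
    rw [h.input _ (by omega)]
    exact hin.leaf a true
  have hq := (B.δ₀ (a, true)).2
  have m₂ : ∀ k, (s.put (rowAddr D.n m s₀ s₂ x.val + 1) k).mem (leafAddr D.n + 2 * a.val + 1)
      = (B.δ₀ (a, true)).val := fun k => by
    rw [← m₁, St.put_mem, Function.update_apply, if_neg (by omega)]
  simp only [leafTrees, Cmd.wp, Ex.eval_mem, Ex.eval_var, Ex.eval_ofNat, Ex.eval_add,
    Ex.eval_mul, Ex.safe_ofNat, Ex.safe_add, Ex.safe_var, Ex.safe_mem, true_and, St.set_var,
    St.put_var, reduceCtorEq, if_false, if_true, hrow, hid, hl, h.tabLeaf, m₀, m₂]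
  refine ⟨by norm_num, by omega, by omega, ?_⟩
  set q := (B.δ₀ (a, true)).val with hqd
  set R := rowAddr D.n m s₀ s₂ x.val with hR
  set H := s.var .heap with hH
  generalize hs' : St.set _ _ _ = s'
  have hmem : ∀ b, s'.mem b = if b = R + 4 + 2 * q + 1 then pathCode D code x x .nil else
      if b = R + 4 + 2 * q then H else if b = H then 0 else
      if b = R + 1 then (B.δ₀ (a, false)).val else s.mem b := by
    intro b
    simp [← hs', Function.update_apply]
  have hH' : s'.var .heap = H + 7 := by simp [← hs']
  refine ⟨fun y hy => ?_, by omega, by omega, fun b hb hb' => ?_, ?_, ?_, fun t ht => ?_⟩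
  · have e : ∀ z : Var, ¬ z.Kept → y ≠ z := fun z hz => hy.ne hz
    simp [← hs', e .heap (by simp [Var.Kept]), e .cell (by simp [Var.Kept]),
      e .q (by simp [Var.Kept])]
  · rw [hmem]
    repeat rw [if_neg (by omega)]
  · rw [hmem]
    repeat rw [if_neg (by omega)]
    rw [if_pos rfl, emptyState_leaf B D ha]
  · rw [hmem]
    repeat rw [if_neg (by omega)]
    exact h.fresh x hx 2 (by omega)
  · by_cases e : q = t
    · refine .inr ⟨⟨x, .nil, .leaf x⟩, ?_, ?_, fun v ρ => ?_⟩
      · have e₁ : s'.mem (R + 4 + 2 * t) = H := by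
          rw [hmem, if_neg (by omega), if_pos (by omega)]
        have e₂ : s'.mem H = 0 := by
          rw [hmem, if_neg (by omega), if_neg (by omega), if_pos rfl]
        rw [e₁]
        exact ⟨hge, hH'.ge, e₂⟩
      · rw [hmem, if_pos (by omega)]
      · rw [vertexSols_leaf B D code ha ht, if_pos e]
        rfl
    · refine .inl ⟨?_, fun v ρ => ?_⟩
      · rw [hmem]
        repeat rw [if_neg (by omega)]
        have := h.fresh x hx (4 + 2 * t) (by omega)
        rwa [← add_assoc] at this
      · rw [vertexSols_leaf B D code ha ht, if_neg e]

/-- A bound for the time needed for the trees of an inner vertex. -/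
def nodeTime (m : ℕ) : ℕ :=
  nodeInit.cost + pairTime m

-- Both children are done, so their rows supply what the pair loop needs, and `vertexSols_node`
-- identifies the accumulated sum over all pairs with the solutions of `x`.
set_option maxHeartbeats 1000000 in
theorem tri_nodeTrees (hcd : Coding (pathCode D code) op N) (hN₂ : 2 ≤ N)
    (hin : InputMem B D code mem₀)
    (hroom : heapAddr D.n m s₀ s₂ + growth m * D.n + growth m + 14 < 2 ^ N)
    (h : DataInv B D code mem₀ done s) (hx : x ∉ done)
    (hrow : s.var .row = rowAddr D.n m s₀ s₂ x.val) (hrec : s.var .record = 4 + 7 * x.val)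
    (hid : s.var .ident = pathCode D code x x .nil) {f : Fin s₂} {l r : D.V}
    (hx' : D.node x = Sum.inr (f, l, r)) (hlab : s.var .label = f.val)
    (hlr : s.var .lrow = rowAddr D.n m s₀ s₂ l.val) (hrr : s.var .rrow = rowAddr D.n m s₀ s₂ r.val)
    (hl : l ∈ done) (hr : r ∈ done) :
    Tri op N nodeTrees s (nodeTime m) (Filled B D code x s) := by
  have hcard : done.card ≤ D.n := (Finset.card_le_univ _).trans_eq (Fintype.card_fin _)
  have hgc := Nat.mul_le_mul_left (growth m) hcard
  have hle := h.heap_le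
  have hge := h.heap_ge
  have hxs : rowAddr D.n m s₀ s₂ x.val + (2 * m + 4) ≤ stackAddr D.n m s₀ s₂ :=
    rowAddr_add_le_stackAddr x.2
  have hls : rowAddr D.n m s₀ s₂ l.val + (2 * m + 4) ≤ stackAddr D.n m s₀ s₂ :=
    rowAddr_add_le_stackAddr l.2
  have hrs : rowAddr D.n m s₀ s₂ r.val + (2 * m + 4) ≤ stackAddr D.n m s₀ s₂ :=
    rowAddr_add_le_stackAddr r.2
  have htr : tableAddr D.n m s₀ s₂ ≤ rowAddr D.n m s₀ s₂ x.val := tableAddr_le_rowAddr _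
  have hheap : heapAddr D.n m s₀ s₂ = stackAddr D.n m s₀ s₂ + D.n + 1 := rfl
  have htab : tableAddr D.n m s₀ s₂ = finAddr D.n m s₀ s₂ + m := rfl
  have htab' : tableAddr D.n m s₀ s₂ = 4 + 7 * D.n + 2 * s₀ + s₂ * m * m + m := rfl
  have hgr : growth m = 14 * ((m + 1) * (m + 1)) + 7 + 7 * m := rfl
  have hlx := rowAddr_disj (n := D.n) (m := m) (s₀ := s₀) (s₂ := s₂) (x := l.val) (y := x.val)
    fun e => hx (Fin.ext e ▸ hl)
  have hrx := rowAddr_disj (n := D.n) (m := m) (s₀ := s₀) (s₂ := s₂) (x := r.val) (y := x.val)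
    fun e => hx (Fin.ext e ▸ hr)
  have hxn : x.val < D.n := x.2
  have hrec' : ∀ k < 7, s.mem (4 + 7 * x.val + k) = (vertexRecord D code x).getD k 0 := by
    intro k hk
    rw [h.input _ (by omega)]
    exact hin.record x k hk
  rw [vertexRecord_node D code hx'] at hrec'
  have m₅ := hrec' 5 (by omega)
  have m₆ := hrec' 6 (by omega)
  have mt : ∀ p q : Fin m, s.mem (nodeAddr D.n s₀ + ((f.val * m + p.val) * m + q.val))
      = (B.δ₂ p q f).val := by
    intro p q
    have := nodeAddr_add_lt (n := D.n) (s₀ := s₀) f.2 p.2 q.2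
    rw [h.input _ (by omega)]
    exact hin.node f p q
  refine Tri.seq (Tri.of_wp hN₂ ?_)
  simp only [nodeInit, Cmd.wp, Ex.eval_mem, Ex.eval_var, Ex.eval_ofNat, Ex.eval_add,
    Ex.eval_mul, Ex.safe_var, Ex.safe_mem, true_and, St.set_var, St.set_mem,
    St.put_var, reduceCtorEq, if_false, if_true, hrow, hlr, hrr, hrec, hlab, h.tabNode, h.states,
    (h.rows l hl).empty, (h.rows r hr).empty, mt, m₅, m₆]
  rw [← emptyState_node B D hx']
  set R := rowAddr D.n m s₀ s₂ x.val with hR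
  generalize hs' : St.put _ _ _ = s'
  have hmem : ∀ b, s'.mem b = if b = R + 1 then (emptyState B D x).val else s.mem b := by
    intro b
    simp [← hs', Function.update_apply]
  have hmem' : ∀ b, b ≠ R + 1 → s'.mem b = s.mem b := fun b hb => by rw [hmem, if_neg hb]
  have hv : ∀ y : Var, y ≠ .lempty → y ≠ .rempty → y ≠ .lmor → y ≠ .rmor →
      s'.var y = s.var y := by
    intro y h₁ h₂ h₃ h₄
    simp [← hs', h₁, h₂, h₃, h₄]
  have hv₁ : s'.var .lempty = (emptyState B D l).val := by simp [← hs']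
  have hv₂ : s'.var .rempty = (emptyState B D r).val := by simp [← hs']
  have hv₃ : s'.var .lmor = pathCode D code x l (D.leftEdge hx').toPath := by simp [← hs']
  have hv₄ : s'.var .rmor = pathCode D code x r (D.rightEdge hx').toPath := by simp [← hs']
  have hH : s'.var .heap = s.var .heap := hv _ (by simp) (by simp) (by simp) (by simp)
  have hrow' : s'.var .row = R := (hv _ (by simp) (by simp) (by simp) (by simp)).trans hrow
  have hlr' : s'.var .lrow = rowAddr D.n m s₀ s₂ l.val :=
    (hv _ (by simp) (by simp) (by simp) (by simp)).trans hlr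
  have hrr' : s'.var .rrow = rowAddr D.n m s₀ s₂ r.val :=
    (hv _ (by simp) (by simp) (by simp) (by simp)).trans hrr
  have htn : s'.var .tabNode = nodeAddr D.n s₀ :=
    (hv _ (by simp) (by simp) (by simp) (by simp)).trans h.tabNode
  have hlab' : s'.var .label = f.val := (hv _ (by simp) (by simp) (by simp) (by simp)).trans hlab
  -- The machine replaces the number `m` by the state for the empty selection, exactly as
  -- `pairState` does.
  have hst : ∀ i : ℕ, ∀ e : Fin m, (if i < m then i else e.val)
      = (if h : i < m then (⟨i, h⟩ : Fin m) else e).val := by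
    intro i e
    split_ifs <;> rfl
  clear hs' hrow hlr hrr hlab hrec
  have hpre : PairPre (pathCode D code) N (heapAddr D.n m s₀ s₂) m (pairState B D f l r)
      (D.leftEdge hx').toPath (D.rightEdge hx').toPath (vertexSols B D code l)
      (vertexSols B D code r) s' := by
    refine ⟨by omega, by omega, (hv _ (by simp) (by simp) (by simp) (by simp)).trans h.states,
      by omega, hv₃, hv₄, (hv _ (by simp) (by simp) (by simp) (by simp)).trans hid,
      fun i hi => ?_, fun i hi => ?_, by omega, by omega, by omega, by omega,
      fun i _ j _ => (B.δ₂ _ _ f).2, fun i _ j _ => ?_, fun i _ j _ => ?_, fun t ht => ?_, by omega⟩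
    · rw [hlr']
      exact ((h.rows l hl).links i hi).congr hH.ge (fun b hb _ => hmem' b (by omega))
        (hmem' _ (by omega)) (hmem' _ (by omega))
    · rw [hrr']
      exact ((h.rows r hr).links i hi).congr hH.ge (fun b hb _ => hmem' b (by omega))
        (hmem' _ (by omega)) (hmem' _ (by omega))
    · rw [htn, hlab', hv₁, hv₂, hrow', hst, hst]
      have := nodeAddr_add_lt (n := D.n) (s₀ := s₀) f.2
        (if h : i < m then (⟨i, h⟩ : Fin m) else emptyState B D l).2
        (if h : j < m then (⟨j, h⟩ : Fin m) else emptyState B D r).2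
      omega
    · rw [htn, hlab', hv₁, hv₂, hst, hst]
      have := nodeAddr_add_lt (n := D.n) (s₀ := s₀) f.2
        (if h : i < m then (⟨i, h⟩ : Fin m) else emptyState B D l).2
        (if h : j < m then (⟨j, h⟩ : Fin m) else emptyState B D r).2
      rw [hmem' _ (by omega), mt]
      rfl
    · rw [hrow', hmem' _ (by omega)]
      have := h.fresh x hx (4 + 2 * t) (by omega)
      rwa [← add_assoc] at this
  refine (tri_pairLoop hcd hN₂ hpre).mono le_rfl fun s₁ hi => ?_
  have i₁ := hi.heap_ge
  have i₂ := hi.heap_le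
  have i₃ := hi.mem
  have i₄ := hi.links
  have i₅ := hi.var
  simp only [St.set_var, St.set_mem, reduceCtorEq, if_false, hrow'] at i₁ i₂ i₃ i₄ i₅
  refine ⟨fun y hy => ?_, by omega, by omega, fun b hb hb' => ?_, ?_, ?_, fun t ht => ?_⟩
  · have e : ∀ z : Var, ¬ z.Kept → y ≠ z := fun z hz => hy.ne hz
    have hj := e .j (by simp [Var.Kept])
    rw [← hv y (e _ (by simp [Var.Kept])) (e _ (by simp [Var.Kept])) (e _ (by simp [Var.Kept]))
      (e _ (by simp [Var.Kept])), ← i₅ y hy.not_scratch (e _ (by simp [Var.Kept])) hj, if_neg hj]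
  · rw [i₃ b (by omega) (by omega), hmem' b (by omega)]
  · rw [i₃ _ (by omega) (by omega), hmem, if_pos rfl]
  · rw [i₃ _ (by omega) (by omega), hmem' _ (by omega)]
    exact h.fresh x hx 2 (by omega)
  · refine (i₄ t ht).ext fun v ρ => ?_
    rw [vertexSols_node B D code hx' ht]
    simp [accSem]

end Vertices

/-! ### Length of chains in the graph. -/

section Chains

variable {C : Type u} [Category.{v} C] {A F : Type} (D : DecDAG C A F)

theorem DecDAG.card_below_le (x : D.V) : (D.below x).card ≤ D.n :=
  (Finset.card_le_univ _).trans_eq (Fintype.card_fin _)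

/-- Every edge loses a reachable vertex. Hence the search stack has bounded depth, and no vertex
occurs twice on it. -/
theorem DecDAG.card_below_chain {st : ℕ → D.V} {d : ℕ}
    (h : ∀ k < d, ∃ b, D.Edge (st k) b (st (k + 1))) {k : ℕ} (hk : k ≤ d) :
    (D.below (st d)).card + (d - k) ≤ (D.below (st k)).card := by
  induction d with
  | zero =>
    obtain rfl : k = 0 := by omega
    simp
  | succ d ih =>
    rcases Nat.lt_or_ge d k with h₁ | h₁
    · obtain rfl : k = d + 1 := by omega
      simp
    · have := ih (fun k hk => h k (by omega)) h₁
      obtain ⟨b, hb⟩ := h d (by omega)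
      have := D.card_below_lt hb
      omega

end Chains

/-! ### The depth-first search and the preprocessing program. -/

section Search

open Quiver (Path)

variable {C : Type u} [Category.{v} C] {m s₀ s₂ : ℕ}
  (B : DBUTA (Fin m) (Fin s₀ × Bool) (Fin s₂)) (D : DecDAG C (Fin s₀) (Fin s₂))
  (code : ∀ x y : C, (x ⟶ y) → ℕ)

/-- The invariant of the depth-first search; `k` bounds the number of remaining steps. -/
structure SearchInv (mem₀ : ℕ → ℕ) (k : ℕ) (done : Finset (Fin D.n)) (s : St) : Prop
    extends DataInv B D code mem₀ done s where
  before : ∀ x : D.V, x.val < s.var .vert → x ∈ done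
  vert_le : s.var .vert ≤ D.n
  depth_le : s.var .depth ≤ D.n
  -- The potential in brackets is at most 2n + n + n and grows in every step: completing a vertex
  -- adds 2 and removes at most one level, visiting a child adds a level, and advancing moves to the
  -- next start vertex.
  bound : 4 * D.n ≤ k + (2 * done.card + s.var .vert + s.var .depth)
  path : s.var .vert < D.n → ∃ st : ℕ → D.V, (st 0).val = s.var .vert ∧
    (∀ k ≤ s.var .depth, s.mem (stackAddr D.n m s₀ s₂ + k) = (st k).val) ∧
    (∀ k < s.var .depth, ∃ b, D.Edge (st k) b (st (k + 1))) ∧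
    -- The first alternative occurs when the start vertex has been completed, or was completed by an
    -- earlier search; the next step then advances.
    ((s.var .depth = 0 ∧ st 0 ∈ done) ∨ ∀ k ≤ s.var .depth, st k ∉ done)

variable {B D code} {op : ℕ → ℕ → ℕ} {N : ℕ} {mem₀ : ℕ → ℕ} {done : Finset (Fin D.n)} {s s' : St}
  {x : D.V}

theorem DataInv.congr (h : DataInv B D code mem₀ done s)
    (hv : ∀ y : Var, y.Kept → y ≠ .vert → y ≠ .depth → y ≠ .row → y ≠ .ident →
      s'.var y = s.var y) (hh : s'.var .heap = s.var .heap)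
    (hm : ∀ b, (b < stackAddr D.n m s₀ s₂ ∨ heapAddr D.n m s₀ s₂ ≤ b) → s'.mem b = s.mem b) :
    DataInv B D code mem₀ done s' where
  toGlobals := h.toGlobals.congr hv
  input b hb := (hm b (.inl (hb.trans_le (Nat.le_add_right _ _)))).trans (h.input b hb)
  heap_ge := h.heap_ge.trans_eq hh.symm
  heap_le := hh.trans_le h.heap_le
  rows x hx := by
    have := rowAddr_add_le_stackAddr (m := m) (s₀ := s₀) (s₂ := s₂) x.2
    exact (h.rows x hx).congr hh.ge (fun k hk => hm _ (.inl (by omega))) fun b hb _ => hm b (.inr hb)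
  fresh x hx k hk := by
    have := rowAddr_add_le_stackAddr (m := m) (s₀ := s₀) (s₂ := s₂) x.2
    exact (hm _ (.inl (by omega))).trans (h.fresh x hx k hk)

theorem SearchInv.card_le {k : ℕ} (_ : SearchInv B D code mem₀ k done s) : done.card ≤ D.n :=
  (Finset.card_le_univ _).trans_eq (Fintype.card_fin _)

/-- The situation when the current vertex is `x` and its data have been loaded. -/
structure Fetched (k : ℕ) (mem₀ : ℕ → ℕ) (done : Finset (Fin D.n)) (x : D.V) (s : St) : Prop
    extends SearchInv B D code mem₀ k done s where
  cur : ∃ st : ℕ → D.V, (st 0).val = s.var .vert ∧ st (s.var .depth) = x ∧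
    (∀ k ≤ s.var .depth, s.mem (stackAddr D.n m s₀ s₂ + k) = (st k).val) ∧
    (∀ k < s.var .depth, ∃ b, D.Edge (st k) b (st (k + 1))) ∧
    ((s.var .depth = 0 ∧ st 0 ∈ done) ∨ ∀ k ≤ s.var .depth, st k ∉ done)
  vert_lt : s.var .vert < D.n
  row : s.var .row = rowAddr D.n m s₀ s₂ x.val
  record : s.var .record = 4 + 7 * x.val
  label : s.var .label = (vertexRecord D code x).getD 1 0
  ident : s.var .ident = (vertexRecord D code x).getD 4 0

theorem DataInv.record_eq (hin : InputMem B D code mem₀) (h : DataInv B D code mem₀ done s)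
    (x : D.V) {k : ℕ} (hk : k < 7) :
    s.mem (4 + 7 * x.val + k) = (vertexRecord D code x).getD k 0 := by
  have hxn : x.val < D.n := x.2
  have htab : tableAddr D.n m s₀ s₂ = 4 + 7 * D.n + 2 * s₀ + s₂ * m * m + m := rfl
  rw [h.input _ (by omega)]
  exact hin.record x k hk

theorem wp_fetch (hin : InputMem B D code mem₀)
    (hroom : heapAddr D.n m s₀ s₂ + growth m * D.n + growth m + 14 < 2 ^ N)
    {k : ℕ} (h : SearchInv B D code mem₀ k done s) (hv : s.var .vert < D.n) :
    fetch.wp op N (fun s' => ∃ x, Fetched (B := B) (code := code) k mem₀ done x s') s := by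
  obtain ⟨st, h0, hst, hedge, hdone⟩ := h.path hv
  set x := st (s.var .depth) with hx
  have hx1 : s.mem (stackAddr D.n m s₀ s₂ + s.var .depth) = x.val := hst _ le_rfl
  have hxs : rowAddr D.n m s₀ s₂ x.val + (2 * m + 4) ≤ stackAddr D.n m s₀ s₂ :=
    rowAddr_add_le_stackAddr x.2
  have hheap : heapAddr D.n m s₀ s₂ = stackAddr D.n m s₀ s₂ + D.n + 1 := rfl
  have htab' : tableAddr D.n m s₀ s₂ = 4 + 7 * D.n + 2 * s₀ + s₂ * m * m + m := rfl
  have hrow : rowAddr D.n m s₀ s₂ x.val = tableAddr D.n m s₀ s₂ + x.val * (2 * m + 4) := rfl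
  have hxn : x.val < D.n := x.2
  have m₁ := h.record_eq hin x (k := 1) (by omega)
  have m₄ := h.record_eq hin x (k := 4) (by omega)
  simp only [fetch, Cmd.wp, Ex.eval_mem, Ex.eval_var, Ex.eval_ofNat, Ex.eval_add,
    Ex.eval_mul, Ex.safe_var, Ex.safe_mem, Ex.safe_add, true_and, St.set_var, St.set_mem,
    reduceCtorEq, if_false, if_true, h.stack, h.table, h.width, hx1, m₁, m₄]
  refine ⟨by omega, by omega, x, ?_⟩
  generalize hs' : St.set _ _ _ = s'
  have hv' : ∀ y : Var, y ≠ .cur → y ≠ .row → y ≠ .record → y ≠ .label → y ≠ .ident →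
      s'.var y = s.var y := by
    intro y h₁ h₂ h₃ h₄ h₅
    simp [← hs', h₁, h₂, h₃, h₄, h₅]
  have hm : s'.mem = s.mem := by simp [← hs']
  have hve : s'.var .vert = s.var .vert := hv' _ (by simp) (by simp) (by simp) (by simp) (by simp)
  have hde : s'.var .depth = s.var .depth := hv' _ (by simp) (by simp) (by simp) (by simp) (by simp)
  have hdata : DataInv B D code mem₀ done s' := h.toDataInv.congr
    (fun y hy _ _ h₁ h₂ => hv' y (hy.ne (by simp [Var.Kept])) h₁ (hy.ne (by simp [Var.Kept]))
      (hy.ne (by simp [Var.Kept])) h₂)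
    (hv' _ (by simp) (by simp) (by simp) (by simp) (by simp)) fun b _ => by rw [hm]
  refine ⟨⟨hdata, ?_, ?_, ?_, ?_, fun _ => ⟨st, ?_⟩⟩, ⟨st, ?_⟩, ?_, ?_, ?_, ?_, ?_⟩
  · rw [hve]; exact h.before
  · rw [hve]; exact h.vert_le
  · rw [hde]; exact h.depth_le
  · rw [hve, hde]; exact h.bound
  · rw [hve, hde, hm]; exact ⟨h0, hst, hedge, hdone⟩
  · rw [hve, hde, hm]; exact ⟨h0, hx.symm, hst, hedge, hdone⟩
  · rw [hve]; exact hv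
  · simp [← hs', hrow]
  · simp [← hs']
  · simp [← hs']
  · simp [← hs']

theorem wp_advance {k : ℕ}
    (hroom : heapAddr D.n m s₀ s₂ + growth m * D.n + growth m + 14 < 2 ^ N)
    (h : Fetched (B := B) (code := code) k mem₀ done x s)
    (hx : s.mem (s.var .row) ≠ 0) :
    advance.wp op N (fun s' => ∃ k' < k, ∃ done', SearchInv B D code mem₀ k' done' s') s := by
  obtain ⟨st, h0, hxd, hst, hedge, hdone⟩ := h.cur
  have hxd' : x ∈ done := h.mem_done (h.row ▸ hx)
  obtain ⟨hd, -⟩ : s.var .depth = 0 ∧ st 0 ∈ done :=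
    hdone.resolve_right fun h' => h' _ le_rfl (hxd ▸ hxd')
  have hvl := h.vert_lt
  have hb := h.bound
  have hc := h.toSearchInv.card_le
  have hheap : heapAddr D.n m s₀ s₂ = stackAddr D.n m s₀ s₂ + D.n + 1 := rfl
  simp only [advance, Cmd.wp, Ex.eval_var, Ex.eval_ofNat, Ex.eval_add,
    Ex.safe_var, Ex.safe_add, true_and, St.set_var, St.set_mem,
    reduceCtorEq, if_false, if_true, h.stack]
  refine ⟨by omega, k - 1, by omega, done, ?_⟩
  generalize hs' : St.put _ _ _ = s'
  have hv' : ∀ y : Var, y ≠ .vert → s'.var y = s.var y := fun y h₁ => by simp [← hs', h₁]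
  have hve : s'.var .vert = s.var .vert + 1 := by simp [← hs']
  have hde : s'.var .depth = 0 := (hv' _ (by simp)).trans hd
  have hm : ∀ b, s'.mem b = if b = stackAddr D.n m s₀ s₂ then s.var .vert + 1 else s.mem b := by
    intro b
    simp [← hs', Function.update_apply]
  refine ⟨h.toDataInv.congr (fun y _ h₁ _ _ _ => hv' y h₁) (hv' _ (by simp)) fun b hb => ?_, ?_,
    by omega, by omega, by omega, fun hlt => ?_⟩
  · rw [hm, if_neg (by omega)]
  · intro y hy
    rcases Nat.lt_or_ge y.val (s.var .vert) with h₁ | h₁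
    · exact h.before y h₁
    · have : y = x := Fin.ext (by rw [← hxd, hd, h0]; omega)
      exact this ▸ hxd'
  · refine ⟨fun _ => ⟨s.var .vert + 1, by omega⟩, hve.symm, ?_, by omega, ?_⟩
    · intro k hk
      obtain rfl : k = 0 := by omega
      rw [hm, add_zero, if_pos rfl]
    · by_cases h₁ : (⟨s.var .vert + 1, by omega⟩ : Fin D.n) ∈ done
      · exact .inl ⟨hde, h₁⟩
      · exact .inr fun _ _ => h₁

/-- The stack is a path of the graph, so `DecDAG.card_below_chain` shows that there is room for one
more entry. -/
theorem wp_visit {k : ℕ}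
    (hroom : heapAddr D.n m s₀ s₂ + growth m * D.n + growth m + 14 < 2 ^ N)
    (h : Fetched (B := B) (code := code) k mem₀ done x s) (hx : x ∉ done) {y : D.V} {b : Bool}
    (hy : y ∉ done) (hxy : D.Edge x b y) {e : Ex} (he : ∀ d, e.Safe N (s.set .depth d))
    (hey : ∀ d, e.eval (s.set .depth d) = y.val) :
    (visit e).wp op N (fun s' => ∃ k' < k, ∃ done', SearchInv B D code mem₀ k' done' s') s := by
  obtain ⟨st, h0, hxd, hst, hedge, hdone⟩ := h.cur
  have hund : ∀ k ≤ s.var .depth, st k ∉ done := by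
    refine hdone.resolve_left fun ⟨hd, h'⟩ => hx ?_
    rwa [← hxd, hd]
  have hvl := h.vert_lt
  have hb := h.bound
  have hc := h.toSearchInv.card_le
  have hheap : heapAddr D.n m s₀ s₂ = stackAddr D.n m s₀ s₂ + D.n + 1 := rfl
  have hdn : s.var .depth + 1 ≤ D.n := by
    have h₁ := D.card_below_chain hedge (Nat.zero_le _)
    have h₂ := D.card_below_lt hxy
    have h₃ := D.card_below_le (st 0)
    rw [hxd] at h₁
    omega
  simp only [visit, Cmd.wp, Ex.eval_var, Ex.eval_ofNat, Ex.eval_add,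
    Ex.safe_var, Ex.safe_add, true_and, St.set_var, St.set_mem,
    reduceCtorEq, if_false, if_true, h.stack, hey, he]
  refine ⟨by omega, k - 1, by omega, done, ?_⟩
  generalize hs' : St.put _ _ _ = s'
  have hv' : ∀ y : Var, y ≠ .depth → s'.var y = s.var y := fun y h₁ => by simp [← hs', h₁]
  have hde : s'.var .depth = s.var .depth + 1 := by simp [← hs']
  have hve : s'.var .vert = s.var .vert := hv' _ (by simp)
  have hm : ∀ b, s'.mem b = if b = stackAddr D.n m s₀ s₂ + (s.var .depth + 1) then y.val
      else s.mem b := by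
    intro b
    simp [← hs', Function.update_apply]
  refine ⟨h.toDataInv.congr (fun y _ _ h₁ _ _ => hv' y h₁) (hv' _ (by simp)) fun b hb => ?_, ?_,
    by omega, by omega, by omega, fun hlt => ?_⟩
  · rw [hm, if_neg (by omega)]
  · rw [hve]; exact h.before
  · obtain ⟨st', e₁, e₂⟩ : ∃ st' : ℕ → D.V, (∀ k ≤ s.var .depth, st' k = st k) ∧
        st' (s.var .depth + 1) = y :=
      ⟨fun k => if k ≤ s.var .depth then st k else y, fun k hk => if_pos hk, if_neg (by omega)⟩
    refine ⟨st', ?_, fun k hk => ?_, fun k hk => ?_, .inr fun k hk => ?_⟩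
    · rw [e₁ 0 (by omega), hve, h0]
    · rcases Nat.lt_or_ge (s.var .depth) k with h₁ | h₁
      · obtain rfl : k = s.var .depth + 1 := by omega
        rw [hm, if_pos rfl, e₂]
      · rw [hm, if_neg (by omega), e₁ k h₁]
        exact hst k h₁
    · rcases Nat.lt_or_ge k (s.var .depth) with h₁ | h₁
      · rw [e₁ _ (by omega), e₁ _ (by omega)]
        exact hedge k h₁
      · obtain rfl : k = s.var .depth := by omega
        rw [e₁ _ le_rfl, e₂, hxd]
        exact ⟨b, hxy⟩
    · rcases Nat.lt_or_ge (s.var .depth) k with h₁ | h₁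
      · obtain rfl : k = s.var .depth + 1 := by omega
        rwa [e₂]
      · rw [e₁ k h₁]
        exact hund k h₁

/-- By acyclicity `x` occurs only at the top of the stack, so the entries below it are still
unfinished. -/
theorem Fetched.finished {k : ℕ} (h : Fetched (B := B) (code := code) k mem₀ done x s)
    (hx : x ∉ done) (hf : Finished B D code mem₀ done x s s') :
    ∃ k' < k, ∃ done', SearchInv B D code mem₀ k' done' s' := by
  obtain ⟨st, h0, hxd, hst, hedge, hdone⟩ := h.cur
  have hund : ∀ k ≤ s.var .depth, st k ∉ done := by
    refine hdone.resolve_left fun ⟨hd, h'⟩ => hx ?_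
    rwa [← hxd, hd]
  have hvl := h.vert_lt
  have hb := h.bound
  have hc : (insert x done : Finset (Fin D.n)).card ≤ D.n :=
    (Finset.card_le_univ _).trans_eq (Fintype.card_fin _)
  have hc' : (insert x done : Finset (Fin D.n)).card = done.card + 1 :=
    Finset.card_insert_of_notMem hx
  have hdl := h.depth_le
  have f₁ := hf.vert
  have f₂ := hf.depth
  refine ⟨k - 1, by omega, insert x done, ⟨hf.data, fun y hy => ?_, by omega, by omega, by omega,
    fun hlt => ⟨st, h0.trans f₁.symm, fun k hk => ?_, fun k hk => hedge k (by omega), ?_⟩⟩⟩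
  · rw [f₁] at hy
    exact Finset.mem_insert_of_mem (α := Fin D.n) (h.before y hy)
  · rw [hf.stack k (by omega)]
    exact hst k (by omega)
  · rcases Nat.eq_zero_or_pos (s.var .depth) with hd | hd
    · refine .inl ⟨by omega, ?_⟩
      rw [← hd, hxd]
      exact Finset.mem_insert_self (α := Fin D.n) _ _
    · refine .inr fun k hk hmem => ?_
      rcases (Finset.mem_insert (α := Fin D.n)).1 hmem with h₁ | h₁
      · have h₂ := D.card_below_chain hedge (k := k) (by omega)
        have h₃ : st k = st (s.var .depth) := h₁.trans hxd.symm
        rw [h₃] at h₂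
        omega
      · exact hund k (by omega) h₁

theorem Fetched.congr {k : ℕ} (h : Fetched (B := B) (code := code) k mem₀ done x s)
    (hv : ∀ y : Var, y ≠ .lrow → y ≠ .rrow → s'.var y = s.var y) (hm : s'.mem = s.mem) :
    Fetched (B := B) (code := code) k mem₀ done x s' := by
  have hve : s'.var .vert = s.var .vert := hv _ (by simp) (by simp)
  have hde : s'.var .depth = s.var .depth := hv _ (by simp) (by simp)
  refine ⟨⟨h.toDataInv.congr (fun y hy _ _ _ _ => hv y (hy.ne (by simp [Var.Kept]))
    (hy.ne (by simp [Var.Kept]))) (hv _ (by simp) (by simp)) fun b _ => by rw [hm],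
    ?_, ?_, ?_, ?_, ?_⟩, ?_, ?_, ?_, ?_, ?_, ?_⟩
  · rw [hve]; exact h.before
  · rw [hve]; exact h.vert_le
  · rw [hde]; exact h.depth_le
  · rw [hve, hde]; exact h.bound
  · rw [hve, hde, hm]; exact h.path
  · rw [hve, hde, hm]; exact h.cur
  · rw [hve]; exact h.vert_lt
  · rw [hv .row (by simp) (by simp)]; exact h.row
  · rw [hv .record (by simp) (by simp)]; exact h.record
  · rw [hv .label (by simp) (by simp)]; exact h.label
  · rw [hv .ident (by simp) (by simp)]; exact h.ident

theorem wp_fetchRows (hin : InputMem B D code mem₀)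
    (hroom : heapAddr D.n m s₀ s₂ + growth m * D.n + growth m + 14 < 2 ^ N) {k : ℕ}
    (h : Fetched (B := B) (code := code) k mem₀ done x s) {f : Fin s₂} {l r : D.V}
    (hx : D.node x = Sum.inr (f, l, r)) :
    fetchRows.wp op N (fun s' => Fetched (B := B) (code := code) k mem₀ done x s' ∧
      s'.var .lrow = rowAddr D.n m s₀ s₂ l.val ∧ s'.var .rrow = rowAddr D.n m s₀ s₂ r.val) s := by
  have hls : rowAddr D.n m s₀ s₂ l.val + (2 * m + 4) ≤ stackAddr D.n m s₀ s₂ :=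
    rowAddr_add_le_stackAddr l.2
  have hrs : rowAddr D.n m s₀ s₂ r.val + (2 * m + 4) ≤ stackAddr D.n m s₀ s₂ :=
    rowAddr_add_le_stackAddr r.2
  have hheap : heapAddr D.n m s₀ s₂ = stackAddr D.n m s₀ s₂ + D.n + 1 := rfl
  have hlr : rowAddr D.n m s₀ s₂ l.val = tableAddr D.n m s₀ s₂ + l.val * (2 * m + 4) := rfl
  have hrr : rowAddr D.n m s₀ s₂ r.val = tableAddr D.n m s₀ s₂ + r.val * (2 * m + 4) := rfl
  have m₂ : s.mem (4 + 7 * x.val + 2) = l.val := by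
    rw [h.record_eq hin x (by omega), vertexRecord_node D code hx]; rfl
  have m₃ : s.mem (4 + 7 * x.val + 3) = r.val := by
    rw [h.record_eq hin x (by omega), vertexRecord_node D code hx]; rfl
  simp only [fetchRows, Cmd.wp, Ex.eval_mem, Ex.eval_var, Ex.eval_ofNat, Ex.eval_add,
    Ex.eval_mul, Ex.safe_add, true_and, St.set_var, St.set_mem,
    reduceCtorEq, if_false, if_true, h.record, h.table, h.width, m₂, m₃]
  refine ⟨by omega, by omega, h.congr (fun y h₁ h₂ => ?_) rfl, hlr.symm, hrr.symm⟩
  simp [h₁, h₂]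

/-- A bound for the time needed for one step of the search. -/
def searchTime (m : ℕ) : ℕ :=
  fetch.cost + ((Cond.eq (.mem (.var .row)) 0).len + 1 +
    (advance.cost + ((Cond.eq (.mem (.var .record)) 0).len + 1 +
      (leafTrees.cost + finishTime m + (fetchRows.cost + ((Cond.eq (.mem (.var .lrow)) 0).len + 1 +
        ((visit (.mem (.var .record + 2))).cost + ((Cond.eq (.mem (.var .rrow)) 0).len + 1 +
          ((visit (.mem (.var .record + 3))).cost + (nodeTime m + finishTime m))))))))))

theorem tri_searchStep (hcd : Coding (pathCode D code) op N) (hN₂ : 2 ≤ N)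
    (hin : InputMem B D code mem₀)
    (hroom : heapAddr D.n m s₀ s₂ + growth m * D.n + growth m + 14 < 2 ^ N)
    {k : ℕ} (h : SearchInv B D code mem₀ k done s) (hv : s.var .vert < D.n) :
    Tri op N searchStep s (searchTime m)
      fun s' => ∃ k' < k, ∃ done', SearchInv B D code mem₀ k' done' s' := by
  refine Tri.seq ((Tri.of_wp hN₂ (wp_fetch hin hroom h hv)).mono le_rfl ?_)
  rintro s ⟨x, h⟩
  refine Tri.ite (fun h₁ => ?_) fun h₁ => ?_
  -- A nonzero flag in the row means that the current vertex is done.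
  swap
  · exact (Tri.of_wp hN₂ (wp_advance hroom h h₁)).mono (by omega) fun _ => id
  have hx : x ∉ done := by
    intro hx
    have h₂ : s.mem (s.var .row) = 0 := h₁
    rw [h.row, (h.rows x hx).flag] at h₂
    omega
  have hrec : ∀ k < 7, s.mem (s.var .record + k) = (vertexRecord D code x).getD k 0 := by
    rw [h.record]
    exact fun k hk => h.record_eq hin x hk
  have hlab := h.label
  have hid := h.ident
  refine Tri.mono (Tri.ite (T := leafTrees.cost + finishTime m + (fetchRows.cost +
    ((Cond.eq (.mem (.var .lrow)) 0).len + 1 +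
        ((visit (.mem (.var .record + 2))).cost + ((Cond.eq (.mem (.var .rrow)) 0).len + 1 +
          ((visit (.mem (.var .record + 3))).cost + (nodeTime m + finishTime m)))))))
    (fun h₂ => ?_) fun h₂ => ?_) (by omega) fun _ => id
  · have h₂ : s.mem (s.var .record + 0) = 0 := h₂
    match hnode : D.node x with
    | .inr (f, l, r) =>
      rw [hrec 0 (by omega), vertexRecord_node D code hnode] at h₂
      exact absurd h₂ (by simp)
    | .inl a =>
      rw [vertexRecord_leaf D code hnode] at hlab hid
      refine (Tri.seq ((Tri.of_wp hN₂ (wp_leafTrees hin hroom h.toDataInv hx h.row hid hnode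
        hlab)).mono le_rfl fun s₁ hf => ?_)).mono (Nat.le_add_right _ _) fun _ => id
      exact (tri_finish hcd hN₂ hroom h.toDataInv hx h.row hid h.depth_le hf).mono le_rfl
        fun s₂ => h.finished hx
  · have h₂ : ¬ s.mem (s.var .record + 0) = 0 := h₂
    match hnode : D.node x with
    | .inl a =>
      rw [hrec 0 (by omega), vertexRecord_leaf D code hnode] at h₂
      exact absurd rfl h₂
    | .inr (f, l, r) =>
      rw [vertexRecord_node D code hnode] at hlab hid hrec
      clear hlab hid hrec h₁ h₂
      refine Tri.mono (Tri.seq ((Tri.of_wp hN₂ (wp_fetchRows hin hroom h hnode)).mono le_rfl ?_)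
        (T₂ := (Cond.eq (.mem (.var .lrow)) 0).len + 1 +
        ((visit (.mem (.var .record + 2))).cost + ((Cond.eq (.mem (.var .rrow)) 0).len + 1 +
          ((visit (.mem (.var .record + 3))).cost + (nodeTime m + finishTime m))))))
        (Nat.le_add_left _ _) fun _ => id
      rintro s ⟨h, hl, hr⟩
      have hlab : s.var .label = f.val := by rw [h.label, vertexRecord_node D code hnode]; rfl
      have hid : s.var .ident = pathCode D code x x .nil := by
        rw [h.ident, vertexRecord_node D code hnode]; rfl
      have hc₂ : s.mem (s.var .record + 2) = l.val := by
        rw [h.record, h.record_eq hin x (by omega), vertexRecord_node D code hnode]; rfl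
      have hc₃ : s.mem (s.var .record + 3) = r.val := by
        rw [h.record, h.record_eq hin x (by omega), vertexRecord_node D code hnode]; rfl
      refine Tri.ite (fun h₁ => ?_) fun h₁ => ?_
      · have hl' : l ∉ done := fun hl' => by
          have h₂ : s.mem (s.var .lrow) = 0 := h₁
          rw [hl, (h.rows l hl').flag] at h₂
          omega
        exact (Tri.of_wp hN₂ (wp_visit (e := .mem (.var .record + 2)) hroom h hx hl'
          (b := false) ⟨f, l, r, hnode, rfl⟩
          (fun d => trivial) (fun d => by simpa using hc₂))).mono (Nat.le_add_right _ _) fun _ => id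
      refine Tri.mono (Tri.ite (T := (visit (.mem (.var .record + 3))).cost +
        (nodeTime m + finishTime m)) (fun h₂ => ?_) fun h₂ => ?_) (by omega) fun _ => id
      · have hr' : r ∉ done := fun hr' => by
          have h₂ : s.mem (s.var .rrow) = 0 := h₂
          rw [hr, (h.rows r hr').flag] at h₂
          omega
        exact (Tri.of_wp hN₂ (wp_visit (e := .mem (.var .record + 3)) hroom h hx hr'
          (b := true) ⟨f, l, r, hnode, rfl⟩
          (fun d => trivial) (fun d => by simpa using hc₃))).mono (Nat.le_add_right _ _) fun _ => id
      · have hl' : l ∈ done := h.mem_done (hl ▸ h₁)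
        have hr' : r ∈ done := h.mem_done (hr ▸ h₂)
        refine (Tri.seq ((tri_nodeTrees hcd hN₂ hin hroom h.toDataInv hx h.row h.record hid hnode
          hlab hl hr hl' hr').mono le_rfl fun s₁ hf => ?_)).mono (Nat.le_add_left _ _) fun _ => id
        exact (tri_finish hcd hN₂ hroom h.toDataInv hx h.row hid h.depth_le hf).mono le_rfl
          fun s₂ => h.finished hx

variable (B D code) in
/-- The memory contains the data structure. -/
structure DataMem (mem₀ mem : ℕ → ℕ) (top : ℕ) : Prop where
  table : mem 0 = tableAddr D.n m s₀ s₂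
  width : mem 1 = 2 * m + 4
  top_eq : mem 2 = top
  fin : mem 3 = finAddr D.n m s₀ s₂
  top_ge : heapAddr D.n m s₀ s₂ ≤ top
  top_le : top ≤ heapAddr D.n m s₀ s₂ + growth m * D.n
  final : ∀ t < m, mem (finAddr D.n m s₀ s₂ + t) = mem₀ (finAddr D.n m s₀ s₂ + t)
  rows : ∀ x : D.V, RowDone B D code mem₀ mem top x

/-- A bound for the time of the preprocessing. -/
def preTime (n m : ℕ) : ℕ :=
  preInit.cost + (4 * n * ((Cond.lt (.var .vert) (.var .cnt)).len + searchTime m + 1) +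
    ((Cond.lt (.var .vert) (.var .cnt)).len + 1) + preExit.cost)

theorem wp_preInit (hin : InputMem B D code mem₀)
    (hroom : heapAddr D.n m s₀ s₂ + growth m * D.n + growth m + 14 < 2 ^ N)
    (hs : ∀ y, s.var y = 0) (hm : s.mem = mem₀) :
    preInit.wp op N (SearchInv B D code mem₀ (4 * D.n) ∅) s := by
  have h₁ : heapAddr D.n m s₀ s₂ = stackAddr D.n m s₀ s₂ + D.n + 1 := rfl
  have h₂ : stackAddr D.n m s₀ s₂ = tableAddr D.n m s₀ s₂ + D.n * (2 * m + 4) := rfl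
  have h₃ : tableAddr D.n m s₀ s₂ = finAddr D.n m s₀ s₂ + m := rfl
  have h₄ : finAddr D.n m s₀ s₂ = nodeAddr D.n s₀ + s₂ * m * m := rfl
  have h₅ : nodeAddr D.n s₀ = leafAddr D.n + 2 * s₀ := rfl
  have h₆ : leafAddr D.n = 4 + 7 * D.n := rfl
  have hgr : growth m = 14 * ((m + 1) * (m + 1)) + 7 + 7 * m := rfl
  simp only [preInit, Cmd.wp, Ex.eval_mem, Ex.eval_var, Ex.eval_ofNat, Ex.eval_add,
    Ex.eval_mul, Ex.safe_add, Ex.safe_mem, Ex.safe_var, true_and, St.set_var, St.set_mem,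
    reduceCtorEq, if_false, if_true, hm, hin.cnt, hin.states, hin.leaves, hin.nodes,
    ← h₆, ← h₅, ← h₄, ← h₃, ← h₂, ← h₁]
  refine ⟨by omega, by omega, by omega, by omega, by omega, by omega, by omega, ?_⟩
  generalize hs' : St.set _ _ _ = s'
  have hm' : s'.mem = mem₀ := by simp [← hs', hm]
  have hv : s'.var .vert = 0 := by simp [← hs', hs]
  have hd : s'.var .depth = 0 := by simp [← hs', hs]
  have hh : s'.var .heap = heapAddr D.n m s₀ s₂ := by simp [← hs']
  refine ⟨⟨⟨by simp [← hs'], by simp [← hs'], by simp [← hs'], by simp [← hs'], by simp [← hs'],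
    by simp [← hs'], by simp [← hs'], by simp [← hs']⟩, fun b _ => by rw [hm'], hh.ge,
    hh.le.trans (Nat.le_add_right _ _), fun x hx => absurd hx (Finset.notMem_empty (α := Fin D.n) _),
    fun x _ k _ => ?_⟩, fun x hx => by omega, by omega, by omega, by omega, fun hlt => ?_⟩
  · rw [hm']
    -- Memory beyond the input is zero, so all rows are fresh and the bottom of the stack already
    -- contains the first vertex, which has number 0.
    exact hin.zero _ ((tableAddr_le_rowAddr _).trans (Nat.le_add_right _ _))
  · refine ⟨fun _ => ⟨0, by omega⟩, hv.symm, fun k hk => ?_, fun k hk => by omega,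
      .inr fun k _ => Finset.notMem_empty (α := Fin D.n) _⟩
    rw [hm']
    exact hin.zero _ (by omega)

theorem tri_preCmd (hcd : Coding (pathCode D code) op N) (hN₂ : 2 ≤ N)
    (hin : InputMem B D code mem₀)
    (hroom : heapAddr D.n m s₀ s₂ + growth m * D.n + growth m + 14 < 2 ^ N)
    (hs : ∀ y, s.var y = 0) (hm : s.mem = mem₀) :
    Tri op N preCmd s (preTime D.n m) fun s' => ∃ top, DataMem B D code mem₀ s'.mem top := by
  refine Tri.seq ((Tri.of_wp hN₂ (wp_preInit hin hroom hs hm)).mono le_rfl fun s₁ h => ?_)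
  refine Tri.seq (Tri.loop (fun k s => ∃ done, SearchInv B D code mem₀ k done s) ?_ ?_
    (k := 4 * D.n) ⟨∅, h⟩)
  · rintro k s ⟨done, h⟩ hc
    refine tri_searchStep hcd hN₂ hin hroom h ?_
    have : s.var .vert < s.var .cnt := hc
    rwa [h.cnt] at this
  · rintro k s ⟨done, h⟩ hc
    have hc : ¬ s.var .vert < s.var .cnt := hc
    rw [h.cnt] at hc
    refine Tri.of_wp hN₂ ?_
    -- The loop ends when the start vertex has run through all vertices, so none is left out.
    have hd : ∀ x : D.V, x ∈ done := fun x => h.before x (lt_of_lt_of_le x.2 (by omega))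
    have hgc := Nat.mul_le_mul_left (growth m) h.card_le
    have hle := h.heap_le
    have hge := h.heap_ge
    have htab : tableAddr D.n m s₀ s₂ = finAddr D.n m s₀ s₂ + m := rfl
    have hfin : finAddr D.n m s₀ s₂ = 4 + 7 * D.n + 2 * s₀ + s₂ * m * m := rfl
    have hst : stackAddr D.n m s₀ s₂ = tableAddr D.n m s₀ s₂ + D.n * (2 * m + 4) := rfl
    have hheap : heapAddr D.n m s₀ s₂ = stackAddr D.n m s₀ s₂ + D.n + 1 := rfl
    simp only [preExit, Cmd.wp, Ex.eval_var, Ex.eval_ofNat, Ex.safe_var, true_and, St.put_var,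
      h.table, h.width, h.fin]
    refine ⟨s.var .heap, ?_⟩
    generalize hs' : St.put _ _ _ = s'
    have hmem : ∀ b, s'.mem b = if b = 3 then finAddr D.n m s₀ s₂ else if b = 2 then s.var .heap else
        if b = 1 then 2 * m + 4 else if b = 0 then tableAddr D.n m s₀ s₂ else s.mem b := by
      intro b
      simp [← hs', Function.update_apply]
    -- Only the four sizes at the start of the input are overwritten; everything the enumeration
    -- reads otherwise lies behind them.
    have hmem' : ∀ b, 4 ≤ b → s'.mem b = s.mem b := by
      intro b hb
      rw [hmem]
      repeat rw [if_neg (by omega)]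
    refine ⟨by simp [hmem], by simp [hmem], by simp [hmem], by simp [hmem], hge, by omega,
      fun t ht => ?_, fun x => ?_⟩
    · rw [hmem' _ (by omega)]
      exact h.input _ (by omega)
    · have : tableAddr D.n m s₀ s₂ ≤ rowAddr D.n m s₀ s₂ x.val := tableAddr_le_rowAddr _
      exact (h.rows x (hd x)).congr le_rfl (fun k _ => hmem' _ (by omega))
        fun b _ _ => hmem' b (by omega)

end Search

/-! ### Bounds -/

theorem Config.Fits.mono {W W' : ℕ} {σ : Config} (h : σ.Fits W) (hW : W ≤ W') : σ.Fits W' :=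
  have h2 : 2 ^ W ≤ 2 ^ W' := Nat.pow_le_pow_right (by norm_num) hW
  ⟨fun r => (h.1 r).trans_le h2, fun a => (h.2 a).trans_le h2⟩

theorem EnumeratesLinearDelay.mono {op : ℕ → ℕ → ℕ} {P : Program} {c c' : ℕ} {σ : Config}
    {S : Multiset (Multiset ℕ)} (h : EnumeratesLinearDelay op P c σ S) (hc : c ≤ c') :
    EnumeratesLinearDelay op P c' σ S := by
  obtain ⟨L, t, h₁, h₂, h₃, h₄, T, h₅, h₆, h₇⟩ := h
  exact ⟨L, t, h₁, h₂, fun i hi => ⟨(h₃ i hi).1, (h₃ i hi).2.trans (Nat.mul_le_mul_right _ hc)⟩, h₄,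
    T, h₅, by omega, h₇⟩

/-! ### Running time of the preprocessing. -/

section Time

theorem rowTime_le : ∃ K, ∀ m, rowTime m ≤ K * (m + 1) := by
  refine ⟨rowTime 0, fun m => ?_⟩
  simp only [rowTime]
  generalize (Cmd.assign .j 0).cost = a
  generalize (Cond.lt (.var .j) (.var .states + 1)).len = b
  generalize pairStep.cost = c
  generalize (Cmd.assign .i (.var .i + 1)).cost = d
  nlinarith [Nat.zero_le (a * m), Nat.zero_le (b * m), Nat.zero_le (c * m), Nat.zero_le (d * m)]

theorem pairTime_le : ∃ K, ∀ m, pairTime m ≤ K * (m + 1) ^ 2 := by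
  obtain ⟨K, hK⟩ := rowTime_le
  simp only [pairTime]
  generalize (Cmd.assign .i 0).cost = a
  generalize (Cond.lt (.var .i) (.var .states + 1)).len = b
  refine ⟨a + (b + K + 1) + (b + 1), fun m => ?_⟩
  have h₁ : (m + 1) * (b + rowTime m + 1) ≤ (m + 1) * ((b + K + 1) * (m + 1)) := by
    refine Nat.mul_le_mul_left _ ?_
    have := hK m
    nlinarith [Nat.zero_le (b * m)]
  have h₂ : 1 ≤ (m + 1) ^ 2 := Nat.one_le_pow _ _ (by omega)
  calc a + ((m + 1) * (b + rowTime m + 1) + (b + 1))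
      ≤ a + ((m + 1) * ((b + K + 1) * (m + 1)) + (b + 1)) := by omega
    _ = a * 1 + (b + K + 1) * (m + 1) ^ 2 + (b + 1) * 1 := by ring
    _ ≤ a * (m + 1) ^ 2 + (b + K + 1) * (m + 1) ^ 2 + (b + 1) * (m + 1) ^ 2 := by gcongr
    _ = _ := by ring

theorem finishTime_le : ∃ K, ∀ m, finishTime m ≤ K * (m + 1) ^ 2 := by
  simp only [finishTime, rootTime]
  generalize (Cmd.assign .i 0).cost = a
  generalize (Cond.lt (.var .i) (.var .states)).len = b
  generalize rootStep.cost = c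
  generalize leave.cost = d
  refine ⟨a + (b + c + 1) + (b + 1) + d, fun m => ?_⟩
  nlinarith [Nat.zero_le (a * m), Nat.zero_le (b * m), Nat.zero_le (c * m), Nat.zero_le (d * m),
    Nat.zero_le (a * m ^ 2), Nat.zero_le (b * m ^ 2), Nat.zero_le (c * m ^ 2),
    Nat.zero_le (d * m ^ 2), Nat.zero_le (m ^ 2)]

theorem searchTime_le : ∃ K, ∀ m, searchTime m ≤ K * (m + 1) ^ 2 := by
  obtain ⟨K₁, h₁⟩ := pairTime_le
  obtain ⟨K₂, h₂⟩ := finishTime_le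
  obtain ⟨A, hA⟩ : ∃ A, ∀ m, searchTime m = A + (pairTime m + 2 * finishTime m) :=
    -- The search time depends on `m` only through these summands, so the difference at 0 is the
    -- constant part.
    ⟨searchTime 0 - (pairTime 0 + 2 * finishTime 0), fun m => by
      simp only [searchTime, nodeTime]; omega⟩
  refine ⟨A + (K₁ + 2 * K₂), fun m => ?_⟩
  have h₃ : 1 ≤ (m + 1) ^ 2 := Nat.one_le_pow _ _ (by omega)
  have h₄ : A * 1 ≤ A * (m + 1) ^ 2 := Nat.mul_le_mul_left _ h₃
  rw [hA, add_mul, add_mul, mul_assoc 2]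
  have := h₁ m
  have := h₂ m
  omega

/-- The loops run over `m + 1` values, which costs at most a factor 4 compared with `m ^ 2` if `m`
is positive. Without vertices the constant term suffices. -/
theorem preTime_le : ∃ K, ∀ n m, (0 < n → 0 < m) → preTime n m ≤ K * (n * m ^ 2 + 1) := by
  obtain ⟨K, hK⟩ := searchTime_le
  simp only [preTime]
  generalize (Cond.lt (.var .vert) (.var .cnt)).len = b
  generalize preInit.cost = a
  generalize preExit.cost = c
  refine ⟨a + (b + 1) + c + 4 * (b + 4 * K + 1), fun n m hnm => ?_⟩
  rcases Nat.eq_zero_or_pos n with rfl | hn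
  · simp only [mul_zero, zero_mul, zero_add, mul_one]
    omega
  have hm : 1 ≤ m := hnm hn
  have h₁ : (m + 1) ^ 2 ≤ 4 * m ^ 2 := by nlinarith
  have h₂ : searchTime m ≤ K * (4 * m ^ 2) := (hK m).trans (Nat.mul_le_mul_left _ h₁)
  have h₃ : 1 ≤ m ^ 2 := Nat.one_le_pow _ _ hm
  have h₄ : b + searchTime m + 1 ≤ (b + 4 * K + 1) * m ^ 2 := by
    have : (b + 1) * 1 ≤ (b + 1) * m ^ 2 := Nat.mul_le_mul_left _ h₃
    calc b + searchTime m + 1 ≤ (b + 1) * m ^ 2 + K * (4 * m ^ 2) := by omega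
      _ = _ := by ring
  have h₅ : 4 * n * (b + searchTime m + 1) ≤ 4 * n * ((b + 4 * K + 1) * m ^ 2) :=
    Nat.mul_le_mul_left _ h₄
  calc a + (4 * n * (b + searchTime m + 1) + (b + 1) + c)
      ≤ a + (4 * n * ((b + 4 * K + 1) * m ^ 2) + (b + 1) + c) := by omega
    _ = (a + (b + 1) + c) + (4 * (b + 4 * K + 1)) * (n * m ^ 2) := by ring
    _ ≤ (a + (b + 1) + c) * (n * m ^ 2 + 1) + (4 * (b + 4 * K + 1)) * (n * m ^ 2 + 1) := by
        gcongr
        · exact Nat.le_mul_of_pos_right _ (by omega)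
        · omega
    _ = _ := by ring

end Time

/-! ### Lengths of addresses. -/

section Space

variable {n m s₀ s₂ X : ℕ}

/-- Each term is at most its coefficient times `X ^ 3`. The growth per vertex gives 14 * 4 + 7 + 7 =
70, and the parts below the heap add up to 23. -/
theorem heapAddr_le (hX : 1 ≤ X) (hn : n ≤ X) (hm : m ≤ X) (h₀ : s₀ ≤ X) (h₂ : s₂ ≤ X) :
    heapAddr n m s₀ s₂ + growth m * n ≤ 93 * X ^ 3 ∧ growth m ≤ 70 * X ^ 3 := by
  have e₁ : X ≤ X ^ 2 := by nlinarith
  have e₂ : X ^ 2 ≤ X ^ 3 := by nlinarith [sq_nonneg X]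
  have e₃ : s₂ * m * m ≤ X ^ 3 := by
    calc s₂ * m * m ≤ X * X * X := by gcongr
      _ = X ^ 3 := by ring
  have e₄ : n * (2 * m + 4) ≤ 2 * X ^ 2 + 4 * X := by
    calc n * (2 * m + 4) ≤ X * (2 * X + 4) := by gcongr
      _ = _ := by ring
  have e₅ : growth m ≤ 70 * X ^ 2 := by
    have : (m + 1) * (m + 1) ≤ (X + 1) * (X + 1) := by gcongr
    have : (X + 1) * (X + 1) ≤ 4 * X ^ 2 := by nlinarith
    simp only [growth]
    omega
  have e₆ : growth m * n ≤ 70 * X ^ 3 := by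
    calc growth m * n ≤ 70 * X ^ 2 * X := by gcongr
      _ = _ := by ring
  simp only [heapAddr, stackAddr, tableAddr, finAddr, nodeAddr, leafAddr]
  constructor <;> omega

theorem two_pow_room {w S : ℕ} (hn : n ≤ 2 ^ w) (hm : m ≤ 2 ^ w) (h₀ : s₀ ≤ 2 ^ w)
    (h₂ : s₂ ≤ 2 ^ w) :
    heapAddr n m s₀ s₂ + growth m * n + growth m + 14 < 2 ^ (11 * (w + S + 1)) := by
  have hX : 1 ≤ 2 ^ w := Nat.one_le_two_pow
  obtain ⟨h₁, h₃⟩ := heapAddr_le hX hn hm h₀ h₂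
  have h₄ : 1 ≤ (2 ^ w) ^ 3 := Nat.one_le_pow _ _ hX
  have h₅ : 2 ^ 11 * (2 ^ w) ^ 3 ≤ 2 ^ (11 * (w + S + 1)) := by
    rw [← pow_mul, ← pow_add]
    exact Nat.pow_le_pow_right (by norm_num) (by omega)
  omega

/-- The constant 11 comes from here: with `Y = (2 ^ w) ^ 3` and `M = 2 ^ n`, the bound is at most (6
+ 15) * 93 + 30 + 10 = 1993 times `M * Y`, and 1993 is less than 2 ^ 11. -/
theorem two_pow_addrBound {w S top : ℕ} (hn : n ≤ 2 ^ w) (hm : m ≤ 2 ^ w) (h₀ : s₀ ≤ 2 ^ w)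
    (h₂ : s₂ ≤ 2 ^ w) (htop : top ≤ heapAddr n m s₀ s₂ + growth m * n) (hS : n ≤ S) :
    addrBound top (2 ^ n) (2 ^ n) + 10 < 2 ^ (11 * (w + S + 1)) := by
  have hX : 1 ≤ 2 ^ w := Nat.one_le_two_pow
  have h₁ := htop.trans (heapAddr_le hX hn hm h₀ h₂).1
  have h₄ : 1 ≤ (2 ^ w) ^ 3 := Nat.one_le_pow _ _ hX
  have h₅ : 2 ^ n * (2 ^ 11 * (2 ^ w) ^ 3) ≤ 2 ^ (11 * (w + S + 1)) := by
    rw [← pow_mul, ← pow_add, ← pow_add]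
    exact Nat.pow_le_pow_right (by norm_num) (by omega)
  refine lt_of_lt_of_le ?_ h₅
  have hM : 1 ≤ 2 ^ n := Nat.one_le_two_pow
  generalize (2 ^ w) ^ 3 = Y at *
  generalize 2 ^ n = M at *
  have h₆ : M * top ≤ M * (93 * Y) := Nat.mul_le_mul_left _ h₁
  have h₇ : 1 * top ≤ M * top := Nat.mul_le_mul_right _ hM
  have h₈ : M * 1 ≤ M * Y := Nat.mul_le_mul_left _ h₄
  have e : addrBound top M M = 6 * top + 15 * (M * top) + 30 * M := by
    rw [addrBound]; ring
  have e' : M * (2 ^ 11 * Y) = 2048 * (M * Y) := by ring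
  have e'' : M * (93 * Y) = 93 * (M * Y) := by ring
  rw [e, e']
  rw [e''] at h₆
  omega

end Space

/-! ### Assembling the two phases. -/

section Final

open Quiver (Path)

variable {C : Type u} [Category.{v} C] {m s₀ s₂ : ℕ}
  {B : DBUTA (Fin m) (Fin s₀ × Bool) (Fin s₂)} {D : DecDAG C (Fin s₀) (Fin s₂)}
  {code : ∀ x y : C, (x ⟶ y) → ℕ} {op : ℕ → ℕ → ℕ} {w : ℕ}

/-- The state in which the preprocessing starts. -/
def inputState (input : List ℕ) : St :=
  { var := fun _ => 0, mem := fun a => input.getD a 0, out := [] }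

theorem sim_inputState (input : List ℕ) : Sim (inputState input) (initConfig input) :=
  ⟨fun _ => rfl, rfl, rfl⟩

theorem reach_preCmd (h : RegisterAssumption D code op w) (hm : m ≤ 2 ^ w) (h₀ : s₀ ≤ 2 ^ w)
    (h₂ : s₂ ≤ 2 ^ w) {W : ℕ} (hW : 11 * (w + D.size + 1) * preCmd.weight ≤ W)
    (hNW : 11 * (w + D.size + 1) ≤ W) :
    ∃ T ≤ preTime D.n m, ∃ τ, Reach op (preCmd.code 0) W T (initConfig (encodeInput B D code)) τ ∧
      Halted (preCmd.code 0) τ ∧ (∀ a, τ.mem a < 2 ^ (11 * (w + D.size + 1))) ∧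
      ∃ top, DataMem B D code (fun a => (encodeInput B D code).getD a 0) τ.mem top := by
  set N := 11 * (w + D.size + 1) with hN
  have hlt : ∀ a, (encodeInput B D code).getD a 0 < 2 ^ N :=
    encodeInput_lt B D code h hm h₀ h₂ (by omega)
  have hbd : (inputState (encodeInput B D code)).Bounded N := ⟨fun _ => Nat.two_pow_pos _, hlt⟩
  obtain ⟨T, hT, s, hex, hs, top, htop⟩ := tri_preCmd (s := inputState (encodeInput B D code))
    (h.coding (show w ≤ N by omega)) (by omega) (inputMem B D code)
    (two_pow_room h.vertex_fits hm h₀ h₂) (fun _ => rfl) rfl hbd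
  have hfit : (initConfig (encodeInput B D code)).Fits W :=
    Config.Fits.mono (W := N) ⟨fun _ => Nat.two_pow_pos _, hlt⟩ hNW
  obtain ⟨τ, hr, hpc, hsim⟩ := hex.reach (P := preCmd.code 0) (by omega) hbd hW (codeAt_self _) rfl
    (sim_inputState _) hfit
  refine ⟨T, hT, τ, hr, .inl ?_, fun a => ?_, top, ?_⟩
  · rw [List.getElem?_eq_none_iff, Cmd.length_code, hpc, zero_add]
  · rw [hsim.2.1]; exact hs.2 a
  · rw [hsim.2.1]; exact htop

theorem enumer_of_dataMem (h : RegisterAssumption D code op w) (hm : m ≤ 2 ^ w) (h₀ : s₀ ≤ 2 ^ w)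
    (h₂ : s₂ ≤ 2 ^ w) {W : ℕ} (hW : 11 * (w + D.size + 1) * enumCmd.weight ≤ W)
    (hNW : 11 * (w + D.size + 1) ≤ W) {mem : ℕ → ℕ} {top : ℕ}
    (hmem : ∀ a, mem a < 2 ^ (11 * (w + D.size + 1)))
    (hd : DataMem B D code (fun a => (encodeInput B D code).getD a 0) mem top) (x : D.V) :
    ∃ L, Enumer op (enumCmd.code 0) W enumConst (queryConfig mem x.val) L ∧
      multisets L = answers B D code x := by
  have hin := inputMem B D code
  have hrow : mem 0 + x.val * mem 1 = rowAddr D.n m s₀ s₂ x.val := by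
    rw [hd.table, hd.width]; rfl
  have hroom := two_pow_room (S := D.size) h.vertex_fits hm h₀ h₂
  have hxs : rowAddr D.n m s₀ s₂ x.val + (2 * m + 4) ≤ stackAddr D.n m s₀ s₂ :=
    rowAddr_add_le_stackAddr x.2
  have hheap : heapAddr D.n m s₀ s₂ = stackAddr D.n m s₀ s₂ + D.n + 1 := rfl
  have hxn : x.val < D.n := x.2
  have htop := hd.top_ge
  have hbd : (queryState mem x.val).Bounded (11 * (w + D.size + 1)) := by
    refine ⟨fun y => ?_, hmem⟩
    simp only [queryState]
    split_ifs <;> omega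
  -- Solutions have at most as many elements as the unfolding has leaves, so `2 ^ D.n` serves as the
  -- size bound `M` of the enumeration.
  have hcard : ∀ a ∈ finalSem (fun t => (encodeInput B D code).getD (finAddr D.n m s₀ s₂ + t) 0)
      (vertexSols B D code x) m x .nil, a.card ≤ 2 ^ D.n := by
    intro a ha
    obtain ⟨t, -, ha⟩ := Multiset.mem_sum.1 ha
    split_ifs at ha
    · simp at ha
    · exact card_le_of_mem_vertexSols B D code ha
  obtain ⟨L, hL, hL'⟩ := enumer_enumCmd (cd := pathCode D code) (x := x) (M := 2 ^ D.n)
    (lo := heapAddr D.n m s₀ s₂) (q := x.val) (h.coding (show w ≤ 11 * (w + D.size + 1) by omega))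
    (by omega) (by omega)
    (two_pow_addrBound (S := D.size) h.vertex_fits hm h₀ h₂ hd.top_le (Nat.le_add_right _ _))
    hW hNW (mem := mem) hbd hd.top_eq (by omega) (by rw [hrow]; omega)
    (by rw [hrow]; exact (hd.rows x).root) hcard
  refine ⟨L, hL, hL'.trans ?_⟩
  rw [answers_eq, hrow, hd.fin, (hd.rows x).empty, hd.final _ (emptyState B D x).2, hin.final]
  congr 1
  · simp
  · refine Finset.sum_congr rfl fun t ht => ?_
    have ht' := Finset.mem_range.1 ht
    rw [dif_pos ht']
    have := hin.final ⟨t, ht'⟩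
    simp only at this
    simp only [this]
    split_ifs <;> simp_all

end Final

end DAGEnum

theorem mainTheorem3 (C : Type u) [Category.{v} C] :
    ∃ (pre enum : DAGEnum.Program) (c : ℕ),
      ∀ (m s₀ s₂ w : ℕ) (B : DAGEnum.DBUTA (Fin m) (Fin s₀ × Bool) (Fin s₂))
        (D : DAGEnum.DecDAG C (Fin s₀) (Fin s₂))
        (code : ∀ x y : C, (x ⟶ y) → ℕ) (op : ℕ → ℕ → ℕ),
        DAGEnum.RegisterAssumption D code op w →
        m ≤ 2 ^ w → s₀ ≤ 2 ^ w → s₂ ≤ 2 ^ w →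
        (∀ t, (DAGEnum.run op pre t (DAGEnum.initConfig (DAGEnum.encodeInput B D code))).Fits
          (c * (w + D.size + 1))) ∧
        ∃ T ≤ c * (D.size * m ^ 2 + 1), ∃ τ : DAGEnum.Config,
          τ = DAGEnum.run op pre T (DAGEnum.initConfig (DAGEnum.encodeInput B D code)) ∧
          DAGEnum.Halted pre τ ∧
          ∀ v₀ : D.V,
            (∀ t, (DAGEnum.run op enum t (DAGEnum.queryConfig τ.mem v₀.val)).Fits
              (c * (w + D.size + 1))) ∧
            DAGEnum.EnumeratesLinearDelay op enum c (DAGEnum.queryConfig τ.mem v₀.val)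
              (DAGEnum.answers B D code v₀) := by
  obtain ⟨K, hK⟩ := DAGEnum.preTime_le
  set c := 11 * (DAGEnum.preCmd.weight + DAGEnum.enumCmd.weight + 1) + K + 3 * DAGEnum.enumConst
    with hc
  refine ⟨DAGEnum.preCmd.code 0, DAGEnum.enumCmd.code 0, c, fun m s₀ s₂ w B D code op h hm h₀ h₂ => ?_⟩
  -- If there is a vertex, then the automaton has a state, namely the one for the empty selection at
  -- that vertex.
  have hpos : 0 < D.n → 0 < m := fun hn => Fin.pos (DAGEnum.emptyState B D ⟨0, hn⟩)
  -- Structured states have 11 * (w + size + 1) bits; intermediate results of expressions multiply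
  -- this by the weight of the program.
  have hW : ∀ k, 11 * k ≤ c → 11 * (w + D.size + 1) * k ≤ c * (w + D.size + 1) := fun k hk => by
    rw [mul_right_comm]
    exact Nat.mul_le_mul_right _ hk
  have hNW : 11 * (w + D.size + 1) ≤ c * (w + D.size + 1) := Nat.mul_le_mul_right _ (by omega)
  obtain ⟨T, hT, τ, hr, hh, hmem, top, hd⟩ := DAGEnum.reach_preCmd (B := B) h hm h₀ h₂
    (hW DAGEnum.preCmd.weight (by omega)) hNW
  refine ⟨hr.fits_of_halted hh, T, ?_, τ, hr.1.symm, hh, fun v₀ => ?_⟩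
  · calc T ≤ K * (D.n * m ^ 2 + 1) := hT.trans (hK _ _ hpos)
      _ ≤ c * (D.size * m ^ 2 + 1) := by
          have h₁ : D.n ≤ D.size := Nat.le_add_right _ _
          have h₂ : K ≤ c := by omega
          gcongr
  · obtain ⟨L, hL, hL'⟩ := DAGEnum.enumer_of_dataMem h hm h₀ h₂
      (hW DAGEnum.enumCmd.weight (by omega)) hNW hmem hd v₀
    refine ⟨hL.fits, ?_⟩
    rw [← hL']
    exact (hL.enumeratesLinearDelay rfl).mono (by omega)
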